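/- **Proposition (partition function of the resolved conifold with one outer brane).** Let $\lambda$, $t$ be formal parameters, $q=e^{\sqrt{-1}\lambda}$, and $Q=-e^{-t}$; all identities are between formal power series with coefficients in $\mathbb C((\lambda))[[e^{-t}]]$. Let $a$ be the framing (an integer, or more generally any complex number). *Notation.* For a partition $\mu$ let $|\mu|$, $l(\mu)$, $\mu^t$ be its size, length and transpose, $\kappa_\mu=\sum_i\mu_i(\mu_i-2i+1)$, $z_\mu=\prod_n n^{m_n}m_n!$ where $m_n$ is the multiplicity of the part $n$, and $p_\mu=\prod_i p_{\mu_i}$ the Newton functions. Let $s_{\mu/\eta}$ be the skew Schur functions and $\chi_\mu$ the irreducible characters of the symmetric groups, so that $s_\mu=\sum_\eta \frac{\chi_\mu(\eta)}{z_\eta}p_\eta$. For a symmetric function $f$, $f(q^{\mu+\rho})$ denotes its value at $(q^{\mu_i-i+1/2})_{i\ge 1}$, where the tails of the power sums are summed as $\sum_{i\ge1}q^{n(-i+1/2)}=1/(q^{n/2}-q^{-n/2})$. The topological vertex is $$C_{\mu^1,\mu^2,\mu^3}(q)=q^{(\kappa_{\mu^2}+\kappa_{\mu^3})/2}\,s_{(\mu^2)^t}(q^{\rho})\sum_{\eta}s_{\mu^1/\eta}(q^{(\mu^2)^t+\rho})\,s_{(\mu^3)^t/\eta}(q^{\mu^2+\rho}).$$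 *Open string amplitude.* Let $$\tilde Z^{(a)}(\lambda;t;\mathbf p)=\sum_{\mu,\nu,\eta}q^{a\kappa_\mu/2}\,C_{\mu,(0),\nu^t}(q)\,Q^{|\nu|}\,C_{\nu,(0),(0)}(q)\,\frac{\chi_\mu(\eta)}{z_\eta\sqrt{-1}^{\,l(\eta)}}\,p_\eta ,$$ where $|\eta|=|\mu|$ in the sum, let $\hat{\tilde Z}^{(a)}=\tilde Z^{(a)}/\tilde Z^{(a)}|_{\mathbf p=0}$, and for $g,k\ge 0$ and nonempty $\mu$ let $\tilde F^{(a)}_{g;k;\mu}$ be the coefficient of $\lambda^{2g-2+l(\mu)}e^{-kt}p_\mu$ in $\log\hat{\tilde Z}^{(a)}$. For $g\ge0$, $n\ge1$ put $$\Phi_{g,n}(x_1,\dots,x_n)=\sum_{l(\mu)=n}\ \sum_{k\ge0}\sqrt{-1}^{\,n}\,\tilde F^{(a)}_{g;k;\mu}\,e^{-kt}\sum_{\sigma\in S_n}x_{\sigma(1)}^{\mu_1}\cdots x_{\sigma(n)}^{\mu_n}.$$ *Statement.* The partition function $$Z=\exp\sum_{n\ge1}\frac1{n!}\sum_{g\ge0}\lambda^{2g-2+n}\,\Phi_{g,n}(x,\dots,x)$$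 is given by $$Z=\sum_{n\ge0}\ \prod_{j=1}^n\frac{e^{-t}-q^{j-1}}{1-q^j}\cdot q^{an(n-1)/2+n/2}\,x^n,$$ or, equivalently, $$Z=\sum_{n\ge0}\ \prod_{j=1}^n\frac{1-e^{-t}q^{-(j-1)}}{1-q^{-j}}\cdot q^{an(n-1)/2-n/2}\,x^n.$$ -/

import Mathlib

noncomputable section

namespace ResolvedConifold

/-! ### Partitions

Partitions are Young diagrams: `μ.card` is `|μ|`, `μ.rowLen i` is the part `μ_{i+1}`,
`μ.colLen 0` is the length `l(μ)`, `⊥` is the empty partition. -/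

theorem finite_partitionsOf (d : ℕ) : {μ : YoungDiagram | μ.card = d}.Finite := by
  have hinj : Set.InjOn YoungDiagram.cells {μ : YoungDiagram | μ.card = d} :=
    fun μ _ ν _ h => YoungDiagram.ext h
  refine Set.Finite.of_finite_image (f := YoungDiagram.cells) ?_ hinj
  refine Set.Finite.subset
    (Finset.finite_toSet ((Finset.range d ×ˢ Finset.range d).powerset)) ?_
  rintro s ⟨μ, hμ, rfl⟩
  have hμ' : μ.cells.card = d := hμ
  simp only [Finset.coe_powerset, Set.mem_preimage, Set.mem_powerset_iff, Finset.coe_subset]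
  rintro ⟨i, j⟩ hij
  have hij' : (i, j) ∈ μ := hij
  rw [Finset.mem_product, Finset.mem_range, Finset.mem_range]
  constructor
  · have h1 : (Finset.range (i + 1)).image (fun k => (k, j)) ⊆ μ.cells := by
      intro x hx
      obtain ⟨k, hk, rfl⟩ := Finset.mem_image.mp hx
      exact μ.up_left_mem (Nat.lt_succ_iff.mp (Finset.mem_range.mp hk)) le_rfl hij'
    have h2 := Finset.card_le_card h1
    rw [Finset.card_image_of_injective _ (fun a b h => (Prod.ext_iff.mp h).1),
      Finset.card_range] at h2
    omega
  · have h1 : (Finset.range (j + 1)).image (fun k => (i, k)) ⊆ μ.cells := by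
      intro x hx
      obtain ⟨k, hk, rfl⟩ := Finset.mem_image.mp hx
      exact μ.up_left_mem le_rfl (Nat.lt_succ_iff.mp (Finset.mem_range.mp hk)) hij'
    have h2 := Finset.card_le_card h1
    rw [Finset.card_image_of_injective _ (fun a b h => (Prod.ext_iff.mp h).2),
      Finset.card_range] at h2
    omega

/-- The finite set of all partitions of `d`. -/
def partitionsOf (d : ℕ) : Finset YoungDiagram := (finite_partitionsOf d).toFinset

theorem mem_partitionsOf {d : ℕ} {μ : YoungDiagram} : μ ∈ partitionsOf d ↔ μ.card = d := by
  simp [partitionsOf]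

/-- The length `l(μ)`. -/
def len (μ : YoungDiagram) : ℕ := μ.colLen 0

/-- `κ_μ = ∑_{i=1}^{l(μ)} μ_i (μ_i - 2 i + 1)`. -/
def kappa (μ : YoungDiagram) : ℤ :=
  ∑ i ∈ Finset.range (len μ),
    (μ.rowLen i : ℤ) * ((μ.rowLen i : ℤ) - 2 * ((i : ℤ) + 1) + 1)

/-- The monomial `p_μ = ∏_{i=1}^{l(μ)} p_{μ_i}` in the variables `p_1, p_2, …`, as an exponent
vector: the value at `n` is the multiplicity of the part `n` in `μ`. -/
def pExp (μ : YoungDiagram) : ℕ+ →₀ ℕ :=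
  ∑ i ∈ Finset.range (len μ), Finsupp.single (Nat.toPNat' (μ.rowLen i)) 1

/-- `|η|` for the partition `η` whose multiplicity vector is `m`. -/
def expSize (m : ℕ+ →₀ ℕ) : ℕ := m.sum fun n c => (n : ℕ) * c

/-- `l(η)` for the partition `η` whose multiplicity vector is `m`. -/
def expLen (m : ℕ+ →₀ ℕ) : ℕ := m.sum fun _ c => c

/-- `z_η = ∏_n n ^ {m_n} m_n !` for the partition `η` whose multiplicity vector is `m`. -/
def expZ (m : ℕ+ →₀ ℕ) : ℕ := m.prod fun n c => (n : ℕ) ^ c * c.factorial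

/-! ### Symmetric functions

The ring of symmetric functions over `ℚ` is the polynomial ring in the Newton functions
`p_1, p_2, …`. -/

/-- The ring of symmetric functions with rational coefficients. -/
abbrev SymmFun : Type := MvPolynomial ℕ+ ℚ

/-- `∑_n h_n z^n = exp (∑_{n ≥ 1} p_n z^n / n)`. -/
def hGen : PowerSeries SymmFun :=
  (PowerSeries.exp SymmFun).subst
    (PowerSeries.mk fun n : ℕ =>
      if h : 0 < n then
        MvPolynomial.C ((n : ℚ)⁻¹) * (MvPolynomial.X (⟨n, h⟩ : ℕ+) : SymmFun)
      else 0 : PowerSeries SymmFun)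

/-- The complete homogeneous symmetric function `h_n`, which is `0` for `n < 0`. -/
def hSymm (n : ℤ) : SymmFun := if n < 0 then 0 else PowerSeries.coeff n.toNat hGen

/-- The skew Schur function `s_{μ/η} = det (h_{μ_i - η_j - i + j})`
(it is `0` unless `η ⊆ μ`). -/
def skewSchur (μ η : YoungDiagram) : SymmFun :=
  Matrix.det (Matrix.of fun i j : Fin (max (len μ) (len η)) =>
    hSymm ((μ.rowLen i : ℤ) - (η.rowLen j : ℤ) - (i : ℤ) + (j : ℤ)))

/-- The Schur function `s_μ`. -/
def schur (μ : YoungDiagram) : SymmFun := skewSchur μ ⊥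

/-- The value `χ_μ(η)` of the irreducible character of the symmetric group indexed by `μ` on the
conjugacy class of cycle type `η` (given by its multiplicity vector `m`), defined by
`s_μ = ∑_η (χ_μ(η) / z_η) p_η`. -/
def symmChar (μ : YoungDiagram) (m : ℕ+ →₀ ℕ) : ℚ :=
  (expZ m : ℚ) * MvPolynomial.coeff m (schur μ)

/-! ### The topological vertex

All quantities are formal Laurent series in the genus variable `λ`, and `q = e^{√-1 λ}`. -/

/-- Formal Laurent series in `λ` with complex coefficients. -/
abbrev LambdaSeries : Type := LaurentSeries ℂ

/-- `q ^ c = e^{√-1 c λ}`. -/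
def qpow (c : ℂ) : LambdaSeries :=
  HahnSeries.ofPowerSeries ℤ ℂ (PowerSeries.rescale (Complex.I * c) (PowerSeries.exp ℂ))

/-- `[n] = q^{n/2} - q^{-n/2}`. -/
def qbr (n : ℕ) : LambdaSeries := qpow ((n : ℂ) / 2) - qpow (-((n : ℂ) / 2))

/-- The value of the Newton function `p_n` at `q^{μ+ρ} = (q^{μ_i - i + 1/2})_{i ≥ 1}`, i.e.
`∑_{i ≥ 1} q^{n (μ_i - i + 1/2)}`: the tail is summed by `∑_{i ≥ 1} q^{n (-i + 1/2)} = 1 / [n]`. -/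
def pAt (μ : YoungDiagram) (n : ℕ+) : LambdaSeries :=
  (qbr n)⁻¹ + ∑ i ∈ Finset.range (len μ),
    (qpow ((n : ℂ) * ((μ.rowLen i : ℂ) - ((i : ℂ) + 1) + 1 / 2))
      - qpow ((n : ℂ) * (-((i : ℂ) + 1) + 1 / 2)))

/-- The value `f(q^{μ+ρ})` of a symmetric function. -/
def evalAt (μ : YoungDiagram) (f : SymmFun) : LambdaSeries := MvPolynomial.aeval (pAt μ) f

/-- The topological vertex
`C_{μ₁,μ₂,μ₃}(q) = q^{(κ_{μ₂}+κ_{μ₃})/2} s_{μ₂ᵗ}(q^ρ)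
  ∑_η s_{μ₁/η}(q^{μ₂ᵗ+ρ}) s_{μ₃ᵗ/η}(q^{μ₂+ρ})`.
The sum is over all partitions `η`; the terms with `|η| > |μ₁|` vanish. -/
def vertex (μ₁ μ₂ μ₃ : YoungDiagram) : LambdaSeries :=
  qpow (((kappa μ₂ : ℂ) + (kappa μ₃ : ℂ)) / 2) * evalAt ⊥ (schur μ₂.transpose) *
    ∑ k ∈ Finset.range (μ₁.card + 1), ∑ η ∈ partitionsOf k,
      evalAt μ₂.transpose (skewSchur μ₁ η) * evalAt μ₂ (skewSchur μ₃.transpose η)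

/-! ### Open string amplitudes of the resolved conifold -/

/-- Formal power series in `e^{-t}` over the Laurent series in `λ`; the variable
`PowerSeries.X` is `e^{-t}`. -/
abbrev Coef : Type := PowerSeries LambdaSeries

/-- `∑_ν C_{μ,(0),νᵗ}(q) Q^{|ν|} C_{ν,(0),(0)}(q)` with `Q = -e^{-t}`. -/
def glued (μ : YoungDiagram) : Coef :=
  PowerSeries.mk fun k => ∑ ν ∈ partitionsOf k,
    vertex μ ⊥ ν.transpose * (-1) ^ k * vertex ν ⊥ ⊥

/-- The open string amplitude with framing `a`, a power series in `p_1, p_2, …`: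
`∑_{μ,ν,η} q^{a κ_μ/2} C_{μ,(0),νᵗ}(q) Q^{|ν|} C_{ν,(0),(0)}(q)
  (χ_μ(η) / (z_η √-1^{l(η)})) p_η`. -/
def amplitude (a : ℂ) : MvPowerSeries ℕ+ Coef := fun m =>
  ∑ μ ∈ partitionsOf (expSize m),
    PowerSeries.C (qpow (a * (kappa μ : ℂ) / 2)) * glued μ *
      PowerSeries.C (HahnSeries.C
        (((symmChar μ m : ℚ) : ℂ) / ((expZ m : ℂ) * Complex.I ^ expLen m)))

/-- The normalized amplitude: the amplitude divided by its value at `p = 0`. -/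
def normAmplitude (a : ℂ) : MvPowerSeries ℕ+ Coef :=
  MvPowerSeries.C (MvPowerSeries.constantCoeff (amplitude a))⁻¹ * amplitude a

/-- The logarithm of the normalized amplitude. -/
def freeEnergy (a : ℂ) : MvPowerSeries ℕ+ Coef :=
  (PowerSeries.log Coef).subst (normAmplitude a - 1)

/-- The open string invariant: the coefficient of `λ^{2g-2+l(μ)} e^{-kt} p_μ` in the logarithm of
the normalized amplitude. -/
def openInv (a : ℂ) (g k : ℕ) (μ : YoungDiagram) : ℂ :=
  HahnSeries.coeff (PowerSeries.coeff k (MvPowerSeries.coeff (pExp μ) (freeEnergy a)))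
    (2 * (g : ℤ) - 2 + (len μ : ℤ))

/-! ### Symmetrization and the partition function -/

/-- `∑_{σ ∈ S_n} x_{σ(1)}^{μ_1} ⋯ x_{σ(n)}^{μ_n}`. -/
def symmMonomial (n : ℕ) (μ : YoungDiagram) : MvPowerSeries (Fin n) (PowerSeries ℂ) :=
  ∑ σ : Equiv.Perm (Fin n), ∏ i : Fin n, MvPowerSeries.X (σ i) ^ μ.rowLen i

/-- `Φ_{g,n}(x_1, …, x_n) = ∑_{l(μ)=n} ∑_k √-1^n F_{g;k;μ} e^{-kt}
  ∑_{σ ∈ S_n} x_{σ(1)}^{μ_1} ⋯ x_{σ(n)}^{μ_n}`, with coefficients power series in `e^{-t}`.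
Only the `μ` with `|μ| = e_1 + ⋯ + e_n` contribute to the coefficient of `x^e`. -/
def Phi (a : ℂ) (g n : ℕ) : MvPowerSeries (Fin n) (PowerSeries ℂ) := fun e =>
  ∑ μ ∈ (partitionsOf (∑ i, e i)).filter (fun μ => len μ = n),
    (PowerSeries.mk fun k => Complex.I ^ n * openInv a g k μ) *
      MvPowerSeries.coeff e (symmMonomial n μ)

/-- `Φ_{g,n}(x, …, x)`. -/
def PhiDiag (a : ℂ) (g n : ℕ) : PowerSeries (PowerSeries ℂ) :=
  PowerSeries.mk fun d => ∑ e ∈ Finset.finsuppAntidiag Finset.univ d,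
    MvPowerSeries.coeff e (Phi a g n)

/-- `∑_{g ≥ 0} λ^{2g-2+n} c_g`. -/
def genusSum (n : ℕ) (c : ℕ → ℂ) : LambdaSeries :=
  HahnSeries.single ((n : ℤ) - 2) (1 : ℂ) *
    HahnSeries.ofPowerSeries ℤ ℂ (PowerSeries.mk fun j => if Even j then c (j / 2) else 0)

/-- `∑_{g ≥ 0} λ^{2g-2+n} Φ_{g,n}(x, …, x)`, a power series in `x`. -/
def nPoint (a : ℂ) (n : ℕ) : PowerSeries Coef :=
  PowerSeries.mk fun d => PowerSeries.mk fun k =>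
    genusSum n fun g => PowerSeries.coeff k (PowerSeries.coeff d (PhiDiag a g n))

/-- `∑_{n ≥ 1} (1 / n!) ∑_{g ≥ 0} λ^{2g-2+n} Φ_{g,n}(x, …, x)`. The terms with `n > d` do not
contribute to the coefficient of `x^d`, see `coeff_nPoint_of_lt`. -/
def logPartition (a : ℂ) : PowerSeries Coef :=
  PowerSeries.mk fun d => ∑ n ∈ Finset.Icc 1 d,
    ((n.factorial : ℚ)⁻¹) • PowerSeries.coeff d (nPoint a n)

/-- The partition function
`Z = exp (∑_{n ≥ 1} (1 / n!) ∑_{g ≥ 0} λ^{2g-2+n} Φ_{g,n}(x, …, x))`. -/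
def partitionFunction (a : ℂ) : PowerSeries Coef :=
  (PowerSeries.exp Coef).subst (logPartition a)

theorem len_le_card (μ : YoungDiagram) : len μ ≤ μ.card := by
  rw [len, YoungDiagram.colLen_eq_card]
  exact Finset.card_le_card (Finset.filter_subset _ _)

theorem coeff_nPoint_of_lt (a : ℂ) {d n : ℕ} (h : d < n) :
    PowerSeries.coeff d (nPoint a n) = 0 := by
  have h0 : ∀ g, PowerSeries.coeff d (PhiDiag a g n) = 0 := by
    intro g
    rw [PhiDiag, PowerSeries.coeff_mk]
    refine Finset.sum_eq_zero fun e he => ?_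
    rw [Finset.mem_finsuppAntidiag] at he
    change ∑ μ ∈ (partitionsOf (∑ i, e i)).filter (fun μ => len μ = n), _ = _
    refine Finset.sum_eq_zero fun μ hμ => ?_
    rw [Finset.mem_filter, mem_partitionsOf] at hμ
    have h1 := len_le_card μ
    have h2 : ∑ i, e i = d := he.1
    omega
  ext k : 1
  rw [nPoint, PowerSeries.coeff_mk, PowerSeries.coeff_mk]
  simp only [h0, map_zero]
  have h1 : (PowerSeries.mk fun j : ℕ => if Even j then (0 : ℂ) else 0) = 0 := by
    ext j
    simp
  rw [genusSum, h1, map_zero, mul_zero]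

end ResolvedConifold

end

/-!
The amplitude is glued from two vertices with an empty leg. The identity
`s_ν(q^ρ) = q^{κ_ν/2} s_{νᵗ}(q^ρ)` (`aeval_tau_schur`) absorbs the framing factor of the glued leg,
and the Cauchy identity for skew Schur functions (`sum_schur_mul_skewSchur`) evaluates the sum over
`ν`: up to the closed string factor, the coefficient of `s_μ` is the value of `s_μ` at the point
`spec`, where the Newton function `p_n` equals `(1 - e^{-nt}) / (q^{n/2} - q^{-n/2})`
(`glued_eq`). So the normalized amplitude is `∑_μ q^{a κ_μ/2} s_μ[spec] s_μ`, with `p_n` rescaled by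
`1/√-1` (`normAmplitude_eq`).

The partition function only sees the coefficients of the free energy at `λ^j` with `j ≥ l(η) - 2`
and `j ≡ l(η) mod 2`, and there are no others (`coeff_freeEnergy_mem`). The reason is the
cut-and-join equation. Schur functions are eigenfunctions of the cut-and-join operator with
eigenvalue `κ_μ` (`cutJoin_schur`), which is proved in finitely many variables, where the operator
becomes a second order operator acting on the numerators of the bialternant formula. Hence the
logarithm, as a polynomial function of the framing `a`, satisfies
`∂F/∂a = (√-1 λ/2) ∑ ((i + j) p_i p_j ∂_{i+j} F + i j p_{i+j} (∂_i ∂_j F + ∂_i F ∂_j F))`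
(`framingDerivation_coeff_framedLog`). At `a = 0` the Cauchy identity gives
`F = ∑_n spec_n p_n / n`, and `spec_n` is odd in `λ` with a simple pole, so the property holds there.
An induction on `|η|`, which takes care of the quadratic term, and on the power of `λ` propagates it
to all `a` (`coeff_framedLog_mem`).

Consequently the symmetrized sum of the `Φ_{g,n}` is the free energy at `p_n = x^n`, the factors
`√-1` cancel, and the partition function is `∑_μ q^{a κ_μ/2} s_μ[spec] s_μ(x)`
(`partitionFunction_eq`). In the single variable `x` only the one-row partitions survive; there
`κ_μ = d (d - 1)` for `d = |μ|`, so the coefficient of `x^d` is `q^{a d (d-1)/2} h_d[spec]`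
(`coeff_partitionFunction`). The relation `q^n spec_n = spec_n + q^{n/2} - (q^{1/2} e^{-t})^n`
translates into a first order recursion for `h_d[spec]`, which is the product formula.

Throughout, the Schur functions are given by the Jacobi-Trudi determinant in the polynomial ring in
the Newton functions. The Cauchy identities and the orthogonality relations are derived from the
bialternant formula, by extracting the coefficient of a staircase shift of `μ` from an alternating
polynomial (`schurCoeff`).
-/

noncomputable section

namespace ResolvedConifold

open Finset.HasAntidiagonal (antidiagonal mem_antidiagonal)

/-! ### Complete homogeneous symmetric functions -/

section Newton

variable {R : Type*} [CommRing R] [Algebra ℚ R]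

/-- The generating series `∑_n h_n(u) z^n` of the complete homogeneous symmetric functions at the
point where the Newton function `p_n` takes the value `u n`. -/
def hSer (u : ℕ+ → R) : PowerSeries R :=
  PowerSeries.map (MvPolynomial.aeval u : SymmFun →ₐ[ℚ] R).toRingHom hGen

/-- The series `∑_{n ≥ 0} u_{n+1} z^n`, the logarithmic derivative of `hSer u`. -/
def pSer (u : ℕ+ → R) : PowerSeries R := PowerSeries.mk fun n => u n.succPNat

/-- The series `∑_{n ≥ 1} p_n z^n / n`, whose exponential is `hGen`. -/
def pLogSer : PowerSeries SymmFun := PowerSeries.mk fun n : ℕ =>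
  if h : 0 < n then
    MvPolynomial.C ((n : ℚ)⁻¹) * (MvPolynomial.X (⟨n, h⟩ : ℕ+) : SymmFun)
  else 0

theorem constantCoeff_pLogSer : PowerSeries.constantCoeff pLogSer = 0 := by
  rw [← PowerSeries.coeff_zero_eq_constantCoeff_apply, pLogSer, PowerSeries.coeff_mk]
  simp

theorem hasSubst_pLogSer : PowerSeries.HasSubst pLogSer :=
  PowerSeries.HasSubst.of_constantCoeff_zero' constantCoeff_pLogSer

theorem hGen_eq : hGen = (PowerSeries.exp SymmFun).subst pLogSer := rfl

theorem derivative_hGen : PowerSeries.derivative SymmFun hGen =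
    pSer (fun n => (MvPolynomial.X n : SymmFun)) * hGen := by
  rw [hGen_eq, PowerSeries.derivative_subst hasSubst_pLogSer, PowerSeries.derivative_exp, mul_comm]
  congr 1
  ext1 n
  rw [PowerSeries.coeff_derivative, pLogSer, PowerSeries.coeff_mk, pSer, PowerSeries.coeff_mk,
    dif_pos n.succ_pos]
  have h1 : ((n : SymmFun) + 1) = MvPolynomial.C ((n : ℚ) + 1) := by simp
  rw [h1, mul_comm, ← mul_assoc, ← MvPolynomial.C_mul]
  have h2 : ((n : ℚ) + 1) * (((n + 1 : ℕ) : ℚ))⁻¹ = 1 := by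
    push_cast
    exact mul_inv_cancel₀ (by positivity)
  rw [h2, MvPolynomial.C_1, one_mul]
  rfl

theorem constantCoeff_hGen : PowerSeries.constantCoeff hGen = 1 := by
  have h : PowerSeries.constantCoeff (PowerSeries.exp SymmFun - 1) = 0 := by
    simp [PowerSeries.constantCoeff_exp]
  have h1 := PowerSeries.constantCoeff_subst_eq_zero (a := pLogSer) constantCoeff_pLogSer _ h
  rw [PowerSeries.subst_sub hasSubst_pLogSer, ← hGen_eq, map_sub] at h1
  have h2 : (1 : PowerSeries SymmFun).subst pLogSer = 1 := by
    rw [← PowerSeries.coe_substAlgHom hasSubst_pLogSer, map_one]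
  rw [h2, map_one, sub_eq_zero] at h1
  exact h1

theorem constantCoeff_hSer (u : ℕ+ → R) : PowerSeries.constantCoeff (hSer u) = 1 := by
  rw [hSer, ← PowerSeries.coeff_zero_eq_constantCoeff_apply, PowerSeries.coeff_map,
    PowerSeries.coeff_zero_eq_constantCoeff_apply, constantCoeff_hGen, map_one]

/-- Newton's identities: `H' = P H`. -/
theorem derivative_hSer (u : ℕ+ → R) :
    PowerSeries.derivative R (hSer u) = pSer u * hSer u := by
  have h := congrArg (PowerSeries.map (MvPolynomial.aeval u : SymmFun →ₐ[ℚ] R).toRingHom)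
    derivative_hGen
  rw [map_mul, ← hSer] at h
  convert h using 1
  · ext n
    simp [PowerSeries.coeff_derivative, hSer]
  · congr 1
    ext n
    simp [pSer]

theorem coeff_hSer (u : ℕ+ → R) (n : ℕ) :
    PowerSeries.coeff n (hSer u) = MvPolynomial.aeval u (hSymm n) := by
  have h : ¬ (n : ℤ) < 0 := by omega
  simp [hSer, hSymm, h]

/-- A linear differential equation `G' = P G` determines `G` from its constant term. -/
theorem eq_of_derivative_eq_mul {P G H : PowerSeries R}
    (h0 : PowerSeries.constantCoeff G = PowerSeries.constantCoeff H)
    (hG : PowerSeries.derivative R G = P * G) (hH : PowerSeries.derivative R H = P * H) :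
    G = H := by
  ext n
  induction n using Nat.strong_induction_on with
  | _ n ih =>
    rcases n with _ | n
    · simpa using h0
    · have h1 := congrArg (PowerSeries.coeff n) hG
      have h2 := congrArg (PowerSeries.coeff n) hH
      rw [PowerSeries.coeff_derivative, PowerSeries.coeff_mul] at h1 h2
      have h3 : PowerSeries.coeff (n + 1) G * ((n : R) + 1)
          = PowerSeries.coeff (n + 1) H * ((n : R) + 1) := by
        rw [h1, h2]
        refine Finset.sum_congr rfl fun p hp => ?_
        rw [ih p.2 (by have := mem_antidiagonal.mp hp; omega)]
      have h4 : ((n : R) + 1) * algebraMap ℚ R ((n + 1 : ℚ)⁻¹) = 1 := by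
        have : ((n : R) + 1) = algebraMap ℚ R (n + 1) := by simp
        rw [this, ← map_mul, mul_inv_cancel₀ (by positivity), map_one]
      calc _ = PowerSeries.coeff (n + 1) G * ((n : R) + 1) * algebraMap ℚ R ((n + 1 : ℚ)⁻¹) := by
            rw [mul_assoc, h4, mul_one]
        _ = _ := by rw [h3, mul_assoc, h4, mul_one]

theorem hSer_unique {u : ℕ+ → R} {G : PowerSeries R} (h0 : PowerSeries.constantCoeff G = 1)
    (h1 : PowerSeries.derivative R G = pSer u * G) : G = hSer u :=
  eq_of_derivative_eq_mul (by rw [h0, constantCoeff_hSer]) h1 (derivative_hSer u)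

theorem hSer_add (u v : ℕ+ → R) : hSer (u + v) = hSer u * hSer v := by
  refine (hSer_unique ?_ ?_).symm
  · rw [map_mul, constantCoeff_hSer, constantCoeff_hSer, one_mul]
  · rw [Derivation.leibniz, derivative_hSer, derivative_hSer]
    have : pSer (u + v) = pSer u + pSer v := by ext n; simp [pSer]
    rw [this, smul_eq_mul, smul_eq_mul]
    ring

theorem hSer_zero : hSer (0 : ℕ+ → R) = 1 := by
  refine (hSer_unique (by simp) ?_).symm
  have : pSer (0 : ℕ+ → R) = 0 := by ext n; simp [pSer]
  rw [this, zero_mul, PowerSeries.derivative_one]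

theorem hSer_sum {ι : Type*} (s : Finset ι) (u : ι → ℕ+ → R) :
    hSer (∑ i ∈ s, u i) = ∏ i ∈ s, hSer (u i) := by
  classical
  induction s using Finset.induction_on with
  | empty => simp [hSer_zero]
  | insert i s hi ih => rw [Finset.sum_insert hi, Finset.prod_insert hi, hSer_add, ih]

/-- In one variable `w` the complete homogeneous symmetric functions are the powers of `w`. -/
theorem hSer_geom (w : R) : hSer (fun n => w ^ (n : ℕ)) = PowerSeries.mk fun n => w ^ n := by
  refine (hSer_unique (by simp [← PowerSeries.coeff_zero_eq_constantCoeff_apply]) ?_).symm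
  ext n
  rw [PowerSeries.coeff_derivative, PowerSeries.coeff_mul, PowerSeries.coeff_mk]
  have h : ∀ p ∈ antidiagonal n, PowerSeries.coeff p.1 (pSer fun n => w ^ (n : ℕ)) *
      PowerSeries.coeff p.2 (PowerSeries.mk fun n => w ^ n) = w ^ (n + 1) := by
    intro p hp
    rw [pSer, PowerSeries.coeff_mk, PowerSeries.coeff_mk, ← mem_antidiagonal.mp hp,
      Nat.succPNat_coe, ← pow_add]
    congr 1
    omega
  rw [Finset.sum_congr rfl h, Finset.sum_const, Finset.Nat.card_antidiagonal, nsmul_eq_mul]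
  push_cast
  ring

theorem hSer_scale (c : R) (u : ℕ+ → R) :
    hSer (fun n => c ^ (n : ℕ) * u n) = PowerSeries.rescale c (hSer u) := by
  refine (hSer_unique ?_ ?_).symm
  · rw [← PowerSeries.coeff_zero_eq_constantCoeff_apply, PowerSeries.coeff_rescale]
    simp [constantCoeff_hSer]
  · ext n
    have h := congrArg (PowerSeries.coeff n) (derivative_hSer u)
    rw [PowerSeries.coeff_derivative, PowerSeries.coeff_mul] at h
    rw [PowerSeries.coeff_derivative, PowerSeries.coeff_mul, PowerSeries.coeff_rescale, mul_assoc,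
      h, Finset.mul_sum]
    refine Finset.sum_congr rfl fun p hp => ?_
    rw [PowerSeries.coeff_rescale, pSer, pSer, PowerSeries.coeff_mk, PowerSeries.coeff_mk,
      ← mem_antidiagonal.mp hp, Nat.succPNat_coe, Nat.succ_eq_add_one]
    ring

end Newton

theorem mk_pow_mul_one_sub {R : Type*} [CommRing R] (w : R) :
    (PowerSeries.mk fun n => w ^ n) * (1 - PowerSeries.C w * PowerSeries.X) = 1 := by
  ext n
  rcases n with _ | n
  · simp
  · rw [mul_sub, mul_one, map_sub, mul_comm (PowerSeries.C w), ← mul_assoc,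
      PowerSeries.coeff_mul_C, PowerSeries.coeff_succ_mul_X]
    simp [pow_succ, PowerSeries.coeff_one]

theorem hSymm_of_neg {n : ℤ} (h : n < 0) : hSymm n = 0 := by simp [hSymm, h]

theorem hSymm_zero : hSymm 0 = 1 := by
  simp [hSymm, constantCoeff_hGen]

theorem coeff_hGen (n : ℕ) : PowerSeries.coeff n hGen = hSymm n := by
  have h : ¬ (n : ℤ) < 0 := by omega
  simp [hSymm, h]

theorem newton_hSymm (n : ℕ) : hSymm ((n + 1 : ℕ) : ℤ) * ((n : SymmFun) + 1) =
    ∑ p ∈ antidiagonal n, MvPolynomial.X p.1.succPNat * hSymm p.2 := by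
  have h := congrArg (PowerSeries.coeff n) derivative_hGen
  rw [PowerSeries.coeff_derivative, PowerSeries.coeff_mul] at h
  simpa only [coeff_hGen, pSer, PowerSeries.coeff_mk] using h

theorem expSize_add (m m' : ℕ+ →₀ ℕ) : expSize (m + m') = expSize m + expSize m' := by
  classical
  exact Finsupp.sum_add_index' (by simp) (by intros; ring)

theorem expSize_single (n : ℕ+) (c : ℕ) : expSize (Finsupp.single n c) = n * c := by
  simp [expSize]

theorem expLen_add (m m' : ℕ+ →₀ ℕ) : expLen (m + m') = expLen m + expLen m' := by
  classical
  exact Finsupp.sum_add_index' (by simp) (by intros; ring)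

theorem expLen_single (n : ℕ+) (c : ℕ) : expLen (Finsupp.single n c) = c := by
  simp [expLen]

theorem expZ_pos (m : ℕ+ →₀ ℕ) : 0 < expZ m := by
  rw [expZ, Finsupp.prod]
  exact Finset.prod_pos fun n _ => Nat.mul_pos (pow_pos n.pos _) (Nat.factorial_pos _)

theorem expZ_ne_zero (m : ℕ+ →₀ ℕ) : (expZ m : ℚ) ≠ 0 :=
  Nat.cast_ne_zero.mpr (expZ_pos m).ne'

theorem expZ_add_single (m : ℕ+ →₀ ℕ) (n : ℕ+) :
    expZ (m + Finsupp.single n 1) = (n : ℕ) * (m n + 1) * expZ m := by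
  classical
  set s := insert n m.support
  have h1 : ∀ m' : ℕ+ →₀ ℕ, m'.support ⊆ s →
      expZ m' = ∏ k ∈ s, (k : ℕ) ^ m' k * (m' k).factorial := fun m' hm' =>
    Finsupp.prod_of_support_subset _ hm' _ (by simp)
  have hsub : (m + Finsupp.single n 1).support ⊆ s := by
    intro k hk
    by_cases h : k = n
    · simp [s, h]
    · have h' : n ≠ k := fun e => h e.symm
      simp [h'] at hk
      simp [s, hk]
  rw [h1 _ hsub, h1 m (Finset.subset_insert _ _), ← Finset.mul_prod_erase s _ (Finset.mem_insert_self n _),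
    ← Finset.mul_prod_erase s _ (Finset.mem_insert_self n _)]
  have h2 : ∏ k ∈ s.erase n, (k : ℕ) ^ (m + Finsupp.single n 1 : ℕ+ →₀ ℕ) k *
      ((m + Finsupp.single n 1 : ℕ+ →₀ ℕ) k).factorial = ∏ k ∈ s.erase n, (k : ℕ) ^ m k * (m k).factorial := by
    refine Finset.prod_congr rfl fun k hk => ?_
    have : n ≠ k := fun e => (Finset.ne_of_mem_erase hk) e.symm
    simp [this]
  rw [h2]
  simp only [Finsupp.add_apply, Finsupp.single_eq_same, pow_succ, Nat.factorial_succ]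
  ring

theorem expSize_eq_zero {m : ℕ+ →₀ ℕ} : expSize m = 0 ↔ m = 0 := by
  constructor
  · intro h
    rw [expSize, Finsupp.sum, Finset.sum_eq_zero_iff] at h
    ext n
    by_contra h1
    have := h n (Finsupp.mem_support_iff.mpr h1)
    have h2 := n.pos
    simp_all
  · rintro rfl
    simp [expSize]

/-- `h_d = ∑_{|η| = d} p_η / z_η`. -/
theorem coeff_hSymm (d : ℕ) (m : ℕ+ →₀ ℕ) :
    MvPolynomial.coeff m (hSymm d) = if expSize m = d then ((expZ m : ℚ))⁻¹ else 0 := by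
  classical
  induction d using Nat.strong_induction_on generalizing m with
  | _ d ih =>
    rcases d with _ | d
    · rw [Nat.cast_zero, hSymm_zero, MvPolynomial.coeff_one]
      by_cases h : m = 0
      · subst h; simp [expSize, expZ]
      · rw [if_neg (fun e => h e.symm), if_neg (fun e => h (expSize_eq_zero.mp e))]
    · have h := congrArg (MvPolynomial.coeff m) (newton_hSymm d)
      have e1 : ((d : SymmFun) + 1) = MvPolynomial.C ((d : ℚ) + 1) := by simp
      rw [e1, mul_comm, MvPolynomial.coeff_C_mul, MvPolynomial.coeff_sum] at h
      have h2 : ∀ p ∈ antidiagonal d,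
          MvPolynomial.coeff m (MvPolynomial.X p.1.succPNat * hSymm p.2) =
          if expSize m = d + 1 then
            ((p.1 + 1 : ℕ) * m p.1.succPNat : ℚ) * (expZ m : ℚ)⁻¹ else 0 := by
        intro p hp
        have hp' := mem_antidiagonal.mp hp
        rw [MvPolynomial.coeff_X_mul']
        by_cases hs : p.1.succPNat ∈ m.support
        · rw [if_pos hs]
          obtain ⟨m', rfl⟩ : ∃ m', m = m' + Finsupp.single p.1.succPNat 1 :=
            ⟨m - Finsupp.single p.1.succPNat 1, (tsub_add_cancel_of_le (by
              rw [Finsupp.single_le_iff]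
              exact Nat.one_le_iff_ne_zero.mpr (Finsupp.mem_support_iff.mp hs))).symm⟩
          rw [add_tsub_cancel_right, ih p.2 (by omega), expSize_add, expSize_single,
            expZ_add_single]
          have e2 : (expSize m' = p.2) ↔ expSize m' + ↑p.1.succPNat * 1 = d + 1 := by
            rw [Nat.succPNat_coe]; omega
          simp only [e2]
          split_ifs
          · rw [Finsupp.add_apply, Finsupp.single_eq_same, Nat.succPNat_coe]
            push_cast
            have := expZ_ne_zero m'
            field_simp
          · rfl
        · rw [if_neg hs]
          rw [Finsupp.notMem_support_iff] at hs
          simp [hs]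
      rw [Finset.sum_congr rfl h2] at h
      by_cases hd : expSize m = d + 1
      · simp only [hd, if_true] at h ⊢
        rw [← Finset.sum_mul] at h
        have h3 : (∑ p ∈ antidiagonal d, ((p.1 + 1 : ℕ) * m p.1.succPNat : ℚ)) = d + 1 := by
          rw [Finset.Nat.sum_antidiagonal_eq_sum_range_succ
            (fun i _ => ((i + 1 : ℕ) * m i.succPNat : ℚ))]
          have h4 : expSize m = ∑ i ∈ Finset.range (d + 1), (i + 1) * m i.succPNat := by
            have : m.support ⊆ (Finset.range (d + 1)).image Nat.succPNat := by
              intro n hn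
              have h5 : (n : ℕ) * m n ≤ expSize m :=
                Finset.single_le_sum (f := fun n : ℕ+ => (n : ℕ) * m n) (by simp) hn
              have h6 : (n : ℕ) ≤ (n : ℕ) * m n :=
                Nat.le_mul_of_pos_right _ (Nat.pos_of_ne_zero (Finsupp.mem_support_iff.mp hn))
              refine Finset.mem_image.mpr ⟨n.natPred, ?_, PNat.succPNat_natPred n⟩
              have := PNat.natPred_add_one n
              rw [Finset.mem_range]
              omega
            rw [expSize, Finsupp.sum_of_support_subset _ this _ (by simp),
              Finset.sum_image (fun a _ b _ h => Nat.succPNat_injective h)]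
            rfl
          have h5 : (d : ℚ) + 1 = (expSize m : ℚ) := by rw [hd]; push_cast; rfl
          rw [h5, h4]
          push_cast
          rfl
        rw [h3] at h
        exact mul_left_cancel₀ (by positivity) h
      · simp only [hd, if_false, Finset.sum_const_zero] at h ⊢
        exact (mul_eq_zero.mp h).resolve_left (by positivity)

/-! ### Partitions -/

theorem lt_len_iff {μ : YoungDiagram} {i : ℕ} : i < len μ ↔ 0 < μ.rowLen i := by
  rw [len, ← YoungDiagram.mem_iff_lt_colLen, YoungDiagram.mem_iff_lt_rowLen]

theorem rowLen_eq_zero {μ : YoungDiagram} {i : ℕ} (h : len μ ≤ i) : μ.rowLen i = 0 := by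
  have := (lt_len_iff (μ := μ) (i := i)).not
  omega

theorem sum_cells {M : Type*} [AddCommMonoid M] (μ : YoungDiagram) (f : ℕ × ℕ → M) :
    ∑ c ∈ μ.cells, f c = ∑ i ∈ Finset.range (len μ), ∑ j ∈ Finset.range (μ.rowLen i), f (i, j) := by
  refine Finset.sum_finset_product _ _ _ fun p => ?_
  have h1 : p ∈ μ ↔ p.2 < μ.rowLen p.1 := YoungDiagram.mem_iff_lt_rowLen
  rw [YoungDiagram.mem_cells, Finset.mem_range, Finset.mem_range, lt_len_iff, h1]
  exact ⟨fun h => ⟨Nat.zero_lt_of_lt h, h⟩, fun h => h.2⟩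

theorem sum_rowLen (μ : YoungDiagram) {N : ℕ} (h : len μ ≤ N) :
    ∑ i ∈ Finset.range N, μ.rowLen i = μ.card := by
  have h1 := sum_cells μ (fun _ => 1)
  simp only [Finset.sum_const, Finset.card_range, smul_eq_mul, mul_one] at h1
  rw [YoungDiagram.card, h1]
  refine (Finset.sum_subset (Finset.range_mono h) fun i _ hi => ?_).symm
  exact rowLen_eq_zero (by simpa using hi)

theorem sum_rowLen_fin (μ : YoungDiagram) {N : ℕ} (h : len μ ≤ N) :
    ∑ i : Fin N, μ.rowLen i = μ.card := by
  rw [Fin.sum_univ_eq_sum_range (fun i => μ.rowLen i), sum_rowLen μ h]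

/-- `κ_μ` is twice the sum of the contents `j - i` of the cells. -/
theorem kappa_eq_sum_cells (μ : YoungDiagram) :
    kappa μ = ∑ c ∈ μ.cells, 2 * ((c.2 : ℤ) - c.1) := by
  rw [sum_cells, kappa]
  refine Finset.sum_congr rfl fun i _ => ?_
  generalize μ.rowLen i = r
  induction r with
  | zero => simp
  | succ r ih =>
    rw [Finset.sum_range_succ, ← ih]
    push_cast
    ring

theorem kappa_transpose (μ : YoungDiagram) : kappa μ.transpose = -kappa μ := by
  rw [kappa_eq_sum_cells, kappa_eq_sum_cells, ← Finset.sum_neg_distrib]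
  refine Finset.sum_nbij' Prod.swap Prod.swap ?_ ?_ ?_ ?_ ?_
  · intro c hc
    rwa [YoungDiagram.mem_cells, YoungDiagram.mem_transpose] at hc
  · intro c hc
    rwa [YoungDiagram.mem_cells, YoungDiagram.mem_transpose, Prod.swap_swap]
  · simp
  · simp
  · intro c _
    simp
    ring

theorem len_bot : len ⊥ = 0 := by
  have : (⊥ : YoungDiagram).card = 0 := by simp [YoungDiagram.card]
  have := len_le_card ⊥
  omega

theorem card_bot : (⊥ : YoungDiagram).card = 0 := by simp [YoungDiagram.card]

theorem rowLen_bot (i : ℕ) : (⊥ : YoungDiagram).rowLen i = 0 :=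
  rowLen_eq_zero (by rw [len_bot]; omega)

theorem kappa_bot : kappa ⊥ = 0 := by simp [kappa, len_bot]

theorem card_eq_zero {μ : YoungDiagram} : μ.card = 0 ↔ μ = ⊥ := by
  constructor
  · intro h
    exact YoungDiagram.ext (by rw [YoungDiagram.cells_bot]; exact Finset.card_eq_zero.mp h)
  · rintro rfl; exact card_bot

theorem card_transpose (μ : YoungDiagram) : μ.transpose.card = μ.card := by
  refine Finset.card_nbij' Prod.swap Prod.swap ?_ ?_ ?_ ?_
  · intro c hc
    simpa [YoungDiagram.mem_transpose] using hc
  · intro c hc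
    simpa [YoungDiagram.mem_transpose] using hc
  · simp [Set.LeftInvOn]
  · simp [Set.LeftInvOn]

theorem transpose_bot : (⊥ : YoungDiagram).transpose = ⊥ :=
  card_eq_zero.mp (by rw [card_transpose, card_bot])

theorem partitionsOf_zero : partitionsOf 0 = {⊥} := by
  ext μ
  rw [mem_partitionsOf, card_eq_zero, Finset.mem_singleton]

theorem eq_of_rowLen_eq {μ ν : YoungDiagram} (h : ∀ i, μ.rowLen i = ν.rowLen i) : μ = ν := by
  refine YoungDiagram.ext ?_
  ext ⟨i, j⟩
  rw [YoungDiagram.mem_cells, YoungDiagram.mem_cells, YoungDiagram.mem_iff_lt_rowLen,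
    YoungDiagram.mem_iff_lt_rowLen, h]

theorem toPNat'_rowLen {μ : YoungDiagram} {i : ℕ} (h : i < len μ) :
    ((Nat.toPNat' (μ.rowLen i) : ℕ+) : ℕ) = μ.rowLen i := by
  rw [Nat.toPNat'_coe, if_pos (lt_len_iff.mp h)]

theorem expSize_sum {ι : Type*} (s : Finset ι) (f : ι → ℕ+ →₀ ℕ) :
    expSize (∑ i ∈ s, f i) = ∑ i ∈ s, expSize (f i) := by
  classical
  induction s using Finset.induction_on with
  | empty => simp [expSize]
  | insert i s hi ih => rw [Finset.sum_insert hi, Finset.sum_insert hi, expSize_add, ih]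

theorem expLen_sum {ι : Type*} (s : Finset ι) (f : ι → ℕ+ →₀ ℕ) :
    expLen (∑ i ∈ s, f i) = ∑ i ∈ s, expLen (f i) := by
  classical
  induction s using Finset.induction_on with
  | empty => simp [expLen]
  | insert i s hi ih => rw [Finset.sum_insert hi, Finset.sum_insert hi, expLen_add, ih]

theorem expSize_pExp (μ : YoungDiagram) : expSize (pExp μ) = μ.card := by
  rw [pExp, expSize_sum, ← sum_rowLen μ le_rfl]
  refine Finset.sum_congr rfl fun i hi => ?_
  rw [expSize_single, toPNat'_rowLen (Finset.mem_range.mp hi), mul_one]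

theorem expLen_pExp (μ : YoungDiagram) : expLen (pExp μ) = len μ := by
  rw [pExp, expLen_sum]
  simp [expLen_single]

/-- The multiset of parts of `μ`. -/
theorem map_toMultiset_pExp (μ : YoungDiagram) :
    (Finsupp.toMultiset (pExp μ)).map (fun n : ℕ+ => (n : ℕ)) = (μ.rowLens : Multiset ℕ) := by
  rw [pExp, map_sum]
  simp only [Finsupp.toMultiset_single, one_smul]
  rw [YoungDiagram.rowLens, ← Multiset.map_coe, Multiset.coe_range, ← len]
  have h : ∀ s : Finset ℕ, (∑ i ∈ s, ({Nat.toPNat' (μ.rowLen i)} : Multiset ℕ+)) =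
      s.val.map (fun i => Nat.toPNat' (μ.rowLen i)) := fun s =>
    Multiset.bind_singleton _ _
  rw [h, Multiset.map_map, Finset.range_val]
  refine Multiset.map_congr rfl fun i hi => ?_
  exact toPNat'_rowLen (Multiset.mem_range.mp hi)

theorem pExp_injective : Function.Injective pExp := by
  intro μ ν h
  have h1 := map_toMultiset_pExp μ
  rw [h, map_toMultiset_pExp, Multiset.coe_eq_coe] at h1
  have h2 : μ.rowLens = ν.rowLens :=
    (h1.eq_of_sortedGE ν.rowLens_sorted μ.rowLens_sorted).symm
  exact YoungDiagram.equivListRowLens.injective (Subtype.ext h2)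

theorem pExp_surjective : Function.Surjective pExp := by
  intro m
  set s : Multiset ℕ := (Finsupp.toMultiset m).map (fun n : ℕ+ => (n : ℕ))
  have hw : (s.sort (· ≥ ·)).SortedGE := (Multiset.pairwise_sort s (· ≥ ·)).sortedGE
  have hpos : ∀ x ∈ s.sort (· ≥ ·), 0 < x := by
    intro x hx
    rw [Multiset.mem_sort, Multiset.mem_map] at hx
    obtain ⟨n, _, rfl⟩ := hx
    exact n.pos
  refine ⟨YoungDiagram.ofRowLens _ hw, ?_⟩
  apply Multiset.toFinsupp.symm.injective
  change Finsupp.toMultiset _ = Finsupp.toMultiset _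
  apply Multiset.map_injective PNat.coe_injective
  rw [map_toMultiset_pExp, YoungDiagram.rowLens_ofRowLens_eq_self hpos, Multiset.sort_eq]

/-- The multiplicity vectors of the partitions of `d`. -/
def expsOf (d : ℕ) : Finset (ℕ+ →₀ ℕ) := by
  classical
  exact (partitionsOf d).image pExp

theorem mem_expsOf {d : ℕ} {m : ℕ+ →₀ ℕ} : m ∈ expsOf d ↔ expSize m = d := by
  classical
  rw [expsOf, Finset.mem_image]
  constructor
  · rintro ⟨μ, hμ, rfl⟩
    rw [expSize_pExp, mem_partitionsOf.mp hμ]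
  · intro h
    obtain ⟨μ, rfl⟩ := pExp_surjective m
    exact ⟨μ, mem_partitionsOf.mpr (by rw [← expSize_pExp, h]), rfl⟩

theorem sum_expsOf {M : Type*} [AddCommMonoid M] (d : ℕ) (f : (ℕ+ →₀ ℕ) → M) :
    ∑ m ∈ expsOf d, f m = ∑ μ ∈ partitionsOf d, f (pExp μ) := by
  classical
  rw [expsOf, Finset.sum_image fun _ _ _ _ h => pExp_injective h]

/-! ### Jacobi–Trudi determinants -/

/-- The Jacobi–Trudi determinant of `s_{μ/η}` may be taken of any size that is at least the
lengths of `μ` and `η`. -/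
theorem skewSchur_eq_det (μ η : YoungDiagram) {N : ℕ} (h1 : len μ ≤ N) (h2 : len η ≤ N) :
    skewSchur μ η = Matrix.det (Matrix.of fun i j : Fin N =>
      hSymm ((μ.rowLen i : ℤ) - (η.rowLen j : ℤ) - (i : ℤ) + (j : ℤ))) := by
  obtain ⟨k, rfl⟩ := Nat.exists_eq_add_of_le (max_le h1 h2)
  clear h1 h2
  induction k with
  | zero => rfl
  | succ k ih =>
    rw [ih, ← add_assoc]
    set N := max (len μ) (len η) + k with hN
    have hμ : μ.rowLen N = 0 := rowLen_eq_zero (by omega)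
    have hη : η.rowLen N = 0 := rowLen_eq_zero (by omega)
    rw [Matrix.det_succ_row _ (Fin.last N), Fin.sum_univ_castSucc, Finset.sum_eq_zero, zero_add]
    · simp only [Matrix.of_apply, Fin.val_last, hμ, hη, Fin.succAbove_last]
      rw [Even.neg_one_pow (by simp), one_mul]
      simp only [CharP.cast_eq_zero, sub_zero, zero_sub, neg_add_cancel, hSymm_zero, one_mul]
      rfl
    · intro j _
      have : hSymm ((μ.rowLen (Fin.last N) : ℤ) - (η.rowLen (j.castSucc : Fin (N + 1)) : ℤ)
          - ((Fin.last N : Fin (N + 1)) : ℕ) + ((j.castSucc : Fin (N + 1)) : ℕ)) = 0 := by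
        apply hSymm_of_neg
        simp only [Fin.val_last, hμ, Fin.val_castSucc]
        have := j.isLt
        omega
      rw [Matrix.of_apply, this, mul_zero, zero_mul]

theorem schur_eq_det (μ : YoungDiagram) {N : ℕ} (h1 : len μ ≤ N) :
    schur μ = Matrix.det (Matrix.of fun i j : Fin N =>
      hSymm ((μ.rowLen i : ℤ) - (i : ℤ) + (j : ℤ))) := by
  rw [schur, skewSchur_eq_det μ ⊥ h1 (by rw [len_bot]; omega)]
  simp [rowLen_bot]

theorem schur_bot : schur ⊥ = 1 := by
  rw [schur_eq_det ⊥ (N := 0) (by rw [len_bot])]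
  simp

theorem sum_jacobiTrudi_index (μ η : YoungDiagram) {N : ℕ} (h1 : len μ ≤ N) (h2 : len η ≤ N)
    (σ : Equiv.Perm (Fin N)) :
    ∑ i : Fin N, ((μ.rowLen (σ i) : ℤ) - (η.rowLen i : ℤ) - (σ i : ℤ) + (i : ℤ)) =
      (μ.card : ℤ) - η.card := by
  rw [Finset.sum_add_distrib, Finset.sum_sub_distrib, Finset.sum_sub_distrib,
    Equiv.sum_comp σ (fun i : Fin N => (μ.rowLen i : ℤ)), Equiv.sum_comp σ (fun i : Fin N => (i : ℤ)),
    ← sum_rowLen_fin μ h1, ← sum_rowLen_fin η h2]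
  push_cast
  ring

theorem skewSchur_eq_zero {μ η : YoungDiagram} (h : μ.card < η.card) : skewSchur μ η = 0 := by
  rw [skewSchur, Matrix.det_apply]
  refine Finset.sum_eq_zero fun σ _ => ?_
  obtain ⟨i, hi⟩ : ∃ i, (μ.rowLen (σ i) : ℤ) - (η.rowLen i : ℤ) - (σ i : ℤ) + (i : ℤ) < 0 := by
    by_contra! hc
    have h1 := Finset.sum_nonneg fun i (_ : i ∈ Finset.univ) => hc i
    rw [sum_jacobiTrudi_index μ η (le_max_left _ _) (le_max_right _ _)] at h1
    omega
  rw [Finset.prod_eq_zero (Finset.mem_univ i), smul_zero]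
  rw [Matrix.of_apply, hSymm_of_neg hi]

theorem weight_eq_expSize (m : ℕ+ →₀ ℕ) :
    Finsupp.weight (fun n : ℕ+ => (n : ℕ)) m = expSize m := by
  rw [Finsupp.weight_apply, expSize]
  simp [mul_comm]

theorem isWeightedHomogeneous_hSymm (d : ℕ) :
    MvPolynomial.IsWeightedHomogeneous (fun n : ℕ+ => (n : ℕ)) (hSymm d) d := by
  intro m hm
  rw [coeff_hSymm] at hm
  rw [weight_eq_expSize]
  by_contra h
  simp [h] at hm

theorem isWeightedHomogeneous_schur (μ : YoungDiagram) :
    MvPolynomial.IsWeightedHomogeneous (fun n : ℕ+ => (n : ℕ)) (schur μ) μ.card := by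
  have hb : len ⊥ ≤ len μ := by rw [len_bot]; omega
  rw [schur, skewSchur_eq_det μ ⊥ le_rfl hb, Matrix.det_apply]
  refine MvPolynomial.IsWeightedHomogeneous.sum _ _ _ fun σ _ => ?_
  have key : MvPolynomial.IsWeightedHomogeneous (fun n : ℕ+ => (n : ℕ))
      (∏ i : Fin (len μ), (Matrix.of fun i j : Fin (len μ) =>
      hSymm ((μ.rowLen i : ℤ) - ((⊥ : YoungDiagram).rowLen j : ℤ) - (i : ℤ) + (j : ℤ))) (σ i) i)
      μ.card := by
    by_cases hneg : ∃ i, (μ.rowLen (σ i) : ℤ) - ((⊥ : YoungDiagram).rowLen i : ℤ) - (σ i : ℤ)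
        + (i : ℤ) < 0
    · obtain ⟨i, hi⟩ := hneg
      rw [Finset.prod_eq_zero (Finset.mem_univ i) (by rw [Matrix.of_apply, hSymm_of_neg hi])]
      exact MvPolynomial.isWeightedHomogeneous_zero _ _ _
    · push Not at hneg
      have h1 := sum_jacobiTrudi_index μ ⊥ le_rfl hb σ
      choose n hn using fun i => Int.eq_ofNat_of_zero_le (hneg i)
      simp only [hn, card_bot] at h1
      have h2 : ∑ i, n i = μ.card := by
        rw [Nat.cast_zero, sub_zero] at h1
        exact_mod_cast h1
      rw [← h2]
      refine MvPolynomial.IsWeightedHomogeneous.prod _ _ _ fun i _ => ?_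
      rw [Matrix.of_apply, hn i]
      exact isWeightedHomogeneous_hSymm _
  rcases Int.units_eq_one_or (Equiv.Perm.sign σ) with h | h
  · simpa [h] using key
  · rw [h, Units.neg_smul, one_smul]
    intro m hm
    rw [MvPolynomial.coeff_neg, neg_ne_zero] at hm
    exact key hm

theorem coeff_schur_eq_zero {μ : YoungDiagram} {m : ℕ+ →₀ ℕ} (h : expSize m ≠ μ.card) :
    MvPolynomial.coeff m (schur μ) = 0 := by
  by_contra hc
  have := isWeightedHomogeneous_schur μ hc
  rw [weight_eq_expSize] at this
  exact h this

theorem schur_eq_sum (μ : YoungDiagram) :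
    schur μ = ∑ m ∈ expsOf μ.card, MvPolynomial.monomial m (MvPolynomial.coeff m (schur μ)) := by
  classical
  ext m
  rw [MvPolynomial.coeff_sum]
  simp only [MvPolynomial.coeff_monomial]
  rw [Finset.sum_ite_eq']
  split_ifs with h
  · rfl
  · exact coeff_schur_eq_zero fun e => h (mem_expsOf.mpr e)

theorem aeval_schur {R : Type*} [CommRing R] [Algebra ℚ R] (u : ℕ+ → R) (μ : YoungDiagram) :
    MvPolynomial.aeval u (schur μ) = ∑ m ∈ expsOf μ.card,
      algebraMap ℚ R (MvPolynomial.coeff m (schur μ)) * m.prod fun n c => u n ^ c := by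
  conv_lhs => rw [schur_eq_sum]
  rw [map_sum]
  simp only [MvPolynomial.aeval_monomial]

theorem aeval_hSymm {R : Type*} [CommRing R] [Algebra ℚ R] (u : ℕ+ → R) (d : ℕ) :
    MvPolynomial.aeval u (hSymm d) = ∑ m ∈ expsOf d,
      algebraMap ℚ R ((expZ m : ℚ)⁻¹) * m.prod fun n c => u n ^ c := by
  classical
  have : hSymm d = ∑ m ∈ expsOf d, MvPolynomial.monomial m ((expZ m : ℚ)⁻¹) := by
    ext m
    rw [MvPolynomial.coeff_sum, coeff_hSymm]
    simp only [MvPolynomial.coeff_monomial]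
    rw [Finset.sum_ite_eq']
    simp only [mem_expsOf]
  rw [this, map_sum]
  simp only [MvPolynomial.aeval_monomial]

theorem prod_scale {R : Type*} [CommRing R] (c : R) (u : ℕ+ → R) (m : ℕ+ →₀ ℕ) :
    (m.prod fun n k => (c ^ (n : ℕ) * u n) ^ k) = c ^ expSize m * m.prod fun n k => u n ^ k := by
  simp only [mul_pow, ← pow_mul]
  rw [Finsupp.prod_mul, expSize]
  congr 1
  rw [Finsupp.prod, Finsupp.sum, Finset.prod_pow_eq_pow_sum]

theorem aeval_scale_schur {R : Type*} [CommRing R] [Algebra ℚ R] (c : R) (u : ℕ+ → R)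
    (μ : YoungDiagram) : MvPolynomial.aeval (fun n : ℕ+ => c ^ (n : ℕ) * u n) (schur μ) =
      c ^ μ.card * MvPolynomial.aeval u (schur μ) := by
  rw [aeval_schur, aeval_schur, Finset.mul_sum]
  refine Finset.sum_congr rfl fun m hm => ?_
  rw [prod_scale, mem_expsOf.mp hm]
  ring

/-! ### Schur functions of finitely many variables -/

section Bialternant

variable {R : Type*} [CommRing R]

theorem coeff_prod_one_sub_eq_zero {ι : Type*} (s : Finset ι) (w : ι → R) {n : ℕ}
    (h : s.card < n) :
    PowerSeries.coeff n (∏ k ∈ s, (1 - PowerSeries.C (w k) * PowerSeries.X)) = 0 := by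
  classical
  induction s using Finset.induction_on generalizing n with
  | empty =>
    rw [Finset.prod_empty, PowerSeries.coeff_one, if_neg (by simp at h; omega)]
  | insert i s hi ih =>
    rw [Finset.card_insert_of_notMem hi] at h
    obtain ⟨n, rfl⟩ : ∃ k, n = k + 1 := ⟨n - 1, by omega⟩
    rw [Finset.prod_insert hi, sub_mul, one_mul, map_sub, ih (by omega), mul_assoc,
      PowerSeries.coeff_C_mul, PowerSeries.coeff_succ_X_mul, ih (by omega)]
    simp

/-- The power sums of `w_1, …, w_N`. -/
def powerSum {N : ℕ} (w : Fin N → R) (n : ℕ+) : R := ∑ k, w k ^ (n : ℕ)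

/-- The alternant `det (w_l ^ {N - i})` of the staircase exponents. -/
def alternant {N : ℕ} (w : Fin N → R) : R :=
  Matrix.det (Matrix.of fun i l : Fin N => w l ^ (N - 1 - (i : ℕ)))

variable [Algebra ℚ R]

theorem hSer_powerSum {N : ℕ} (w : Fin N → R) :
    hSer (powerSum w) = ∏ k, PowerSeries.mk fun n => w k ^ n := by
  have : powerSum w = ∑ k, fun n : ℕ+ => w k ^ (n : ℕ) := by
    ext n
    simp [powerSum]
  rw [this, hSer_sum]
  simp only [hSer_geom]

theorem hSer_powerSum_add_mul {N : ℕ} (w : Fin N → R) (y : ℕ+ → R) (l : Fin N) :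
    hSer (powerSum w + y) *
        ∏ k ∈ Finset.univ.erase l, (1 - PowerSeries.C (w k) * PowerSeries.X) =
      hSer y * PowerSeries.mk fun n => w l ^ n := by
  have h : (∏ k ∈ Finset.univ.erase l, PowerSeries.mk fun n => w k ^ n) *
      ∏ k ∈ Finset.univ.erase l, (1 - PowerSeries.C (w k) * PowerSeries.X) = 1 := by
    rw [← Finset.prod_mul_distrib]
    exact Finset.prod_eq_one fun k _ => mk_pow_mul_one_sub (w k)
  rw [hSer_add, hSer_powerSum, ← Finset.mul_prod_erase Finset.univ _ (Finset.mem_univ l)]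
  linear_combination (hSer y * PowerSeries.mk fun n => w l ^ n) * h

/-- The elementary symmetric functions of the variables other than `w_l` turn the Jacobi–Trudi
matrix at `w + y` into a matrix whose `l`-th column depends on `w_l` and `y` only. -/
theorem jacobiTrudi_mul {N : ℕ} (w : Fin N → R) (y : ℕ+ → R) (α : Fin N → ℕ) :
    (Matrix.of fun i j : Fin N => MvPolynomial.aeval (powerSum w + y)
        (hSymm ((α i : ℤ) - ((N - 1 - (j : ℕ) : ℕ) : ℤ)))) *
      (Matrix.of fun j l : Fin N => PowerSeries.coeff (N - 1 - (j : ℕ))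
        (∏ k ∈ Finset.univ.erase l, (1 - PowerSeries.C (w k) * PowerSeries.X))) =
    Matrix.of fun i l : Fin N =>
      PowerSeries.coeff (α i) (hSer y * PowerSeries.mk fun n => w l ^ n) := by
  ext i l
  rw [Matrix.mul_apply, Matrix.of_apply, ← hSer_powerSum_add_mul, PowerSeries.coeff_mul]
  simp only [Matrix.of_apply]
  set E := ∏ k ∈ Finset.univ.erase l, (1 - PowerSeries.C (w k) * PowerSeries.X)
  set u := powerSum w + y
  have hE : ∀ s, N ≤ s → PowerSeries.coeff s E = 0 := fun s hs =>
    coeff_prod_one_sub_eq_zero _ w (by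
      rw [Finset.card_erase_of_mem (Finset.mem_univ l), Finset.card_univ, Fintype.card_fin]
      have := l.isLt
      omega)
  set f : ℕ → R := fun s =>
    MvPolynomial.aeval u (hSymm ((α i : ℤ) - (s : ℤ))) * PowerSeries.coeff s E
  have h1 : ∑ j : Fin N, f (N - 1 - (j : ℕ)) = ∑ s ∈ Finset.range N, f s := by
    rw [Fin.sum_univ_eq_sum_range (fun j => f (N - 1 - j)), Finset.sum_range_reflect]
  have h2 : ∑ s ∈ Finset.range N, f s = ∑ s ∈ Finset.range (N + (α i + 1)), f s := by
    refine Finset.sum_subset (Finset.range_mono (by omega)) fun s _ hs => ?_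
    simp only [f]
    rw [hE s (by simpa using hs), mul_zero]
  have h3 : ∑ s ∈ Finset.range (α i + 1), f s = ∑ s ∈ Finset.range (N + (α i + 1)), f s := by
    refine Finset.sum_subset (Finset.range_mono (by omega)) fun s _ hs => ?_
    simp only [f]
    rw [hSymm_of_neg (by simp at hs; omega), map_zero, zero_mul]
  change ∑ j : Fin N, f (N - 1 - (j : ℕ)) = _
  rw [h1, h2, ← h3, Finset.Nat.sum_antidiagonal_eq_sum_range_succ
    (fun a b => PowerSeries.coeff a (hSer u) * PowerSeries.coeff b E), Nat.succ_eq_add_one,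
    ← Finset.sum_range_reflect]
  refine Finset.sum_congr rfl fun s hs => ?_
  have hs' := Finset.mem_range.mp hs
  simp only [f]
  rw [coeff_hSer]
  have e1 : α i + 1 - 1 - s = α i - s := by omega
  have e2 : α i - (α i - s) = s := by omega
  rw [e1]
  congr 3
  omega

theorem coeff_geom {N : ℕ} (w : Fin N → R) (a : ℕ) (l : Fin N) :
    PowerSeries.coeff a (hSer (0 : ℕ+ → R) * PowerSeries.mk fun n => w l ^ n) = w l ^ a := by
  rw [hSer_zero, one_mul, PowerSeries.coeff_mk]

/-- The staircase case of `jacobiTrudi_mul`, where the matrix of complete symmetric functions is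
unitriangular. -/
theorem det_elementary_eq_alternant {N : ℕ} (w : Fin N → R) :
    Matrix.det (Matrix.of fun j l : Fin N => PowerSeries.coeff (N - 1 - (j : ℕ))
        (∏ k ∈ Finset.univ.erase l, (1 - PowerSeries.C (w k) * PowerSeries.X))) =
      alternant w := by
  have h := congrArg Matrix.det (jacobiTrudi_mul w 0 fun i => N - 1 - (i : ℕ))
  rw [Matrix.det_mul] at h
  simp only [coeff_geom] at h
  suffices hT : Matrix.det (Matrix.of fun i j : Fin N => MvPolynomial.aeval (powerSum w + 0)
      (hSymm (((N - 1 - (i : ℕ) : ℕ) : ℤ) - ((N - 1 - (j : ℕ) : ℕ) : ℤ)))) = 1 by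
    rw [alternant, ← h, hT, one_mul]
  rw [Matrix.det_of_isUpperTriangular, Finset.prod_eq_one]
  · intro i _
    simp [hSymm_zero]
  · intro i j hij
    have hij' : (j : ℕ) < i := hij
    have := i.isLt
    rw [Matrix.of_apply, hSymm_of_neg (by omega), map_zero]

/-- The exponents `μ_i + N - i` of the alternant that belongs to the partition `μ`. -/
def shifted (N : ℕ) (μ : YoungDiagram) (i : Fin N) : ℕ := μ.rowLen i + (N - 1 - (i : ℕ))

theorem shifted_strictAnti (N : ℕ) (μ : YoungDiagram) : StrictAnti (shifted N μ) := by
  intro i j hij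
  have h := μ.rowLen_anti i j (le_of_lt hij)
  have h1 : (i : ℕ) < j := hij
  have := j.isLt
  simp only [shifted]
  omega

theorem shifted_injective {N : ℕ} {μ ν : YoungDiagram} (h1 : len μ ≤ N) (h2 : len ν ≤ N)
    (h : shifted N μ = shifted N ν) : μ = ν := by
  refine eq_of_rowLen_eq fun i => ?_
  by_cases hi : i < N
  · have := congrFun h ⟨i, hi⟩
    simpa [shifted] using this
  · rw [rowLen_eq_zero (by omega), rowLen_eq_zero (by omega)]

/-- A common generalization of the bialternant formula (the case `y = 0`) and of the branching rule
for Schur functions at `w + y`. -/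
theorem alternant_mul_schur {N : ℕ} (w : Fin N → R) (y : ℕ+ → R) {μ : YoungDiagram}
    (hμ : len μ ≤ N) :
    alternant w * MvPolynomial.aeval (powerSum w + y) (schur μ) =
      Matrix.det (Matrix.of fun i l : Fin N =>
        PowerSeries.coeff (shifted N μ i) (hSer y * PowerSeries.mk fun n => w l ^ n)) := by
  rw [← jacobiTrudi_mul, Matrix.det_mul, det_elementary_eq_alternant, mul_comm,
    schur_eq_det μ hμ, AlgHom.map_det]
  congr 2
  ext i j
  rw [AlgHom.mapMatrix_apply, Matrix.map_apply, Matrix.of_apply, Matrix.of_apply]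
  congr 2
  have := i.isLt
  have := j.isLt
  simp only [shifted]
  omega

end Bialternant

/-! ### The Hall inner product -/

/-- A function on `Fin N` as an exponent vector. -/
def expVec {N : ℕ} (β : Fin N → ℕ) : Fin N →₀ ℕ := Finsupp.equivFunOnFinite.symm β

theorem expVec_apply {N : ℕ} (β : Fin N → ℕ) (i : Fin N) : expVec β i = β i := rfl

theorem prod_X_pow {S : Type*} [CommRing S] {N : ℕ} (β : Fin N → ℕ) :
    ∏ l, (MvPolynomial.X l : MvPolynomial (Fin N) S) ^ β l =
      MvPolynomial.monomial (expVec β) 1 := by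
  rw [MvPolynomial.monomial_eq, MvPolynomial.C_1, one_mul, Finsupp.prod_fintype _ _ (by simp)]
  rfl

theorem coeff_prod_univariate {N A : ℕ} (c : Fin N → ℕ → ℚ) (β : Fin N → ℕ) :
    MvPolynomial.coeff (expVec β) (∏ l, ∑ s ∈ Finset.range A,
      MvPolynomial.C (c l s) * (MvPolynomial.X l : MvPolynomial (Fin N) ℚ) ^ s) =
    ∏ l, if β l < A then c l (β l) else 0 := by
  classical
  rw [Finset.prod_univ_sum, MvPolynomial.coeff_sum]
  have h : ∀ p ∈ Fintype.piFinset (fun _ : Fin N => Finset.range A),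
      MvPolynomial.coeff (expVec β) (∏ l, (MvPolynomial.C (c l (p l)) *
        (MvPolynomial.X l : MvPolynomial (Fin N) ℚ) ^ p l)) =
      if p = β then ∏ l, c l (β l) else 0 := by
    intro p _
    rw [Finset.prod_mul_distrib, ← map_prod, MvPolynomial.coeff_C_mul, prod_X_pow,
      MvPolynomial.coeff_monomial]
    by_cases hp : p = β
    · subst hp; simp
    · rw [if_neg hp, if_neg, mul_zero]
      intro e
      exact hp (Finsupp.equivFunOnFinite.symm.injective e)
  rw [Finset.sum_congr rfl h, Finset.sum_ite_eq']
  by_cases hβ : ∀ l, β l < A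
  · rw [if_pos (by simpa using hβ)]
    exact Finset.prod_congr rfl fun l _ => (if_pos (hβ l)).symm
  · rw [if_neg (by simpa using hβ)]
    push Not at hβ
    obtain ⟨l, hl⟩ := hβ
    exact (Finset.prod_eq_zero (Finset.mem_univ l) (if_neg (by omega))).symm

/-- The inner product with the Schur function `s_η`, computed in `N ≥ l(η)` variables as the
coefficient of the leading monomial of the alternant of `η`. -/
def schurCoeff (N : ℕ) (η : YoungDiagram) : SymmFun →ₗ[ℚ] ℚ :=
  MvPolynomial.lcoeff ℚ (expVec (shifted N η)) ∘ₗ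
    LinearMap.mulLeft ℚ (alternant (MvPolynomial.X : Fin N → MvPolynomial (Fin N) ℚ)) ∘ₗ
      (MvPolynomial.aeval (powerSum (MvPolynomial.X : Fin N → MvPolynomial (Fin N) ℚ))).toLinearMap

theorem schurCoeff_apply (N : ℕ) (η : YoungDiagram) (f : SymmFun) :
    schurCoeff N η f = MvPolynomial.coeff (expVec (shifted N η))
      (alternant (MvPolynomial.X : Fin N → MvPolynomial (Fin N) ℚ) *
        MvPolynomial.aeval (powerSum MvPolynomial.X) f) := rfl

theorem coeff_hSer_C_mul_geom {N : ℕ} (y : ℕ+ → ℚ) (a : ℕ) (l : Fin N) {A : ℕ} (hA : a < A) :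
    PowerSeries.coeff a (hSer (fun n => (MvPolynomial.C (y n) : MvPolynomial (Fin N) ℚ)) *
      PowerSeries.mk fun n => (MvPolynomial.X l : MvPolynomial (Fin N) ℚ) ^ n) =
    ∑ s ∈ Finset.range A, MvPolynomial.C (MvPolynomial.aeval y (hSymm ((a : ℤ) - (s : ℤ)))) *
      MvPolynomial.X l ^ s := by
  have h1 : ∀ f : SymmFun, MvPolynomial.aeval
      (fun n => (MvPolynomial.C (y n) : MvPolynomial (Fin N) ℚ)) f =
      MvPolynomial.C (MvPolynomial.aeval y f) := fun f => by
    have := MvPolynomial.map_aeval y (MvPolynomial.C : ℚ →+* MvPolynomial (Fin N) ℚ) f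
    rw [this]
    rfl
  have h2 : ∑ s ∈ Finset.range (a + 1),
      MvPolynomial.C (MvPolynomial.aeval y (hSymm ((a : ℤ) - (s : ℤ)))) *
        (MvPolynomial.X l : MvPolynomial (Fin N) ℚ) ^ s =
      ∑ s ∈ Finset.range A, MvPolynomial.C (MvPolynomial.aeval y (hSymm ((a : ℤ) - (s : ℤ)))) *
        MvPolynomial.X l ^ s := by
    refine Finset.sum_subset (Finset.range_mono (by omega)) fun s _ hs => ?_
    rw [hSymm_of_neg (by simp at hs; omega), map_zero, map_zero, zero_mul]
  rw [← h2, PowerSeries.coeff_mul, Finset.Nat.sum_antidiagonal_eq_sum_range_succ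
    (fun i j => PowerSeries.coeff i (hSer fun n => (MvPolynomial.C (y n) : MvPolynomial (Fin N) ℚ))
      * PowerSeries.coeff j (PowerSeries.mk fun n => (MvPolynomial.X l : MvPolynomial (Fin N) ℚ) ^ n)),
    Nat.succ_eq_add_one, ← Finset.sum_range_reflect]
  refine Finset.sum_congr rfl fun s hs => ?_
  have hs' := Finset.mem_range.mp hs
  rw [coeff_hSer, h1, PowerSeries.coeff_mk]
  have e1 : a + 1 - 1 - s = a - s := by omega
  have e2 : a - (a - s) = s := by omega
  rw [e1, e2]
  congr 4
  omega

/-- The coefficient of `s_η` in `s_μ(x + y)` is `s_{μ/η}(y)`. -/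
theorem schurCoeff_translate {N : ℕ} (y : ℕ+ → ℚ) {μ η : YoungDiagram} (hμ : len μ ≤ N)
    (hη : len η ≤ N) :
    schurCoeff N η (MvPolynomial.aeval (fun n => MvPolynomial.X n + MvPolynomial.C (y n) : ℕ+ → SymmFun)
      (schur μ)) = MvPolynomial.aeval y (skewSchur μ η) := by
  have e : MvPolynomial.aeval (powerSum (MvPolynomial.X : Fin N → MvPolynomial (Fin N) ℚ))
      (MvPolynomial.aeval (fun n => MvPolynomial.X n + MvPolynomial.C (y n) : ℕ+ → SymmFun)
        (schur μ)) =
      MvPolynomial.aeval (powerSum (MvPolynomial.X : Fin N → MvPolynomial (Fin N) ℚ) +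
        fun n => MvPolynomial.C (y n)) (schur μ) := by
    rw [← AlgHom.comp_apply, MvPolynomial.comp_aeval]
    congr 2
    ext1 n
    simp [MvPolynomial.algebraMap_eq]
  rw [schurCoeff_apply, e, alternant_mul_schur _ _ hμ, Matrix.det_apply,
    skewSchur_eq_det μ η hμ hη, AlgHom.map_det, Matrix.det_apply, MvPolynomial.coeff_sum]
  refine Finset.sum_congr rfl fun σ _ => ?_
  set A := (∑ i, shifted N μ i) + (∑ i, shifted N η i) + 1 with hA
  have h1 : ∀ i, shifted N μ i < A := fun i => by
    have := Finset.single_le_sum (f := shifted N μ) (by simp) (Finset.mem_univ i)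
    omega
  have h2 : ∀ i, shifted N η i < A := fun i => by
    have := Finset.single_le_sum (f := shifted N η) (by simp) (Finset.mem_univ i)
    omega
  simp only [Matrix.of_apply, AlgHom.mapMatrix_apply, Matrix.map_apply]
  rw [Finset.prod_congr rfl fun i _ => coeff_hSer_C_mul_geom y (shifted N μ (σ i)) i (h1 _)]
  rw [Units.smul_def, Units.smul_def, MvPolynomial.coeff_smul, coeff_prod_univariate
    (fun l s => MvPolynomial.aeval y (hSymm ((shifted N μ (σ l) : ℤ) - (s : ℤ))))]
  congr 1
  refine Finset.prod_congr rfl fun l _ => ?_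
  rw [if_pos (h2 l)]
  congr 2
  have := l.isLt
  have := (σ l).isLt
  simp only [shifted]
  omega

theorem aeval_zero_hSymm (n : ℤ) :
    MvPolynomial.aeval (0 : ℕ+ → ℚ) (hSymm n) = if n = 0 then 1 else 0 := by
  rcases lt_or_ge n 0 with h | h
  · rw [hSymm_of_neg h, map_zero, if_neg (by omega)]
  · obtain ⟨k, rfl⟩ := Int.eq_ofNat_of_zero_le h
    rw [← coeff_hSer, hSer_zero, PowerSeries.coeff_one]
    simp

open Classical in
/-- The Schur functions are orthonormal. -/
theorem schurCoeff_schur {N : ℕ} {ν η : YoungDiagram} (hν : len ν ≤ N) (hη : len η ≤ N) :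
    schurCoeff N η (schur ν) = if ν = η then 1 else 0 := by
  have h := schurCoeff_translate (0 : ℕ+ → ℚ) hν hη
  have e : (fun n => MvPolynomial.X n + MvPolynomial.C ((0 : ℕ+ → ℚ) n) : ℕ+ → SymmFun) =
      MvPolynomial.X := by
    ext1 n
    simp
  rw [e, MvPolynomial.aeval_X_left, AlgHom.id_apply] at h
  rw [h, skewSchur_eq_det ν η hν hη, AlgHom.map_det, Matrix.det_apply]
  have key : ∀ σ : Equiv.Perm (Fin N), (∏ i, (MvPolynomial.aeval (0 : ℕ+ → ℚ)).mapMatrix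
      (Matrix.of fun i j : Fin N =>
        hSymm ((ν.rowLen i : ℤ) - (η.rowLen j : ℤ) - (i : ℤ) + (j : ℤ))) (σ i) i) =
      if shifted N ν ∘ σ = shifted N η then 1 else 0 := by
    intro σ
    have h1 : ∀ i, (MvPolynomial.aeval (0 : ℕ+ → ℚ)).mapMatrix (Matrix.of fun i j : Fin N =>
        hSymm ((ν.rowLen i : ℤ) - (η.rowLen j : ℤ) - (i : ℤ) + (j : ℤ))) (σ i) i =
        if shifted N ν (σ i) = shifted N η i then 1 else 0 := by
      intro i
      rw [AlgHom.mapMatrix_apply, Matrix.map_apply, Matrix.of_apply, aeval_zero_hSymm]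
      have := i.isLt
      have := (σ i).isLt
      congr 1
      simp only [shifted, eq_iff_iff]
      omega
    rw [Finset.prod_congr rfl fun i _ => h1 i, Finset.prod_ite_zero]
    simp [funext_iff]
  simp only [key]
  rw [Finset.sum_eq_single (1 : Equiv.Perm (Fin N))]
  · rw [Equiv.Perm.sign_one, one_smul]
    congr 1
    rw [eq_iff_iff]
    constructor
    · intro h; exact shifted_injective hν hη h
    · rintro rfl; rfl
  · intro σ _ hσ
    rw [if_neg, smul_zero]
    intro he
    apply hσ
    -- both sequences of exponents are strictly decreasing, so `σ` preserves the order
    have hmono : StrictMono σ := by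
      intro i j hij
      have h1 := shifted_strictAnti N η hij
      rw [← he] at h1
      exact (shifted_strictAnti N ν).lt_iff_gt.mp h1
    ext i
    have h2 := hmono.monotone
    have : (σ : Fin N → Fin N) = id := by
      have h3 := Subsingleton.elim (hmono.orderIsoOfSurjective σ σ.surjective) (OrderIso.refl _)
      ext j
      exact congrArg Fin.val (DFunLike.congr_fun h3 j)
    rw [this]
    rfl
  · simp

/-- The pairing of `p_m` with `h_γ`: the coefficient of `w^γ` in `p_m(w)` is `z_m` times the
coefficient of `p_m` in `h_γ`. Both sides are read off from `h_d` at the products `p_n p_n(w)`. -/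
theorem coeff_prod_powerSum {N : ℕ} (γ : Fin N → ℕ) (m : ℕ+ →₀ ℕ) :
    MvPolynomial.coeff (expVec γ) (m.prod fun n c =>
      powerSum (MvPolynomial.X : Fin N → MvPolynomial (Fin N) ℚ) n ^ c) =
    expZ m * MvPolynomial.coeff m (∏ l, hSymm (γ l)) := by
  classical
  set d := expSize m with hd
  have hu : (fun n : ℕ+ => MvPolynomial.C (MvPolynomial.X n : SymmFun) *
      powerSum (MvPolynomial.X : Fin N → MvPolynomial (Fin N) SymmFun) n) =
      ∑ l : Fin N, fun n : ℕ+ => (MvPolynomial.X l : MvPolynomial (Fin N) SymmFun) ^ (n : ℕ) *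
        MvPolynomial.C (MvPolynomial.X n : SymmFun) := by
    ext1 n
    rw [Finset.sum_apply, powerSum, Finset.mul_sum]
    exact Finset.sum_congr rfl fun l _ => mul_comm _ _
  -- first evaluation: the generating series is a product over the variables `w_l`
  have hC : ∀ a : ℕ, PowerSeries.coeff a
      (hSer (fun n : ℕ+ => (MvPolynomial.C (MvPolynomial.X n : SymmFun) :
        MvPolynomial (Fin N) SymmFun))) = MvPolynomial.C (hSymm a) := by
    intro a
    have h1 := MvPolynomial.comp_aeval_apply (R := ℚ) (fun n : ℕ+ => (MvPolynomial.X n : SymmFun))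
      (IsScalarTower.toAlgHom ℚ SymmFun (MvPolynomial (Fin N) SymmFun)) (hSymm a)
    rw [coeff_hSer]
    rw [MvPolynomial.aeval_X_left_apply] at h1
    exact h1.symm
  have h1 : MvPolynomial.coeff (expVec γ) (PowerSeries.coeff d (hSer
      (fun n : ℕ+ => MvPolynomial.C (MvPolynomial.X n : SymmFun) *
        powerSum (MvPolynomial.X : Fin N → MvPolynomial (Fin N) SymmFun) n))) =
      if ∑ l, γ l = d then ∏ l, hSymm (γ l) else 0 := by
    rw [hu, hSer_sum, PowerSeries.coeff_prod, MvPolynomial.coeff_sum]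
    have h2 : ∀ e ∈ Finset.finsuppAntidiag (Finset.univ : Finset (Fin N)) d,
        MvPolynomial.coeff (expVec γ) (∏ l, PowerSeries.coeff (e l) (hSer fun n : ℕ+ =>
          (MvPolynomial.X l : MvPolynomial (Fin N) SymmFun) ^ (n : ℕ) *
            MvPolynomial.C (MvPolynomial.X n : SymmFun))) =
        if e = expVec γ then ∏ l, hSymm (γ l) else 0 := by
      intro e _
      simp only [hSer_scale, PowerSeries.coeff_rescale, hC]
      rw [Finset.prod_mul_distrib, prod_X_pow (S := SymmFun) (fun l => e l), ← map_prod, mul_comm (MvPolynomial.monomial _ (1 : SymmFun)),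
        MvPolynomial.coeff_C_mul, MvPolynomial.coeff_monomial]
      have e1 : expVec (fun l => e l) = e := Finsupp.ext fun _ => rfl
      rw [e1]
      split_ifs with h
      · subst h; simp [expVec_apply]
      · rw [mul_zero]
    rw [Finset.sum_congr rfl h2, Finset.sum_ite_eq']
    simp only [Finset.mem_finsuppAntidiag, Finset.subset_univ, and_true]
    rfl
  -- second evaluation: the expansion of `h_d` in the Newton functions
  have h3 : MvPolynomial.coeff m (MvPolynomial.coeff (expVec γ) (PowerSeries.coeff d (hSer
      (fun n : ℕ+ => MvPolynomial.C (MvPolynomial.X n : SymmFun) *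
        powerSum (MvPolynomial.X : Fin N → MvPolynomial (Fin N) SymmFun) n))) : SymmFun) =
      (expZ m : ℚ)⁻¹ * MvPolynomial.coeff (expVec γ) (m.prod fun n c =>
        powerSum (MvPolynomial.X : Fin N → MvPolynomial (Fin N) ℚ) n ^ c) := by
    rw [coeff_hSer, aeval_hSymm, MvPolynomial.coeff_sum, MvPolynomial.coeff_sum]
    have h4 : ∀ m' ∈ expsOf d, MvPolynomial.coeff m (MvPolynomial.coeff (expVec γ)
        (algebraMap ℚ (MvPolynomial (Fin N) SymmFun) ((expZ m' : ℚ)⁻¹) * m'.prod fun n c =>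
          (MvPolynomial.C (MvPolynomial.X n : SymmFun) *
            powerSum (MvPolynomial.X : Fin N → MvPolynomial (Fin N) SymmFun) n) ^ c)) =
        if m' = m then (expZ m : ℚ)⁻¹ * MvPolynomial.coeff (expVec γ) (m.prod fun n c =>
          powerSum (MvPolynomial.X : Fin N → MvPolynomial (Fin N) ℚ) n ^ c) else 0 := by
      intro m' _
      have e1 : (m'.prod fun n c => (MvPolynomial.C (MvPolynomial.X n : SymmFun) *
            powerSum (MvPolynomial.X : Fin N → MvPolynomial (Fin N) SymmFun) n) ^ c) =
          MvPolynomial.C (MvPolynomial.monomial m' (1 : ℚ)) *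
            MvPolynomial.map (MvPolynomial.C : ℚ →+* SymmFun) (m'.prod fun n c =>
              powerSum (MvPolynomial.X : Fin N → MvPolynomial (Fin N) ℚ) n ^ c) := by
        simp only [mul_pow]
        rw [Finsupp.prod_mul, MvPolynomial.monomial_eq, MvPolynomial.C_1, one_mul]
        simp only [Finsupp.prod, map_prod, map_pow, powerSum, map_sum, MvPolynomial.map_X]
      have e2 : algebraMap ℚ (MvPolynomial (Fin N) SymmFun) ((expZ m' : ℚ)⁻¹) =
          MvPolynomial.C (MvPolynomial.C ((expZ m' : ℚ)⁻¹)) := rfl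
      rw [e1, e2, MvPolynomial.coeff_C_mul, MvPolynomial.coeff_C_mul, MvPolynomial.coeff_C_mul,
        MvPolynomial.coeff_map, mul_comm (MvPolynomial.monomial m' (1 : ℚ)),
        MvPolynomial.coeff_C_mul, MvPolynomial.coeff_monomial]
      split_ifs with h
      · subst h; ring
      · ring
    rw [Finset.sum_congr rfl h4, Finset.sum_ite_eq', if_pos (mem_expsOf.mpr rfl)]
  rw [h1] at h3
  have h5 : (if ∑ l, γ l = d then ∏ l, hSymm (γ l) else 0).coeff m =
      (∏ l, hSymm (γ l)).coeff m := by
    split_ifs with h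
    · rfl
    · by_contra hc
      rw [MvPolynomial.coeff_zero] at hc
      have h6 := MvPolynomial.IsWeightedHomogeneous.prod Finset.univ (fun l => hSymm (γ l)) γ
        (fun l _ => isWeightedHomogeneous_hSymm (γ l)) (Ne.symm hc)
      rw [weight_eq_expSize] at h6
      exact h h6.symm
  rw [← h5, h3, ← mul_assoc, mul_inv_cancel₀ (expZ_ne_zero m), one_mul]

theorem coeff_monomial_mul_ite {N : ℕ} (γ δ : Fin N → ℕ) (f : MvPolynomial (Fin N) ℚ) :
    MvPolynomial.coeff (expVec γ) (MvPolynomial.monomial (expVec δ) 1 * f) =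
      if ∀ l, δ l ≤ γ l then MvPolynomial.coeff (expVec fun l => γ l - δ l) f else 0 := by
  rw [MvPolynomial.coeff_monomial_mul', one_mul]
  have e : expVec γ - expVec δ = expVec fun l => γ l - δ l := Finsupp.ext fun _ => rfl
  rw [e]
  exact if_congr Iff.rfl rfl rfl

/-- The inner product of `s_η` with `p_m` is `z_m` times the coefficient of `p_m` in `s_η`. -/
theorem schurCoeff_monomial {N : ℕ} {η : YoungDiagram} (hη : len η ≤ N) (m : ℕ+ →₀ ℕ) (c : ℚ) :
    schurCoeff N η (MvPolynomial.monomial m c) =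
      c * (expZ m * MvPolynomial.coeff m (schur η)) := by
  have e1 : MvPolynomial.monomial m c = c • MvPolynomial.monomial m (1 : ℚ) := by
    rw [MvPolynomial.smul_monomial, smul_eq_mul, mul_one]
  rw [e1, map_smul, smul_eq_mul]
  congr 1
  rw [schurCoeff_apply, MvPolynomial.aeval_monomial, map_one, one_mul, alternant, Matrix.det_apply,
    Finset.sum_mul, MvPolynomial.coeff_sum, schur_eq_det η hη, ← Matrix.det_transpose,
    Matrix.det_apply, MvPolynomial.coeff_sum, Finset.mul_sum]
  refine Finset.sum_congr rfl fun σ _ => ?_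
  rw [Units.smul_def, Units.smul_def, smul_mul_assoc, MvPolynomial.coeff_smul,
    MvPolynomial.coeff_smul, mul_smul_comm]
  congr 1
  simp only [Matrix.of_apply, Matrix.transpose_apply]
  rw [prod_X_pow (fun l => N - 1 - ((σ l : Fin N) : ℕ)), coeff_monomial_mul_ite]
  split_ifs with h
  · rw [coeff_prod_powerSum]
    congr 2
    refine Finset.prod_congr rfl fun l _ => ?_
    have := h l
    have := l.isLt
    have := (σ l).isLt
    congr 1
    simp only [shifted] at *
    omega
  · push Not at h
    obtain ⟨l, hl⟩ := h
    rw [Finset.prod_eq_zero (Finset.mem_univ l), MvPolynomial.coeff_zero, mul_zero]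
    apply hSymm_of_neg
    have := l.isLt
    have := (σ l).isLt
    simp only [shifted] at hl
    omega

open Classical in
/-- The orthogonality relations of the characters of the symmetric group. -/
theorem sum_expZ_mul_coeff_schur {d : ℕ} {ν η : YoungDiagram} (hν : ν.card = d) (hη : η.card = d) :
    ∑ m ∈ expsOf d, MvPolynomial.coeff m (schur ν) *
      (expZ m * MvPolynomial.coeff m (schur η)) = if ν = η then 1 else 0 := by
  have h1 : len ν ≤ d := hν ▸ len_le_card ν
  have h2 : len η ≤ d := hη ▸ len_le_card η
  rw [← schurCoeff_schur h1 h2]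
  conv_rhs => rw [schur_eq_sum ν, map_sum]
  rw [hν]
  exact Finset.sum_congr rfl fun m _ => (schurCoeff_monomial h2 m _).symm

open Classical in
/-- The second orthogonality relations: Cauchy's identity `∑_η s_η(x) s_η(y) = h_d(xy)` in terms of
coefficients. A one-sided inverse of a square matrix is two-sided. -/
theorem sum_coeff_schur_mul {d : ℕ} {m m' : ℕ+ →₀ ℕ} (hm : m ∈ expsOf d) (hm' : m' ∈ expsOf d) :
    ∑ η ∈ partitionsOf d, MvPolynomial.coeff m (schur η) * MvPolynomial.coeff m' (schur η) =
      if m = m' then ((expZ m : ℚ))⁻¹ else 0 := by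
  obtain ⟨μ, rfl⟩ := pExp_surjective m
  obtain ⟨μ', rfl⟩ := pExp_surjective m'
  rw [mem_expsOf, expSize_pExp] at hm hm'
  set A : Matrix (partitionsOf d) (partitionsOf d) ℚ :=
    Matrix.of fun ν μ => MvPolynomial.coeff (pExp μ) (schur ν)
  set B : Matrix (partitionsOf d) (partitionsOf d) ℚ :=
    Matrix.of fun μ η => expZ (pExp μ) * MvPolynomial.coeff (pExp μ) (schur η)
  have hAB : A * B = 1 := by
    ext ν η
    rw [Matrix.mul_apply, Matrix.one_apply]
    simp only [A, B, Matrix.of_apply]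
    rw [Finset.sum_coe_sort (partitionsOf d) (fun μ => MvPolynomial.coeff (pExp μ) (schur ν) *
      (expZ (pExp μ) * MvPolynomial.coeff (pExp μ) (schur η))),
      ← sum_expsOf d (fun m => MvPolynomial.coeff m (schur ν) *
      (expZ m * MvPolynomial.coeff m (schur η))),
      sum_expZ_mul_coeff_schur (mem_partitionsOf.mp ν.2) (mem_partitionsOf.mp η.2)]
    simp only [Subtype.ext_iff]
  have hBA0 : B * A = 1 := mul_eq_one_comm.mp hAB
  have hBA := congrFun (congrFun hBA0 ⟨μ, mem_partitionsOf.mpr hm⟩)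
    ⟨μ', mem_partitionsOf.mpr hm'⟩
  rw [Matrix.mul_apply, Matrix.one_apply] at hBA
  simp only [A, B, Matrix.of_apply, mul_assoc] at hBA
  rw [← Finset.mul_sum, Finset.sum_coe_sort (partitionsOf d) (fun η =>
    MvPolynomial.coeff (pExp μ) (schur η) * MvPolynomial.coeff (pExp μ') (schur η))] at hBA
  have hz := expZ_ne_zero (pExp μ)
  have e : (pExp μ = pExp μ') ↔ μ = μ' := pExp_injective.eq_iff
  simp only [e]
  simp only [Subtype.mk.injEq] at hBA
  rw [eq_comm, ← mul_right_inj' hz, hBA]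
  split_ifs
  · exact mul_inv_cancel₀ hz
  · simp

theorem sum_partitionsOf_monomial {d : ℕ} {m : ℕ+ →₀ ℕ} (hm : expSize m = d) :
    ∑ η ∈ partitionsOf d, MvPolynomial.C (MvPolynomial.coeff m (schur η)) * schur η =
      MvPolynomial.monomial m ((expZ m : ℚ)⁻¹) := by
  classical
  ext m'
  rw [MvPolynomial.coeff_sum, MvPolynomial.coeff_monomial]
  simp only [MvPolynomial.coeff_C_mul]
  by_cases hm' : expSize m' = d
  · rw [sum_coeff_schur_mul (mem_expsOf.mpr hm) (mem_expsOf.mpr hm')]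
  · rw [if_neg (by rintro rfl; exact hm' hm)]
    refine Finset.sum_eq_zero fun η hη => ?_
    rw [coeff_schur_eq_zero (m := m') (by rw [mem_partitionsOf.mp hη]; exact hm'), mul_zero]

/-- The expansion of a symmetric function in Schur functions. -/
theorem eq_sum_schurCoeff {f : SymmFun} {D N : ℕ} (hf : ∀ m ∈ f.support, expSize m ≤ D)
    (hN : D ≤ N) : f = ∑ k ∈ Finset.range (D + 1), ∑ η ∈ partitionsOf k,
      MvPolynomial.C (schurCoeff N η f) * schur η := by
  have key : ∀ (m : ℕ+ →₀ ℕ) (c : ℚ), expSize m ≤ D → MvPolynomial.monomial m c =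
      ∑ k ∈ Finset.range (D + 1), ∑ η ∈ partitionsOf k,
        MvPolynomial.C (schurCoeff N η (MvPolynomial.monomial m c)) * schur η := by
    intro m c hm
    rw [Finset.sum_eq_single_of_mem (expSize m) (by simp; omega)]
    · have h1 : ∀ η ∈ partitionsOf (expSize m),
          MvPolynomial.C (schurCoeff N η (MvPolynomial.monomial m c)) * schur η =
          MvPolynomial.C (c * expZ m) *
            (MvPolynomial.C (MvPolynomial.coeff m (schur η)) * schur η) := by
        intro η hη
        have h2 := len_le_card η
        rw [mem_partitionsOf.mp hη] at h2
        rw [schurCoeff_monomial (by omega), ← mul_assoc, ← mul_assoc, ← MvPolynomial.C_mul]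
      rw [Finset.sum_congr rfl h1, ← Finset.mul_sum, sum_partitionsOf_monomial rfl,
        MvPolynomial.C_mul_monomial, mul_assoc, mul_inv_cancel₀ (expZ_ne_zero m), mul_one]
    · intro k hk hkm
      refine Finset.sum_eq_zero fun η hη => ?_
      have h2 := len_le_card η
      rw [mem_partitionsOf.mp hη] at h2
      have h3 := Finset.mem_range.mp hk
      rw [schurCoeff_monomial (by omega), coeff_schur_eq_zero (by
        rw [mem_partitionsOf.mp hη]; exact fun e => hkm e.symm)]
      simp
  conv_lhs => rw [f.as_sum]
  rw [Finset.sum_congr rfl fun m hm => key m _ (hf m hm), Finset.sum_comm]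
  refine Finset.sum_congr rfl fun k _ => ?_
  rw [Finset.sum_comm]
  refine Finset.sum_congr rfl fun η _ => ?_
  rw [← Finset.sum_mul, ← map_sum, ← map_sum, ← f.as_sum]

/-! ### Summation formulas for skew Schur functions -/

/-- Polynomial identities in two sets of Newton functions may be checked at rational points. -/
theorem aeval_sum_eq_of_rat {R : Type*} [CommRing R] [Algebra ℚ R] (x y : ℕ+ → R)
    {P Q : MvPolynomial (ℕ+ ⊕ ℕ+) ℚ}
    (h : ∀ x y : ℕ+ → ℚ, MvPolynomial.aeval (Sum.elim x y) P = MvPolynomial.aeval (Sum.elim x y) Q) :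
    MvPolynomial.aeval (Sum.elim x y) P = MvPolynomial.aeval (Sum.elim x y) Q := by
  have : P = Q := by
    refine MvPolynomial.funext fun z => ?_
    have h1 := h (fun n => z (Sum.inl n)) (fun n => z (Sum.inr n))
    rw [show Sum.elim (fun n => z (Sum.inl n)) (fun n => z (Sum.inr n)) = z from
      Sum.elim_comp_inl_inr z] at h1
    simpa [MvPolynomial.aeval_eq_eval] using h1
  rw [this]

section

variable {R : Type*} [CommRing R] [Algebra ℚ R]

theorem aeval_elim_inl (x y : ℕ+ → R) (f : SymmFun) :
    MvPolynomial.aeval (Sum.elim x y) (MvPolynomial.rename Sum.inl f : MvPolynomial (ℕ+ ⊕ ℕ+) ℚ) =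
      MvPolynomial.aeval x f := by
  rw [MvPolynomial.aeval_rename, Sum.elim_comp_inl]

theorem aeval_elim_inr (x y : ℕ+ → R) (f : SymmFun) :
    MvPolynomial.aeval (Sum.elim x y) (MvPolynomial.rename Sum.inr f : MvPolynomial (ℕ+ ⊕ ℕ+) ℚ) =
      MvPolynomial.aeval y f := by
  rw [MvPolynomial.aeval_rename, Sum.elim_comp_inr]

theorem aeval_elim_add (x y : ℕ+ → R) (f : SymmFun) :
    MvPolynomial.aeval (Sum.elim x y) (MvPolynomial.aeval (fun n : ℕ+ =>
      (MvPolynomial.X (Sum.inl n) + MvPolynomial.X (Sum.inr n) : MvPolynomial (ℕ+ ⊕ ℕ+) ℚ)) f) =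
      MvPolynomial.aeval (x + y) f := by
  rw [← AlgHom.comp_apply, MvPolynomial.comp_aeval]
  congr 2
  ext1 n
  simp

theorem aeval_elim_mul (x y : ℕ+ → R) (f : SymmFun) :
    MvPolynomial.aeval (Sum.elim x y) (MvPolynomial.aeval (fun n : ℕ+ =>
      (MvPolynomial.X (Sum.inl n) * MvPolynomial.X (Sum.inr n) : MvPolynomial (ℕ+ ⊕ ℕ+) ℚ)) f) =
      MvPolynomial.aeval (x * y) f := by
  rw [← AlgHom.comp_apply, MvPolynomial.comp_aeval]
  congr 2
  ext1 n
  simp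

theorem aeval_translate_eq_sum (y : ℕ+ → ℚ) (μ : YoungDiagram) :
    MvPolynomial.aeval (fun n => MvPolynomial.X n + MvPolynomial.C (y n) : ℕ+ → SymmFun) (schur μ) =
      ∑ k ∈ Finset.range (μ.card + 1), ∑ η ∈ partitionsOf k,
        MvPolynomial.C (MvPolynomial.aeval y (skewSchur μ η)) * schur η := by
  set f := MvPolynomial.aeval (fun n => MvPolynomial.X n + MvPolynomial.C (y n) : ℕ+ → SymmFun)
    (schur μ) with hf
  set D := f.support.sup expSize + μ.card
  have h1 : ∀ m ∈ f.support, expSize m ≤ D := fun m hm =>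
    (Finset.le_sup (f := expSize) hm).trans (Nat.le_add_right _ _)
  rw [eq_sum_schurCoeff h1 le_rfl]
  have h2 : ∀ k ∈ Finset.range (D + 1), (∑ η ∈ partitionsOf k,
      MvPolynomial.C (schurCoeff D η f) * schur η) = ∑ η ∈ partitionsOf k,
        MvPolynomial.C (MvPolynomial.aeval y (skewSchur μ η)) * schur η := by
    intro k hk
    refine Finset.sum_congr rfl fun η hη => ?_
    have h3 := len_le_card η
    have h4 := Finset.mem_range.mp hk
    rw [mem_partitionsOf.mp hη] at h3
    rw [hf, schurCoeff_translate y ((len_le_card μ).trans (Nat.le_add_left _ _)) (by omega)]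
  rw [Finset.sum_congr rfl h2]
  symm
  refine Finset.sum_subset (Finset.range_mono (by omega)) fun k _ hk => ?_
  refine Finset.sum_eq_zero fun η hη => ?_
  rw [skewSchur_eq_zero (by rw [mem_partitionsOf.mp hη]; simpa using hk)]
  simp

/-- `s_μ(x + y) = ∑_η s_{μ/η}(y) s_η(x)`. -/
theorem aeval_add_schur (x y : ℕ+ → R) (μ : YoungDiagram) :
    MvPolynomial.aeval (x + y) (schur μ) =
      ∑ k ∈ Finset.range (μ.card + 1), ∑ η ∈ partitionsOf k,
        MvPolynomial.aeval y (skewSchur μ η) * MvPolynomial.aeval x (schur η) := by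
  have h := aeval_sum_eq_of_rat x y
    (P := MvPolynomial.aeval (fun n : ℕ+ => (MvPolynomial.X (Sum.inl n) +
      MvPolynomial.X (Sum.inr n) : MvPolynomial (ℕ+ ⊕ ℕ+) ℚ)) (schur μ))
    (Q := ∑ k ∈ Finset.range (μ.card + 1), ∑ η ∈ partitionsOf k,
      MvPolynomial.rename Sum.inr (skewSchur μ η) * MvPolynomial.rename Sum.inl (schur η))
    (fun x y => by
      have h1 := congrArg (MvPolynomial.aeval x) (aeval_translate_eq_sum y μ)
      rw [← AlgHom.comp_apply, MvPolynomial.comp_aeval] at h1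
      rw [aeval_elim_add]
      simp only [map_sum, map_mul, aeval_elim_inl, aeval_elim_inr]
      simp only [map_sum, map_mul, MvPolynomial.aeval_C, Algebra.algebraMap_self,
        RingHom.id_apply] at h1
      rw [← h1]
      congr 2
      ext1 n
      simp)
  rw [aeval_elim_add] at h
  rw [h]
  simp only [map_sum, map_mul, aeval_elim_inl, aeval_elim_inr]

/-- Cauchy's identity. -/
theorem sum_aeval_schur_mul (u v : ℕ+ → R) (d : ℕ) :
    ∑ ν ∈ partitionsOf d, MvPolynomial.aeval u (schur ν) * MvPolynomial.aeval v (schur ν) =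
      MvPolynomial.aeval (u * v) (hSymm d) := by
  classical
  have h1 : ∀ ν ∈ partitionsOf d, MvPolynomial.aeval u (schur ν) * MvPolynomial.aeval v (schur ν) =
      ∑ m ∈ expsOf d, ∑ m' ∈ expsOf d, algebraMap ℚ R (MvPolynomial.coeff m (schur ν) *
        MvPolynomial.coeff m' (schur ν)) * ((m.prod fun n c => u n ^ c) *
          m'.prod fun n c => v n ^ c) := by
    intro ν hν
    rw [aeval_schur, aeval_schur, mem_partitionsOf.mp hν, Finset.sum_mul_sum]
    refine Finset.sum_congr rfl fun m _ => Finset.sum_congr rfl fun m' _ => ?_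
    rw [map_mul]
    ring
  rw [Finset.sum_congr rfl h1, Finset.sum_comm, aeval_hSymm]
  refine Finset.sum_congr rfl fun m hm => ?_
  rw [Finset.sum_comm]
  have h2 : ∀ m' ∈ expsOf d, (∑ ν ∈ partitionsOf d, algebraMap ℚ R (MvPolynomial.coeff m (schur ν) *
        MvPolynomial.coeff m' (schur ν)) * ((m.prod fun n c => u n ^ c) *
          m'.prod fun n c => v n ^ c)) = if m = m' then algebraMap ℚ R ((expZ m : ℚ)⁻¹) *
            ((m.prod fun n c => u n ^ c) * m.prod fun n c => v n ^ c) else 0 := by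
    intro m' hm'
    rw [← Finset.sum_mul, ← map_sum, sum_coeff_schur_mul hm hm']
    split_ifs with h
    · subst h; rfl
    · simp
  rw [Finset.sum_congr rfl h2, Finset.sum_ite_eq, if_pos hm]
  simp only [Pi.mul_apply, mul_pow]
  rw [Finsupp.prod_mul]

/-- The skew Cauchy identity
`∑_{|ν| = d} s_ν(x) s_{ν/η}(y) = h_{d - |η|}(xy) s_η(x)` at rational points: compare the
coefficients of `s_η(z)` in Cauchy's identity at `x` and `y + z`. -/
theorem sum_schur_mul_skewSchur_rat (x y : ℕ+ → ℚ) (d : ℕ) (η : YoungDiagram) :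
    ∑ ν ∈ partitionsOf d, MvPolynomial.aeval x (schur ν) * MvPolynomial.aeval y (skewSchur ν η) =
      MvPolynomial.aeval (x * y) (hSymm ((d : ℤ) - η.card)) * MvPolynomial.aeval x (schur η) := by
  classical
  set N := d + η.card
  have hη : len η ≤ N := (len_le_card η).trans (Nat.le_add_left _ _)
  have hsc : ∀ k ≤ d, ∀ ν ∈ partitionsOf k, schurCoeff N η (schur ν) = if ν = η then 1 else 0 := by
    intro k hk ν hν
    have h3 := len_le_card ν
    rw [mem_partitionsOf.mp hν] at h3
    exact schurCoeff_schur (by omega) hη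
  -- the Cauchy identity at `x` and at `z + y`, with the indeterminates `p_n` as the power sums of `z`
  set xC : ℕ+ → SymmFun := fun n => MvPolynomial.C (x n)
  have hxC : ∀ f, MvPolynomial.aeval xC f = MvPolynomial.C (MvPolynomial.aeval x f) := fun f =>
    (MvPolynomial.map_aeval x (MvPolynomial.C : ℚ →+* SymmFun) f).symm
  have h1 := congrArg (schurCoeff N η) (sum_aeval_schur_mul xC
    (fun n => MvPolynomial.X n + MvPolynomial.C (y n) : ℕ+ → SymmFun) d)
  rw [map_sum] at h1
  have h2 : ∀ ν ∈ partitionsOf d, schurCoeff N η (MvPolynomial.aeval xC (schur ν) *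
      MvPolynomial.aeval (fun n => MvPolynomial.X n + MvPolynomial.C (y n) : ℕ+ → SymmFun)
        (schur ν)) = MvPolynomial.aeval x (schur ν) * MvPolynomial.aeval y (skewSchur ν η) := by
    intro ν hν
    have h3 := len_le_card ν
    rw [mem_partitionsOf.mp hν] at h3
    rw [hxC, MvPolynomial.C_mul', map_smul, smul_eq_mul, schurCoeff_translate y (by omega) hη]
  rw [Finset.sum_congr rfl h2] at h1
  rw [h1, ← coeff_hSer]
  have h4 : (xC * fun n => MvPolynomial.X n + MvPolynomial.C (y n)) =
      (fun n => MvPolynomial.C ((x * y) n)) + xC * MvPolynomial.X := by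
    ext1 n
    simp only [Pi.mul_apply, Pi.add_apply, xC, MvPolynomial.C_mul]
    ring
  rw [h4, hSer_add, PowerSeries.coeff_mul, map_sum]
  have h5 : ∀ p ∈ antidiagonal d, schurCoeff N η
      (PowerSeries.coeff p.1 (hSer (fun n => (MvPolynomial.C ((x * y) n) : SymmFun))) *
        PowerSeries.coeff p.2 (hSer (xC * MvPolynomial.X))) =
      if p.2 = η.card then MvPolynomial.aeval (x * y) (hSymm p.1) * MvPolynomial.aeval x (schur η)
        else 0 := by
    intro p hp
    have hp' := mem_antidiagonal.mp hp
    have h6 : PowerSeries.coeff p.1 (hSer (fun n => (MvPolynomial.C ((x * y) n) : SymmFun))) =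
        MvPolynomial.C (MvPolynomial.aeval (x * y) (hSymm p.1)) := by
      rw [coeff_hSer]
      exact (MvPolynomial.map_aeval (x * y) (MvPolynomial.C : ℚ →+* SymmFun) _).symm
    rw [h6, MvPolynomial.C_mul', map_smul, smul_eq_mul, coeff_hSer, ← sum_aeval_schur_mul xC,
      map_sum]
    have h7 : ∀ ν ∈ partitionsOf p.2, schurCoeff N η (MvPolynomial.aeval xC (schur ν) *
        MvPolynomial.aeval MvPolynomial.X (schur ν)) =
        if ν = η then MvPolynomial.aeval x (schur η) else 0 := by
      intro ν hν
      rw [hxC, MvPolynomial.C_mul', map_smul, smul_eq_mul, MvPolynomial.aeval_X_left_apply,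
        hsc p.2 (by omega) ν hν]
      split_ifs with h
      · subst h; rw [mul_one]
      · rw [mul_zero]
    rw [Finset.sum_congr rfl h7, Finset.sum_ite_eq']
    simp only [mem_partitionsOf, eq_comm (a := η.card)]
    split_ifs
    · rfl
    · rw [mul_zero]
  rw [Finset.sum_congr rfl h5]
  by_cases hd : η.card ≤ d
  · rw [Finset.sum_eq_single_of_mem (d - η.card, η.card) (by rw [mem_antidiagonal]; omega)]
    · rw [if_pos rfl]
      congr 3
      omega
    · intro p hp hne
      rw [if_neg]
      intro h
      apply hne
      have := mem_antidiagonal.mp hp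
      ext <;> simp <;> omega
  · rw [hSymm_of_neg (by omega), map_zero, zero_mul]
    refine Finset.sum_eq_zero fun p hp => if_neg ?_
    have := mem_antidiagonal.mp hp
    omega

/-- The skew Cauchy identity. -/
theorem sum_schur_mul_skewSchur (x y : ℕ+ → R) (d : ℕ) (η : YoungDiagram) :
    ∑ ν ∈ partitionsOf d, MvPolynomial.aeval x (schur ν) * MvPolynomial.aeval y (skewSchur ν η) =
      MvPolynomial.aeval (x * y) (hSymm ((d : ℤ) - η.card)) * MvPolynomial.aeval x (schur η) := by
  have h := aeval_sum_eq_of_rat x y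
    (P := ∑ ν ∈ partitionsOf d,
      MvPolynomial.rename Sum.inl (schur ν) * MvPolynomial.rename Sum.inr (skewSchur ν η))
    (Q := MvPolynomial.aeval (fun n : ℕ+ => (MvPolynomial.X (Sum.inl n) *
      MvPolynomial.X (Sum.inr n) : MvPolynomial (ℕ+ ⊕ ℕ+) ℚ)) (hSymm ((d : ℤ) - η.card)) *
        MvPolynomial.rename Sum.inl (schur η))
    (fun x y => by
      simp only [map_sum, map_mul, aeval_elim_inl, aeval_elim_inr, aeval_elim_mul]
      exact sum_schur_mul_skewSchur_rat x y d η)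
  simpa only [map_sum, map_mul, aeval_elim_inl, aeval_elim_inr, aeval_elim_mul] using h

end

/-! ### The cut-and-join operator -/

/-- The cut-and-join operator
`∑_{i,j} ((i + j) p_i p_j ∂_{i+j} + i j p_{i+j} ∂_i ∂_j)`, truncated to `i + j ≤ M` in the cut part
and `i, j ≤ M` in the join part. On functions of degree at most `M` the truncation has no effect.
The variable `p_{n+1}` is written `X n.succPNat`. -/
def cutJoin (M : ℕ) (f : SymmFun) : SymmFun :=
  ∑ n ∈ Finset.range M, ((n : SymmFun) + 1) * (∑ a ∈ Finset.range n,
      MvPolynomial.X a.succPNat * MvPolynomial.X (n - 1 - a).succPNat) *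
        MvPolynomial.pderiv n.succPNat f +
    ∑ i ∈ Finset.range M, ∑ j ∈ Finset.range M, ((i : SymmFun) + 1) * ((j : SymmFun) + 1) *
      MvPolynomial.X (i + j + 1).succPNat *
        MvPolynomial.pderiv i.succPNat (MvPolynomial.pderiv j.succPNat f)

section Eigen

variable {V : ℕ}

/-- The value of a symmetric function at the power sums of `V` variables. -/
def finEval (V : ℕ) : SymmFun →ₐ[ℚ] MvPolynomial (Fin V) ℚ :=
  MvPolynomial.aeval (powerSum MvPolynomial.X)

/-- The operator `w_k ∂ / ∂ w_k`. -/
def eulerAt (k : Fin V) : Derivation ℚ (MvPolynomial (Fin V) ℚ) (MvPolynomial (Fin V) ℚ) :=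
  (MvPolynomial.X k : MvPolynomial (Fin V) ℚ) • MvPolynomial.pderiv k

theorem eulerAt_apply (k : Fin V) (f : MvPolynomial (Fin V) ℚ) :
    eulerAt k f = MvPolynomial.X k * MvPolynomial.pderiv k f := rfl

theorem eulerAt_X_pow (k : Fin V) (a : ℕ) :
    eulerAt k (MvPolynomial.X k ^ a : MvPolynomial (Fin V) ℚ) =
      (a : MvPolynomial (Fin V) ℚ) * MvPolynomial.X k ^ a := by
  rw [eulerAt_apply, MvPolynomial.pderiv_pow, MvPolynomial.pderiv_X_self]
  rcases a with _ | a
  · simp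
  · rw [Nat.add_sub_cancel, pow_succ]; ring

theorem eulerAt_powerSum (k : Fin V) (n : ℕ) :
    eulerAt k (powerSum MvPolynomial.X n.succPNat : MvPolynomial (Fin V) ℚ) =
      ((n : MvPolynomial (Fin V) ℚ) + 1) * MvPolynomial.X k ^ (n + 1) := by
  rw [powerSum, map_sum, Finset.sum_eq_single k]
  · rw [Nat.succPNat_coe, Nat.succ_eq_add_one, eulerAt_X_pow]; push_cast; rfl
  · intro l _ hl
    rw [eulerAt_apply, MvPolynomial.pderiv_pow, MvPolynomial.pderiv_X_of_ne hl, mul_zero, mul_zero]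
  · simp

theorem eulerAt_monomial (k : Fin V) (β : Fin V →₀ ℕ) (c : ℚ) :
    eulerAt k (MvPolynomial.monomial β c) = (β k : ℚ) • MvPolynomial.monomial β c := by
  rw [eulerAt_apply, MvPolynomial.X_mul_pderiv_monomial, Nat.cast_smul_eq_nsmul]

/-- The chain rule for the substitution of power sums. -/
theorem exists_chain_rule (D : Derivation ℚ (MvPolynomial (Fin V) ℚ) (MvPolynomial (Fin V) ℚ))
    (f : SymmFun) : ∃ M₀, ∀ M ≥ M₀, D (finEval V f) = ∑ n ∈ Finset.range M,
      finEval V (MvPolynomial.pderiv n.succPNat f) * D (powerSum MvPolynomial.X n.succPNat) := by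
  induction f using MvPolynomial.induction_on with
  | C c =>
    refine ⟨0, fun M _ => ?_⟩
    have : finEval V (MvPolynomial.C c) = algebraMap ℚ _ c := MvPolynomial.aeval_C _ _
    rw [this, D.map_algebraMap]
    simp
  | add f g hf hg =>
    obtain ⟨M₁, h₁⟩ := hf
    obtain ⟨M₂, h₂⟩ := hg
    refine ⟨max M₁ M₂, fun M hM => ?_⟩
    rw [map_add, map_add, h₁ M (le_of_max_le_left hM), h₂ M (le_of_max_le_right hM),
      ← Finset.sum_add_distrib]
    refine Finset.sum_congr rfl fun n _ => ?_
    rw [map_add, map_add, add_mul]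
  | mul_X f i hf =>
    obtain ⟨M₁, h₁⟩ := hf
    refine ⟨max M₁ (i.natPred + 1), fun M hM => ?_⟩
    have hX : finEval V (MvPolynomial.X i) = powerSum MvPolynomial.X i := MvPolynomial.aeval_X _ _
    rw [map_mul, hX, Derivation.leibniz, h₁ M (le_of_max_le_left hM), smul_eq_mul, smul_eq_mul]
    have hi : i.natPred ∈ Finset.range M :=
      Finset.mem_range.mpr (le_of_max_le_right hM)
    have h3 : finEval V f * D (powerSum MvPolynomial.X i) = ∑ n ∈ Finset.range M,
        finEval V (f * MvPolynomial.pderiv n.succPNat (MvPolynomial.X i)) *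
          D (powerSum MvPolynomial.X n.succPNat) := by
      rw [Finset.sum_eq_single_of_mem _ hi]
      · rw [PNat.succPNat_natPred, MvPolynomial.pderiv_X_self, mul_one]
      · intro n _ hn
        rw [MvPolynomial.pderiv_X_of_ne, mul_zero, map_zero, zero_mul]
        rintro rfl
        exact hn (Nat.natPred_succPNat n).symm
    rw [h3, Finset.mul_sum, ← Finset.sum_add_distrib]
    refine Finset.sum_congr rfl fun n _ => ?_
    rw [Derivation.leibniz, smul_eq_mul, smul_eq_mul, map_add, map_mul,
      map_mul (finEval V) (MvPolynomial.X i), hX]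
    ring

/-- The Newton functions occurring in `f` are among `p_1, …, p_M`. -/
def DegreeBounded (M : ℕ) (f : SymmFun) : Prop := ∀ n ≥ M, MvPolynomial.pderiv n.succPNat f = 0

theorem pderiv_pderiv_comm (i j : ℕ+) (f : SymmFun) :
    MvPolynomial.pderiv i (MvPolynomial.pderiv j f) =
      MvPolynomial.pderiv j (MvPolynomial.pderiv i f) := by
  classical
  by_cases hij : i = j
  · rw [hij]
  ext m
  simp only [MvPolynomial.coeff_pderiv]
  have h1 : Finsupp.single i 1 j = 0 := by simp [hij]
  have h2 : Finsupp.single j 1 i = 0 := by simp [Ne.symm hij]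
  rw [add_right_comm]
  simp only [Finsupp.add_apply, h1, h2, add_zero]
  ring

theorem DegreeBounded.pderiv {M : ℕ} {f : SymmFun} (h : DegreeBounded M f) (i : ℕ+) :
    DegreeBounded M (MvPolynomial.pderiv i f) := fun n hn => by
  rw [pderiv_pderiv_comm, h n hn, map_zero]

theorem degreeBounded_schur {M : ℕ} {μ : YoungDiagram} (h : μ.card ≤ M) :
    DegreeBounded M (schur μ) := fun n hn => by
  ext m
  rw [MvPolynomial.coeff_pderiv, coeff_schur_eq_zero, zero_mul, MvPolynomial.coeff_zero]
  rw [expSize_add, expSize_single, Nat.succPNat_coe]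
  omega

theorem chain_rule (D : Derivation ℚ (MvPolynomial (Fin V) ℚ) (MvPolynomial (Fin V) ℚ))
    {M : ℕ} {f : SymmFun} (hf : DegreeBounded M f) : D (finEval V f) = ∑ n ∈ Finset.range M,
      finEval V (MvPolynomial.pderiv n.succPNat f) * D (powerSum MvPolynomial.X n.succPNat) := by
  obtain ⟨M₀, h⟩ := exists_chain_rule D f
  rw [h (M₀ + M) (by omega)]
  symm
  refine Finset.sum_subset (Finset.range_mono (by omega)) fun n _ hn => ?_
  rw [hf n (by simpa using hn), map_zero, zero_mul]

theorem eulerAt_finEval (k : Fin V) {M : ℕ} {f : SymmFun} (hf : DegreeBounded M f) :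
    eulerAt k (finEval V f) = ∑ n ∈ Finset.range M, ((n : MvPolynomial (Fin V) ℚ) + 1) *
      MvPolynomial.X k ^ (n + 1) * finEval V (MvPolynomial.pderiv n.succPNat f) := by
  rw [chain_rule _ hf]
  refine Finset.sum_congr rfl fun n _ => ?_
  rw [eulerAt_powerSum]
  ring

theorem eulerAt_eulerAt_finEval (k : Fin V) {M : ℕ} {f : SymmFun} (hf : DegreeBounded M f) :
    eulerAt k (eulerAt k (finEval V f)) =
      ∑ n ∈ Finset.range M, ((n : MvPolynomial (Fin V) ℚ) + 1) ^ 2 * MvPolynomial.X k ^ (n + 1) *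
        finEval V (MvPolynomial.pderiv n.succPNat f) +
      ∑ i ∈ Finset.range M, ∑ j ∈ Finset.range M, ((i : MvPolynomial (Fin V) ℚ) + 1) *
        ((j : MvPolynomial (Fin V) ℚ) + 1) * MvPolynomial.X k ^ (i + j + 1 + 1) *
          finEval V (MvPolynomial.pderiv i.succPNat (MvPolynomial.pderiv j.succPNat f)) := by
  rw [eulerAt_finEval k hf, map_sum]
  have h : ∀ n ∈ Finset.range M, eulerAt k (((n : MvPolynomial (Fin V) ℚ) + 1) *
      MvPolynomial.X k ^ (n + 1) * finEval V (MvPolynomial.pderiv n.succPNat f)) =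
      ((n : MvPolynomial (Fin V) ℚ) + 1) ^ 2 * MvPolynomial.X k ^ (n + 1) *
        finEval V (MvPolynomial.pderiv n.succPNat f) +
      ∑ i ∈ Finset.range M, ((i : MvPolynomial (Fin V) ℚ) + 1) *
        ((n : MvPolynomial (Fin V) ℚ) + 1) * MvPolynomial.X k ^ (i + n + 1 + 1) *
          finEval V (MvPolynomial.pderiv i.succPNat (MvPolynomial.pderiv n.succPNat f)) := by
    intro n _
    have hc : eulerAt k ((n : MvPolynomial (Fin V) ℚ) + 1) = 0 := by
      rw [map_add, Derivation.map_natCast, Derivation.map_one_eq_zero, add_zero]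
    have hA : eulerAt k (((n : MvPolynomial (Fin V) ℚ) + 1) * MvPolynomial.X k ^ (n + 1)) =
        ((n : MvPolynomial (Fin V) ℚ) + 1) ^ 2 * MvPolynomial.X k ^ (n + 1) := by
      rw [Derivation.leibniz, hc, eulerAt_X_pow, smul_eq_mul, smul_eq_mul]
      push_cast
      ring
    rw [(eulerAt k).leibniz (((n : MvPolynomial (Fin V) ℚ) + 1) * MvPolynomial.X k ^ (n + 1)), hA,
      eulerAt_finEval k (hf.pderiv _), smul_eq_mul, smul_eq_mul]
    rw [Finset.mul_sum, add_comm, mul_comm (finEval V _)]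
    rw [add_right_inj]
    refine Finset.sum_congr rfl fun i _ => ?_
    ring
  refine (Finset.sum_congr rfl h).trans ?_
  rw [Finset.sum_add_distrib, add_right_inj, Finset.sum_comm]

/-- The sum `∑_{i + j = m + 1} p_i p_j` of products of power sums, where `i, j ≥ 1`. -/
def powerSumConv (V m : ℕ) : MvPolynomial (Fin V) ℚ := ∑ a ∈ Finset.range m,
  powerSum MvPolynomial.X a.succPNat * powerSum MvPolynomial.X (m - 1 - a).succPNat

theorem map_prod_of_log {ι A : Type*} [CommRing A] [Algebra ℚ A] (D : Derivation ℚ A A)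
    (s : Finset ι) (t r : ι → A) (h : ∀ i ∈ s, D (t i) = t i * r i) :
    D (∏ i ∈ s, t i) = (∏ i ∈ s, t i) * ∑ i ∈ s, r i := by
  classical
  induction s using Finset.induction_on with
  | empty => simp
  | insert i s hi ih =>
    rw [Finset.prod_insert hi, Finset.sum_insert hi, Derivation.leibniz,
      ih fun j hj => h j (Finset.mem_insert_of_mem hj), h i (Finset.mem_insert_self i s)]
    simp only [smul_eq_mul]
    ring

theorem two_mul_sum_Ioi {A : Type*} [CommRing A] (r : Fin V → Fin V → A)
    (hr : ∀ i j, r i j = r j i) :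
    2 * ∑ i, ∑ j ∈ Finset.Ioi i, r i j = ∑ i, ∑ j, r i j - ∑ i, r i i := by
  have h1 : ∑ i, ∑ j, r i j = ∑ i, ∑ j ∈ Finset.Ioi i, r i j + ∑ i, ∑ j ∈ Finset.Iio i, r i j +
      ∑ i, r i i := by
    rw [← Finset.sum_add_distrib, ← Finset.sum_add_distrib]
    refine Finset.sum_congr rfl fun i _ => ?_
    have h2 : (Finset.univ : Finset (Fin V)) =
        Finset.disjUnion (Finset.Ioi i) (Finset.Iic i)
          (Finset.disjoint_left.mpr fun j hj hj' => by
            rw [Finset.mem_Ioi] at hj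
            rw [Finset.mem_Iic] at hj'
            exact absurd hj (not_lt.mpr hj')) := by
      ext j
      simp [lt_or_ge]
    rw [h2, Finset.sum_disjUnion, add_assoc]
    congr 1
    rw [← Finset.Iio_insert, Finset.sum_insert (by simp), add_comm]
  have h2 : ∑ i, ∑ j ∈ Finset.Iio i, r i j = ∑ i, ∑ j ∈ Finset.Ioi i, r i j := by
    rw [Finset.sum_comm' (t' := Finset.univ) (s' := fun j => Finset.Ioi j) (by simp)]
    exact Finset.sum_congr rfl fun i _ => Finset.sum_congr rfl fun j _ => hr _ _
  rw [h1, h2]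
  ring

theorem exists_alternant_eq (V : ℕ) : ∃ c : ℚ,
    alternant (MvPolynomial.X : Fin V → MvPolynomial (Fin V) ℚ) =
      c • ∏ i : Fin V, ∏ j ∈ Finset.Ioi i, (MvPolynomial.X j - MvPolynomial.X i) := by
  refine ⟨((Equiv.Perm.sign (Fin.revPerm : Equiv.Perm (Fin V)) : ℤ) : ℚ), ?_⟩
  rw [← Matrix.det_vandermonde, ← Matrix.det_transpose, alternant]
  have h := Matrix.det_permute (Fin.revPerm : Equiv.Perm (Fin V))
    (Matrix.vandermonde (MvPolynomial.X : Fin V → MvPolynomial (Fin V) ℚ)).transpose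
  have e : (Matrix.of fun i l : Fin V =>
      (MvPolynomial.X l : MvPolynomial (Fin V) ℚ) ^ (V - 1 - (i : ℕ))) =
      (Matrix.vandermonde (MvPolynomial.X : Fin V → MvPolynomial (Fin V) ℚ)).transpose.submatrix
        (Fin.revPerm : Equiv.Perm (Fin V)) id := by
    ext1 i l
    rw [Matrix.submatrix_apply, Matrix.transpose_apply, Matrix.vandermonde_apply, Matrix.of_apply,
      Fin.revPerm_apply, Fin.val_rev]
    congr 1
    omega
  rw [e, h, MvPolynomial.smul_eq_C_mul]
  congr 1

/-- The vector field `∑_k w_k^{m+2} ∂_k` multiplies the alternant by a symmetric function. -/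
theorem two_mul_sum_pow_mul_eulerAt_alternant (V m : ℕ) :
    2 * ∑ k, MvPolynomial.X k ^ (m + 1) *
        eulerAt k (alternant (MvPolynomial.X : Fin V → MvPolynomial (Fin V) ℚ)) =
      alternant (MvPolynomial.X : Fin V → MvPolynomial (Fin V) ℚ) *
        (powerSumConv V m + (2 * (V : MvPolynomial (Fin V) ℚ) - (m : MvPolynomial (Fin V) ℚ) - 2) *
          powerSum MvPolynomial.X m.succPNat) := by
  obtain ⟨c, hc⟩ := exists_alternant_eq V
  set D : Derivation ℚ (MvPolynomial (Fin V) ℚ) (MvPolynomial (Fin V) ℚ) :=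
    ∑ k, (MvPolynomial.X k ^ (m + 1) : MvPolynomial (Fin V) ℚ) • eulerAt k with hD
  have hDapp : ∀ f, D f = ∑ k, MvPolynomial.X k ^ (m + 1) * eulerAt k f := by
    intro f
    have := congrFun (map_sum (Derivation.coeFnAddMonoidHom (R := ℚ)
      (A := MvPolynomial (Fin V) ℚ) (M := MvPolynomial (Fin V) ℚ))
      (fun k => (MvPolynomial.X k ^ (m + 1) : MvPolynomial (Fin V) ℚ) • eulerAt k) Finset.univ) f
    rw [Finset.sum_apply] at this
    exact this
  have hDX : ∀ i, D (MvPolynomial.X i) = MvPolynomial.X i ^ (m + 2) := by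
    intro i
    rw [hDapp, Finset.sum_eq_single i]
    · rw [eulerAt_apply, MvPolynomial.pderiv_X_self]; ring
    · intro k _ hk
      rw [eulerAt_apply, MvPolynomial.pderiv_X_of_ne (Ne.symm hk), mul_zero, mul_zero]
    · simp
  -- `D (w_j - w_i) = w_j^{m+2} - w_i^{m+2}` is `w_j - w_i` times the geometric sum `r i j`
  set r : Fin V → Fin V → MvPolynomial (Fin V) ℚ := fun i j =>
    ∑ a ∈ Finset.range (m + 2), MvPolynomial.X j ^ a * MvPolynomial.X i ^ (m + 1 - a) with hr
  have hrs : ∀ i j, r i j = r j i := fun i j => by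
    have := geom_sum₂_comm (MvPolynomial.X j : MvPolynomial (Fin V) ℚ) (MvPolynomial.X i) (m + 2)
    simpa only [hr, show m + 2 - 1 = m + 1 from rfl] using this
  have h1 : D (∏ i : Fin V, ∏ j ∈ Finset.Ioi i, (MvPolynomial.X j - MvPolynomial.X i)) =
      (∏ i : Fin V, ∏ j ∈ Finset.Ioi i, (MvPolynomial.X j - MvPolynomial.X i)) *
        ∑ i, ∑ j ∈ Finset.Ioi i, r i j := by
    refine map_prod_of_log D _ _ _ fun i _ => map_prod_of_log D _ _ _ fun j _ => ?_
    rw [map_sub, hDX, hDX, mul_comm]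
    exact ((Commute.all (MvPolynomial.X j : MvPolynomial (Fin V) ℚ)
      (MvPolynomial.X i)).geom_sum₂_mul (m + 2)).symm
  have hpow : ∀ a : ℕ, powerSum (MvPolynomial.X : Fin V → MvPolynomial (Fin V) ℚ) a.succPNat =
      ∑ k, MvPolynomial.X k ^ (a + 1) := fun a => rfl
  have h2 : ∑ i, ∑ j, r i j = powerSumConv V m +
      2 * (V : MvPolynomial (Fin V) ℚ) * powerSum MvPolynomial.X m.succPNat := by
    have h3 : ∑ i, ∑ j, r i j = ∑ a ∈ Finset.range (m + 2),
        (∑ j : Fin V, (MvPolynomial.X j : MvPolynomial (Fin V) ℚ) ^ a) *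
          ∑ i : Fin V, MvPolynomial.X i ^ (m + 1 - a) := by
      simp only [hr]
      simp_rw [Finset.sum_mul_sum]
      rw [Finset.sum_comm' (t' := Finset.univ) (s' := fun _ => Finset.univ) (by simp),
        Finset.sum_comm]
      rw [Finset.sum_comm]
      simp_rw [Finset.sum_comm (s := Finset.univ) (t := Finset.range (m + 2))]
    rw [h3, Finset.sum_range_succ, Finset.sum_range_succ', powerSumConv]
    have h4 : ∀ a ∈ Finset.range m,
        (∑ j : Fin V, (MvPolynomial.X j : MvPolynomial (Fin V) ℚ) ^ (a + 1)) *
          ∑ i : Fin V, MvPolynomial.X i ^ (m + 1 - (a + 1)) =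
        powerSum MvPolynomial.X a.succPNat * powerSum MvPolynomial.X (m - 1 - a).succPNat := by
      intro a ha
      have := Finset.mem_range.mp ha
      rw [hpow, hpow]
      congr 3
      ext1 i
      congr 1
      omega
    rw [Finset.sum_congr rfl h4, hpow]
    simp
    ring
  have h3 : ∑ i, r i i = ((m : MvPolynomial (Fin V) ℚ) + 2) * powerSum MvPolynomial.X m.succPNat := by
    rw [hpow, Finset.mul_sum]
    refine Finset.sum_congr rfl fun i _ => ?_
    have h4 : ∀ a ∈ Finset.range (m + 2), (MvPolynomial.X i : MvPolynomial (Fin V) ℚ) ^ a *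
        MvPolynomial.X i ^ (m + 1 - a) = MvPolynomial.X i ^ (m + 1) := by
      intro a ha
      have := Finset.mem_range.mp ha
      rw [← pow_add]
      congr 1
      omega
    simp only [hr]
    rw [Finset.sum_congr rfl h4]
    simp
  have h4 := two_mul_sum_Ioi r hrs
  rw [h2, h3] at h4
  rw [← hDapp, hc, D.map_smul, h1]
  simp only [MvPolynomial.smul_eq_C_mul]
  linear_combination (MvPolynomial.C c * ∏ i : Fin V, ∏ j ∈ Finset.Ioi i,
    (MvPolynomial.X j - MvPolynomial.X i)) * h4

/-- The second-order operator `∑_k (θ_k^2 - (2 V - 1) θ_k)` with `θ_k = w_k ∂ / ∂ w_k`. -/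
def freeOperator (V : ℕ) (f : MvPolynomial (Fin V) ℚ) : MvPolynomial (Fin V) ℚ :=
  ∑ k, (eulerAt k (eulerAt k f) - (2 * (V : MvPolynomial (Fin V) ℚ) - 1) * eulerAt k f)

/-- Conjugation by the alternant turns the cut-and-join operator into an operator with constant
coefficients in the `θ_k`. -/
theorem alternant_mul_finEval_cutJoin {M : ℕ} {f : SymmFun} (hf : DegreeBounded M f) :
    alternant MvPolynomial.X * finEval V (cutJoin M f) =
      freeOperator V (alternant MvPolynomial.X * finEval V f) -
        freeOperator V (alternant MvPolynomial.X) * finEval V f := by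
  set Δ := alternant (MvPolynomial.X : Fin V → MvPolynomial (Fin V) ℚ) with hΔ
  set F := finEval V f with hF
  have hX : ∀ i, finEval V (MvPolynomial.X i) = powerSum MvPolynomial.X i :=
    fun i => MvPolynomial.aeval_X _ _
  -- by the Leibniz rule; the cross terms are computed from the action on the alternant
  have h1 : freeOperator V (Δ * F) - freeOperator V Δ * F =
      ∑ k, 2 * (eulerAt k Δ * eulerAt k F) + Δ * ∑ k, eulerAt k (eulerAt k F) -
        (2 * (V : MvPolynomial (Fin V) ℚ) - 1) * Δ * ∑ k, eulerAt k F := by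
    rw [freeOperator, freeOperator, Finset.sum_mul, Finset.mul_sum, Finset.mul_sum,
      ← Finset.sum_add_distrib, ← Finset.sum_sub_distrib, ← Finset.sum_sub_distrib]
    refine Finset.sum_congr rfl fun k _ => ?_
    simp only [Derivation.leibniz, map_add, smul_eq_mul]
    ring
  have hpow : ∀ a : ℕ, ∑ k, MvPolynomial.X k ^ (a + 1) =
    powerSum (MvPolynomial.X : Fin V → MvPolynomial (Fin V) ℚ) a.succPNat := fun a => rfl
  have h2 : ∑ k, eulerAt k F = ∑ n ∈ Finset.range M, ((n : MvPolynomial (Fin V) ℚ) + 1) *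
      powerSum MvPolynomial.X n.succPNat * finEval V (MvPolynomial.pderiv n.succPNat f) := by
    simp only [hF, eulerAt_finEval _ hf]
    rw [Finset.sum_comm]
    refine Finset.sum_congr rfl fun n _ => ?_
    rw [← Finset.sum_mul, ← Finset.mul_sum, hpow]
  have h3 : ∑ k, eulerAt k (eulerAt k F) =
      ∑ n ∈ Finset.range M, ((n : MvPolynomial (Fin V) ℚ) + 1) ^ 2 *
        powerSum MvPolynomial.X n.succPNat * finEval V (MvPolynomial.pderiv n.succPNat f) +
      ∑ i ∈ Finset.range M, ∑ j ∈ Finset.range M, ((i : MvPolynomial (Fin V) ℚ) + 1) *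
        ((j : MvPolynomial (Fin V) ℚ) + 1) * powerSum MvPolynomial.X (i + j + 1).succPNat *
          finEval V (MvPolynomial.pderiv i.succPNat (MvPolynomial.pderiv j.succPNat f)) := by
    simp only [hF, eulerAt_eulerAt_finEval _ hf]
    rw [Finset.sum_add_distrib]
    congr 1
    · rw [Finset.sum_comm]
      refine Finset.sum_congr rfl fun n _ => ?_
      rw [← Finset.sum_mul, ← Finset.mul_sum, hpow]
    · rw [Finset.sum_comm]
      refine Finset.sum_congr rfl fun i _ => ?_
      rw [Finset.sum_comm]
      refine Finset.sum_congr rfl fun j _ => ?_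
      rw [← Finset.sum_mul, ← Finset.mul_sum, hpow]
  have h4 : ∑ k, 2 * (eulerAt k Δ * eulerAt k F) = ∑ n ∈ Finset.range M,
      ((n : MvPolynomial (Fin V) ℚ) + 1) * (Δ * (powerSumConv V n +
        (2 * (V : MvPolynomial (Fin V) ℚ) - (n : MvPolynomial (Fin V) ℚ) - 2) *
          powerSum MvPolynomial.X n.succPNat)) *
          finEval V (MvPolynomial.pderiv n.succPNat f) := by
    simp only [hF, eulerAt_finEval _ hf, Finset.mul_sum]
    rw [Finset.sum_comm]
    refine Finset.sum_congr rfl fun n _ => ?_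
    rw [hΔ, ← two_mul_sum_pow_mul_eulerAt_alternant, Finset.mul_sum, Finset.mul_sum, Finset.sum_mul]
    refine Finset.sum_congr rfl fun k _ => ?_
    ring
  have h5 : finEval V (cutJoin M f) = ∑ n ∈ Finset.range M, ((n : MvPolynomial (Fin V) ℚ) + 1) *
      powerSumConv V n * finEval V (MvPolynomial.pderiv n.succPNat f) +
      ∑ i ∈ Finset.range M, ∑ j ∈ Finset.range M, ((i : MvPolynomial (Fin V) ℚ) + 1) *
        ((j : MvPolynomial (Fin V) ℚ) + 1) * powerSum MvPolynomial.X (i + j + 1).succPNat *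
          finEval V (MvPolynomial.pderiv i.succPNat (MvPolynomial.pderiv j.succPNat f)) := by
    simp only [cutJoin, map_add, map_sum, map_mul, map_natCast, map_one, hX, powerSumConv]
  rw [h1, h2, h3, h4, h5]
  simp only [mul_add, ← add_assoc, Finset.mul_sum]
  rw [add_sub_right_comm]
  congr 1
  rw [← Finset.sum_add_distrib, ← Finset.sum_sub_distrib]
  refine Finset.sum_congr rfl fun n _ => ?_
  ring

/-- The monomials are eigenvectors of the free operator, and all terms of the determinant have the
same eigenvalue. -/
theorem freeOperator_det (α : Fin V → ℕ) :
    freeOperator V (Matrix.det (Matrix.of fun i l : Fin V =>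
      (MvPolynomial.X l : MvPolynomial (Fin V) ℚ) ^ α i)) =
      (∑ i, ((α i : ℚ) ^ 2 - (2 * V - 1) * α i)) • Matrix.det (Matrix.of fun i l : Fin V =>
        (MvPolynomial.X l : MvPolynomial (Fin V) ℚ) ^ α i) := by
  have h1 : ∀ (k : Fin V) (g : MvPolynomial (Fin V) ℚ),
      (2 * (V : MvPolynomial (Fin V) ℚ) - 1) * g = (2 * (V : ℚ) - 1) • g := by
    intro k g
    rw [MvPolynomial.smul_eq_C_mul]
    congr 1
    rw [map_sub, map_mul, map_one, map_natCast, map_ofNat]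
  have hmon : ∀ β : Fin V →₀ ℕ, ∀ c : ℚ, freeOperator V (MvPolynomial.monomial β c) =
      (∑ k, ((β k : ℚ) ^ 2 - (2 * V - 1) * β k)) • MvPolynomial.monomial β c := by
    intro β c
    rw [freeOperator, Finset.sum_smul]
    refine Finset.sum_congr rfl fun k _ => ?_
    rw [h1 k, eulerAt_monomial, (eulerAt k).map_smul, eulerAt_monomial, smul_smul, smul_smul, ← sub_smul, sq]
  have hadd : ∀ (ι : Type) (s : Finset ι) (g : ι → MvPolynomial (Fin V) ℚ),
      freeOperator V (∑ i ∈ s, g i) = ∑ i ∈ s, freeOperator V (g i) := by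
    intro ι s g
    simp only [freeOperator, map_sum, Finset.mul_sum, ← Finset.sum_sub_distrib]
    rw [Finset.sum_comm]
  rw [Matrix.det_apply, hadd, Finset.smul_sum]
  refine Finset.sum_congr rfl fun σ _ => ?_
  simp only [Matrix.of_apply]
  rw [prod_X_pow (fun l => α (σ l)), Units.smul_def, MvPolynomial.smul_monomial, hmon]
  congr 1
  simp only [expVec_apply]
  exact Equiv.sum_comp σ (fun i => ((α i : ℚ) ^ 2 - (2 * V - 1) * α i))

/-- The Schur functions are eigenfunctions of the cut-and-join operator. -/
theorem cutJoin_schur {M : ℕ} {μ : YoungDiagram} (h : μ.card ≤ M) :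
    cutJoin M (schur μ) = MvPolynomial.C (kappa μ : ℚ) * schur μ := by
  -- enough variables for `g` to be determined by its values at power sums of `N` variables
  set g := cutJoin M (schur μ) - MvPolynomial.C (kappa μ : ℚ) * schur μ with hg
  set D := g.support.sup expSize
  set N := D + μ.card
  have hμ : len μ ≤ N := (len_le_card μ).trans (Nat.le_add_left _ _)
  have h0 : alternant MvPolynomial.X * finEval N g = 0 := by
    have h1 := alternant_mul_schur (MvPolynomial.X : Fin N → MvPolynomial (Fin N) ℚ) 0 hμ
    simp only [coeff_geom, add_zero] at h1
    have h2 : alternant MvPolynomial.X * finEval N (schur μ) = _ := h1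
    have e1 : finEval N (MvPolynomial.C (kappa μ : ℚ)) = MvPolynomial.C (kappa μ : ℚ) :=
      MvPolynomial.aeval_C _ _
    rw [hg, map_sub, map_mul, e1, mul_sub, alternant_mul_finEval_cutJoin (degreeBounded_schur h),
      mul_left_comm, h2, freeOperator_det, alternant, freeOperator_det, ← alternant, smul_mul_assoc,
      h2, ← MvPolynomial.smul_eq_C_mul, ← sub_smul, ← sub_smul]
    refine smul_eq_zero_of_left ?_ _
    rw [← Finset.sum_sub_distrib]
    have h3 : (kappa μ : ℚ) = ∑ i : Fin N, (μ.rowLen i : ℚ) *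
        ((μ.rowLen i : ℚ) - 2 * ((i : ℚ) + 1) + 1) := by
      rw [Fin.sum_univ_eq_sum_range (fun i => (μ.rowLen i : ℚ) *
        ((μ.rowLen i : ℚ) - 2 * ((i : ℚ) + 1) + 1)), kappa]
      push_cast
      refine Finset.sum_subset (Finset.range_mono hμ) fun i _ hi => ?_
      rw [rowLen_eq_zero (by simpa using hi)]
      simp
    rw [h3, ← Finset.sum_sub_distrib]
    refine Finset.sum_eq_zero fun i _ => ?_
    have e2 : ((N - 1 - (i : ℕ) : ℕ) : ℚ) = N - 1 - i := by
      have := i.isLt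
      rw [Nat.cast_sub (by omega), Nat.cast_sub (by omega)]
      simp
    simp only [shifted]
    push_cast [e2]
    ring
  have h1 : g = 0 := by
    rw [eq_sum_schurCoeff (f := g) (D := D) (N := N)
      (fun m hm => Finset.le_sup (f := expSize) hm) (Nat.le_add_right _ _)]
    refine Finset.sum_eq_zero fun k _ => Finset.sum_eq_zero fun η _ => ?_
    have : schurCoeff N η g = 0 := by
      rw [schurCoeff_apply]
      change MvPolynomial.coeff _ (alternant MvPolynomial.X * finEval N g) = 0
      rw [h0, MvPolynomial.coeff_zero]
    rw [this, MvPolynomial.C_0, zero_mul]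
  exact sub_eq_zero.mp h1

end Eigen

/-! ### Principal specialization -/

theorem qpow_add (a b : ℂ) : qpow (a + b) = qpow a * qpow b := by
  rw [qpow, qpow, qpow, ← map_mul, PowerSeries.exp_mul_exp_eq_exp_add, mul_add]

theorem qpow_zero : qpow 0 = 1 := by
  rw [qpow, mul_zero, PowerSeries.rescale_zero]
  simp [PowerSeries.constantCoeff_exp]

theorem qpow_ne_zero (a : ℂ) : qpow a ≠ 0 := by
  intro h
  have h1 := qpow_add a (-a)
  rw [add_neg_cancel, qpow_zero, h, zero_mul] at h1
  exact one_ne_zero h1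

theorem qpow_neg (a : ℂ) : qpow (-a) = (qpow a)⁻¹ := by
  refine eq_inv_of_mul_eq_one_left ?_
  rw [← qpow_add, neg_add_cancel, qpow_zero]

theorem qpow_nat_mul (n : ℕ) (a : ℂ) : qpow (n * a) = qpow a ^ n := by
  induction n with
  | zero => simp [qpow_zero]
  | succ n ih =>
    rw [pow_succ, ← ih, ← qpow_add]
    congr 1
    push_cast
    ring

theorem prod_qpow {ι : Type*} (s : Finset ι) (f : ι → ℂ) :
    ∏ i ∈ s, qpow (f i) = qpow (∑ i ∈ s, f i) := by
  classical
  induction s using Finset.induction_on with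
  | empty => simp [qpow_zero]
  | insert i s hi ih => rw [Finset.prod_insert hi, Finset.sum_insert hi, qpow_add, ih]

theorem coeff_qpow (a : ℂ) (n : ℕ) :
    (qpow a).coeff n = (Complex.I * a) ^ n * ((n.factorial : ℂ))⁻¹ := by
  rw [qpow, HahnSeries.ofPowerSeries_apply_coeff, PowerSeries.coeff_rescale, PowerSeries.coeff_exp]
  simp

theorem qpow_injective : Function.Injective qpow := by
  intro a b h
  have h1 : (qpow a).coeff ((1 : ℕ) : ℤ) = (qpow b).coeff ((1 : ℕ) : ℤ) := by rw [h]
  rw [coeff_qpow, coeff_qpow, pow_one, pow_one, Nat.factorial_one, Nat.cast_one, inv_one, mul_one,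
    mul_one] at h1
  exact mul_left_cancel₀ Complex.I_ne_zero h1

theorem qpow_sub_one_ne_zero {a : ℂ} (h : a ≠ 0) : qpow a - 1 ≠ 0 := by
  rw [← qpow_zero, sub_ne_zero]
  exact fun e => h (qpow_injective e)

theorem qbr_ne_zero (n : ℕ+) : qbr n ≠ 0 := by
  rw [qbr, sub_ne_zero]
  intro e
  have h := qpow_injective e
  have hn : (n : ℂ) ≠ 0 := Nat.cast_ne_zero.mpr n.ne_zero
  apply hn
  linear_combination h

/-- The values `p_n(q^ρ) = 1 / [n]` of the Newton functions. -/
def tau (n : ℕ+) : LambdaSeries := (qbr n)⁻¹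

theorem pAt_bot : pAt ⊥ = tau := by
  ext1 n
  simp [pAt, tau, len_bot]

theorem evalAt_bot (f : SymmFun) : evalAt ⊥ f = MvPolynomial.aeval tau f := by
  rw [evalAt, pAt_bot]

/-- `q^n / [n] = 1 / [n] + q^{n/2}`. -/
theorem qpow_mul_tau (n : ℕ+) : qpow 1 ^ (n : ℕ) * tau n = tau n + qpow (1 / 2) ^ (n : ℕ) := by
  have h := qbr_ne_zero n
  have h1 : qpow 1 ^ (n : ℕ) = qpow ((n : ℂ) / 2) * qpow ((n : ℂ) / 2) := by
    rw [← qpow_nat_mul, ← qpow_add]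
    congr 1
    ring
  have h2 : qpow (1 / 2) ^ (n : ℕ) = qpow ((n : ℂ) / 2) := by
    rw [← qpow_nat_mul]
    congr 1
    ring
  have h3 : qpow ((n : ℂ) / 2) * qpow (-((n : ℂ) / 2)) = 1 := by
    rw [← qpow_add, add_neg_cancel, qpow_zero]
  rw [tau, h1, h2]
  field_simp
  rw [qbr]
  linear_combination h3

/-- The recursion `(q^{n+1} - 1) h_{n+1}(q^ρ) = q^{n+1/2} h_n(q^ρ)`, from the effect of
`x ↦ q x` on the variables `q^{-1/2}, q^{-3/2}, …`. -/
theorem aeval_tau_hSymm_succ (n : ℕ) :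
    (qpow ((n : ℂ) + 1) - 1) * MvPolynomial.aeval tau (hSymm ((n + 1 : ℕ) : ℤ)) =
      qpow (1 / 2) * qpow n * MvPolynomial.aeval tau (hSymm n) := by
  have h := hSer_scale (qpow 1) tau
  have e : (fun n : ℕ+ => qpow 1 ^ (n : ℕ) * tau n) =
      tau + fun n : ℕ+ => qpow (1 / 2) ^ (n : ℕ) := funext qpow_mul_tau
  rw [e, hSer_add, hSer_geom] at h
  have h1 := congrArg (· * (1 - PowerSeries.C (qpow (1 / 2)) * PowerSeries.X)) h
  beta_reduce at h1
  rw [mul_assoc, mk_pow_mul_one_sub, mul_one, mul_sub, mul_one, mul_comm (PowerSeries.C _),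
    ← mul_assoc] at h1
  have h2 := congrArg (PowerSeries.coeff (n + 1)) h1
  rw [map_sub, PowerSeries.coeff_mul_C, PowerSeries.coeff_succ_mul_X, PowerSeries.coeff_rescale,
    PowerSeries.coeff_rescale, ← qpow_nat_mul, ← qpow_nat_mul, coeff_hSer, coeff_hSer, mul_one,
    mul_one] at h2
  push_cast at h2 ⊢
  linear_combination -h2

/-- The point with Newton functions `(-1)^{n-1} / [n]`, where `h_n` takes the value
`e_n(q^ρ)`. -/
def tauDual (n : ℕ+) : LambdaSeries := -((-1) ^ (n : ℕ) * tau n)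

/-- The recursion `(q^{n+1} - 1) e_{n+1}(q^ρ) = q^{1/2} e_n(q^ρ)`. -/
theorem aeval_tauDual_hSymm_succ (n : ℕ) :
    (qpow ((n : ℂ) + 1) - 1) * MvPolynomial.aeval tauDual (hSymm ((n + 1 : ℕ) : ℤ)) =
      qpow (1 / 2) * MvPolynomial.aeval tauDual (hSymm n) := by
  have h := hSer_scale (qpow 1) tauDual
  have h0 : hSer (fun n : ℕ+ => qpow 1 ^ (n : ℕ) * tauDual n) *
      (PowerSeries.mk fun n => (-qpow (1 / 2)) ^ n) = hSer tauDual := by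
    rw [← hSer_geom, ← hSer_add]
    congr 1
    ext1 n
    rw [Pi.add_apply, tauDual, neg_pow (qpow (1 / 2))]
    linear_combination (-(-1) ^ (n : ℕ)) * qpow_mul_tau n
  rw [h] at h0
  have h1 := congrArg (· * (1 - PowerSeries.C (-qpow (1 / 2)) * PowerSeries.X)) h0
  beta_reduce at h1
  rw [mul_assoc, mk_pow_mul_one_sub, mul_one, mul_sub, mul_one, mul_comm (PowerSeries.C _),
    ← mul_assoc] at h1
  have h2 := congrArg (PowerSeries.coeff (n + 1)) h1
  rw [map_sub, PowerSeries.coeff_mul_C, PowerSeries.coeff_succ_mul_X, PowerSeries.coeff_rescale,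
    ← qpow_nat_mul, coeff_hSer, coeff_hSer, mul_one] at h2
  push_cast at h2 ⊢
  linear_combination h2

theorem qpow_mul_aeval_tauDual (m : ℤ) :
    qpow m * MvPolynomial.aeval tauDual (hSymm m) = MvPolynomial.aeval tauDual (hSymm m) +
      qpow (1 / 2) * MvPolynomial.aeval tauDual (hSymm (m - 1)) := by
  rcases lt_trichotomy m 0 with h | rfl | h
  · rw [hSymm_of_neg h, hSymm_of_neg (by omega)]
    simp
  · rw [hSymm_of_neg (by norm_num : (0 : ℤ) - 1 < 0)]
    simp [qpow_zero]
  · obtain ⟨n, rfl⟩ : ∃ n : ℕ, m = ((n + 1 : ℕ) : ℤ) := ⟨(m - 1).toNat, by omega⟩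
    have h1 := aeval_tauDual_hSymm_succ n
    have e : ((n + 1 : ℕ) : ℤ) - 1 = n := by omega
    rw [e]
    push_cast at h1 ⊢
    linear_combination h1

/-- `h_m(q^ρ) = q^{m(m-1)/2} e_m(q^ρ)`. -/
theorem aeval_tau_hSymm (m : ℤ) : MvPolynomial.aeval tau (hSymm m) =
    qpow ((m : ℂ) * (m - 1) / 2) * MvPolynomial.aeval tauDual (hSymm m) := by
  rcases lt_or_ge m 0 with h | h
  · rw [hSymm_of_neg h, map_zero, map_zero, mul_zero]
  · obtain ⟨n, rfl⟩ := Int.eq_ofNat_of_zero_le h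
    clear h
    induction n with
    | zero => simp [hSymm_zero, qpow_zero]
    | succ n ih =>
      have h1 := aeval_tau_hSymm_succ n
      have h2 := aeval_tauDual_hSymm_succ n
      have h3 : qpow ((n : ℂ) + 1) - 1 ≠ 0 := qpow_sub_one_ne_zero (Nat.cast_add_one_ne_zero n)
      refine mul_left_cancel₀ h3 ?_
      have h4 : qpow ((((n + 1 : ℕ) : ℤ) : ℂ) * ((((n + 1 : ℕ) : ℤ) : ℂ) - 1) / 2) =
          qpow n * qpow (((n : ℤ) : ℂ) * (((n : ℤ) : ℂ) - 1) / 2) := by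
        rw [← qpow_add]
        congr 1
        push_cast
        ring
      rw [h1, h4, ih]
      linear_combination (-(qpow n * qpow (((n : ℤ) : ℂ) * (((n : ℤ) : ℂ) - 1) / 2))) * h2

/-- Multiplying the column `e_{m+j}` by `q^{ms}` with `s ≤ j` adds multiples of earlier columns. -/
theorem exists_column_combination {N : ℕ} (s j : ℕ) (hs : s ≤ j) (hj : j < N) :
    ∃ c : ℕ → LambdaSeries, c j = qpow (-((s : ℂ) * j)) ∧ (∀ r, j < r → c r = 0) ∧
      ∀ m : ℤ, qpow ((m : ℂ) * s) * MvPolynomial.aeval tauDual (hSymm (m + j)) =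
        ∑ r : Fin N, MvPolynomial.aeval tauDual (hSymm (m + (r : ℕ))) * c r := by
  induction s generalizing j with
  | zero =>
    refine ⟨fun r => if r = j then 1 else 0, by simp [qpow_zero], fun r hr => if_neg (by omega),
      fun m => ?_⟩
    rw [Finset.sum_eq_single ⟨j, hj⟩]
    · simp [qpow_zero]
    · intro r _ hr
      have hr' : (r : ℕ) ≠ j := fun e => hr (Fin.ext e)
      simp [hr']
    · simp
  | succ s ih =>
    obtain ⟨c, hc1, hc2, hc3⟩ := ih j (by omega) hj
    obtain ⟨c', -, hc2', hc3'⟩ := ih (j - 1) (by omega) (by omega)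
    refine ⟨fun r => qpow (-(j : ℂ)) * (c r + qpow (1 / 2) * c' r), ?_, fun r hr => ?_, fun m => ?_⟩
    · simp only
      rw [hc1, hc2' j (by omega), mul_zero, add_zero, ← qpow_add]
      congr 1
      push_cast
      ring
    · simp only
      rw [hc2 r hr, hc2' r (by omega), mul_zero, add_zero, mul_zero]
    · have h1 := qpow_mul_aeval_tauDual (m + j)
      have e1 : m + (j : ℤ) - 1 = m + ((j - 1 : ℕ) : ℤ) := by omega
      have e2 : qpow ((m : ℂ) * ((s + 1 : ℕ) : ℂ)) =
          qpow ((m : ℂ) * s) * qpow (-(j : ℂ)) * qpow ((m + j : ℤ) : ℂ) := by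
        rw [← qpow_add, ← qpow_add]
        congr 1
        push_cast
        ring
      rw [e2, mul_assoc, h1, e1]
      have h2 : ∑ r : Fin N, MvPolynomial.aeval tauDual (hSymm (m + (r : ℕ))) *
          (qpow (-(j : ℂ)) * (c r + qpow (1 / 2) * c' r)) =
          qpow (-(j : ℂ)) * ∑ r : Fin N, MvPolynomial.aeval tauDual (hSymm (m + (r : ℕ))) * c r +
          qpow (-(j : ℂ)) * qpow (1 / 2) *
            ∑ r : Fin N, MvPolynomial.aeval tauDual (hSymm (m + (r : ℕ))) * c' r := by
        rw [Finset.mul_sum, Finset.mul_sum, ← Finset.sum_add_distrib]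
        exact Finset.sum_congr rfl fun r _ => by ring
      rw [h2, ← hc3, ← hc3']
      ring

/-- `s_ν(q^ρ) = q^{κ_ν/2} s_{νᵗ}(q^ρ)`, where the Schur function of the transposed partition is
expressed through the elementary symmetric functions. -/
theorem aeval_tau_schur (ν : YoungDiagram) : MvPolynomial.aeval tau (schur ν) =
    qpow ((kappa ν : ℂ) / 2) * MvPolynomial.aeval tauDual (schur ν) := by
  set N := len ν
  set m : Fin N → ℤ := fun i => (ν.rowLen i : ℤ) - (i : ℤ) with hm
  -- the factor `q^{(m_i + j)(m_i + j - 1)/2}` of the entries is a row factor times a column factor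
  -- times `q^{m_i j}`, and the latter amounts to a triangular change of columns
  choose c hc1 hc2 hc3 using fun j : Fin N => exists_column_combination (N := N) j j le_rfl j.isLt
  have h1 : (Matrix.of fun i j : Fin N => qpow ((m i : ℂ) * (j : ℕ)) *
      MvPolynomial.aeval tauDual (hSymm (m i + (j : ℕ)))) =
      (Matrix.of fun i r : Fin N => MvPolynomial.aeval tauDual (hSymm (m i + (r : ℕ)))) *
        Matrix.of fun r j : Fin N => c j r := by
    ext1 i j
    rw [Matrix.mul_apply, Matrix.of_apply, hc3]
    rfl
  have h2 : Matrix.det (Matrix.of fun r j : Fin N => c j r) =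
      qpow (∑ j : Fin N, -(((j : ℕ) : ℂ) * (j : ℕ))) := by
    rw [Matrix.det_of_isUpperTriangular, ← prod_qpow]
    · exact Finset.prod_congr rfl fun j _ => hc1 j
    · intro r j hrj
      exact hc2 j r hrj
  have h3 : (Matrix.of fun i j : Fin N => MvPolynomial.aeval tau (hSymm (m i + (j : ℕ)))) =
      Matrix.of fun i j : Fin N => qpow ((m i : ℂ) * (m i - 1) / 2) *
        (Matrix.of fun i j : Fin N => qpow (((j : ℕ) : ℂ) * ((j : ℕ) - 1) / 2) *
          (Matrix.of fun i j : Fin N => qpow ((m i : ℂ) * (j : ℕ)) *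
            MvPolynomial.aeval tauDual (hSymm (m i + (j : ℕ)))) i j) i j := by
    ext1 i j
    simp only [Matrix.of_apply]
    rw [aeval_tau_hSymm, ← mul_assoc, ← mul_assoc, ← qpow_add, ← qpow_add]
    congr 2
    push_cast
    ring
  rw [schur_eq_det ν le_rfl, AlgHom.map_det, AlgHom.map_det]
  change Matrix.det (Matrix.of fun i j : Fin N => MvPolynomial.aeval tau (hSymm (m i + (j : ℕ)))) =
    _ * Matrix.det (Matrix.of fun i j : Fin N =>
      MvPolynomial.aeval tauDual (hSymm (m i + (j : ℕ))))
  rw [h3, Matrix.det_mul_column, Matrix.det_mul_row, h1, Matrix.det_mul, h2, prod_qpow, prod_qpow]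
  have h4 : qpow ((kappa ν : ℂ) / 2) = qpow (∑ i : Fin N, (m i : ℂ) * (m i - 1) / 2) *
      (qpow (∑ j : Fin N, ((j : ℕ) : ℂ) * ((j : ℕ) - 1) / 2) *
        qpow (∑ j : Fin N, -(((j : ℕ) : ℂ) * (j : ℕ)))) := by
    rw [← qpow_add, ← qpow_add, ← Finset.sum_add_distrib, ← Finset.sum_add_distrib, kappa]
    congr 1
    push_cast
    rw [← Fin.sum_univ_eq_sum_range (fun i => (ν.rowLen i : ℂ) *
      ((ν.rowLen i : ℂ) - 2 * ((i : ℂ) + 1) + 1)), Finset.sum_div]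
    refine Finset.sum_congr rfl fun i _ => ?_
    simp only [hm]
    push_cast
    ring
  rw [h4]
  ring

/-! ### The gluing of two vertices -/

theorem map_aeval_rat {A B : Type*} [CommRing A] [CommRing B] [Algebra ℚ A] [Algebra ℚ B]
    (φ : A →+* B) (u : ℕ+ → A) (f : SymmFun) :
    φ (MvPolynomial.aeval u f) = MvPolynomial.aeval (fun n => φ (u n)) f :=
  MvPolynomial.comp_aeval_apply u (RingHom.toRatAlgHom φ) f

theorem vertex_bot_bot (ν : YoungDiagram) : vertex ν ⊥ ⊥ = MvPolynomial.aeval tau (schur ν) := by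
  rw [vertex, transpose_bot, schur_bot, kappa_bot, evalAt_bot, map_one]
  simp only [evalAt_bot]
  rw [Finset.sum_eq_single_of_mem 0 (by simp)]
  · rw [partitionsOf_zero, Finset.sum_singleton, ← schur, ← schur, schur_bot]
    simp [qpow_zero]
  · intro k _ hk
    refine Finset.sum_eq_zero fun η hη => ?_
    rw [skewSchur_eq_zero (μ := ⊥) (by rw [card_bot, mem_partitionsOf.mp hη]; omega), map_zero,
      mul_zero]

theorem vertex_bot_transpose (μ ν : YoungDiagram) : vertex μ ⊥ ν.transpose =
    qpow (-((kappa ν : ℂ) / 2)) * ∑ k ∈ Finset.range (μ.card + 1), ∑ η ∈ partitionsOf k,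
      MvPolynomial.aeval tau (skewSchur μ η) * MvPolynomial.aeval tau (skewSchur ν η) := by
  rw [vertex, transpose_bot, schur_bot, kappa_bot, evalAt_bot, map_one, kappa_transpose,
    YoungDiagram.transpose_transpose]
  simp only [evalAt_bot]
  rw [mul_one]
  congr 2
  push_cast
  ring

/-- The sum over the intermediate partition by the skew Cauchy identity; the framing factor of the
first vertex is absorbed by `aeval_tau_schur`. -/
theorem coeff_glued (μ : YoungDiagram) (k : ℕ) : PowerSeries.coeff k (glued μ) =
    ∑ j ∈ Finset.range (μ.card + 1), ∑ η ∈ partitionsOf j,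
      MvPolynomial.aeval tau (skewSchur μ η) *
        (MvPolynomial.aeval (-tau * tau) (hSymm ((k : ℤ) - η.card)) *
          MvPolynomial.aeval (-tau) (schur η)) := by
  rw [glued, PowerSeries.coeff_mk]
  have h1 : ∀ ν ∈ partitionsOf k, vertex μ ⊥ ν.transpose * (-1) ^ k * vertex ν ⊥ ⊥ =
      ∑ j ∈ Finset.range (μ.card + 1), ∑ η ∈ partitionsOf j,
        MvPolynomial.aeval tau (skewSchur μ η) * (MvPolynomial.aeval (-tau) (schur ν) *
          MvPolynomial.aeval tau (skewSchur ν η)) := by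
    intro ν hν
    have e1 : (-1) ^ k * MvPolynomial.aeval tauDual (schur ν) =
        MvPolynomial.aeval (-tau) (schur ν) := by
      rw [← mem_partitionsOf.mp hν, ← aeval_scale_schur]
      congr 2
      ext1 n
      have e0 : (-1 : LambdaSeries) ^ (n : ℕ) * (-1) ^ (n : ℕ) = 1 := by
        rw [← mul_pow, show (-1 : LambdaSeries) * -1 = 1 by ring, one_pow]
      rw [tauDual, Pi.neg_apply]
      linear_combination (-tau n) * e0
    have e2 : qpow (-((kappa ν : ℂ) / 2)) * qpow ((kappa ν : ℂ) / 2) = 1 := by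
      rw [← qpow_add, neg_add_cancel, qpow_zero]
    rw [vertex_bot_bot, vertex_bot_transpose, aeval_tau_schur, ← e1]
    have e3 : ∑ j ∈ Finset.range (μ.card + 1), ∑ η ∈ partitionsOf j,
        MvPolynomial.aeval tau (skewSchur μ η) *
          ((-1) ^ k * MvPolynomial.aeval tauDual (schur ν) *
            MvPolynomial.aeval tau (skewSchur ν η)) =
        (∑ j ∈ Finset.range (μ.card + 1), ∑ η ∈ partitionsOf j,
          MvPolynomial.aeval tau (skewSchur μ η) * MvPolynomial.aeval tau (skewSchur ν η)) *
          ((-1) ^ k * MvPolynomial.aeval tauDual (schur ν)) := by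
      rw [Finset.sum_mul]
      refine Finset.sum_congr rfl fun j _ => ?_
      rw [Finset.sum_mul]
      exact Finset.sum_congr rfl fun η _ => by ring
    rw [e3]
    linear_combination (∑ j ∈ Finset.range (μ.card + 1), ∑ η ∈ partitionsOf j,
      MvPolynomial.aeval tau (skewSchur μ η) * MvPolynomial.aeval tau (skewSchur ν η)) *
        (-1) ^ k * MvPolynomial.aeval tauDual (schur ν) * e2
  rw [Finset.sum_congr rfl h1, Finset.sum_comm]
  refine Finset.sum_congr rfl fun j _ => ?_
  rw [Finset.sum_comm]
  refine Finset.sum_congr rfl fun η _ => ?_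
  rw [← Finset.mul_sum, sum_schur_mul_skewSchur]

theorem coeff_glued_bot (k : ℕ) : PowerSeries.coeff k (glued ⊥) =
    MvPolynomial.aeval (-tau * tau) (hSymm k) := by
  have e : skewSchur ⊥ ⊥ = 1 := schur_bot
  rw [coeff_glued, card_bot, zero_add, Finset.sum_range_one, partitionsOf_zero,
    Finset.sum_singleton, e, schur_bot, card_bot, map_one, map_one]
  simp

/-- The values `(1 - e^{-nt}) / [n]` of the Newton functions that describe the resolved conifold. -/
def spec (n : ℕ+) : Coef := PowerSeries.C (tau n) * (1 - PowerSeries.X ^ (n : ℕ))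

theorem aeval_spec_schur (μ : YoungDiagram) : MvPolynomial.aeval spec (schur μ) =
    ∑ j ∈ Finset.range (μ.card + 1), ∑ η ∈ partitionsOf j,
      PowerSeries.C (MvPolynomial.aeval tau (skewSchur μ η) * MvPolynomial.aeval (-tau) (schur η)) *
        PowerSeries.X ^ j := by
  have e : spec = (fun n : ℕ+ => (PowerSeries.X : Coef) ^ (n : ℕ) * PowerSeries.C ((-tau) n)) +
      fun n => PowerSeries.C (tau n) := by
    ext1 n
    rw [spec, Pi.add_apply, Pi.neg_apply, map_neg]
    ring
  rw [e, aeval_add_schur]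
  refine Finset.sum_congr rfl fun j _ => Finset.sum_congr rfl fun η hη => ?_
  rw [aeval_scale_schur, mem_partitionsOf.mp hη, ← map_aeval_rat, ← map_aeval_rat, map_mul]
  ring

/-- Gluing gives, up to the closed string factor, the Schur functions at the point `spec`. -/
theorem glued_eq (μ : YoungDiagram) :
    glued μ = glued ⊥ * MvPolynomial.aeval spec (schur μ) := by
  ext1 k
  rw [aeval_spec_schur, Finset.mul_sum, map_sum, coeff_glued]
  refine Finset.sum_congr rfl fun j _ => ?_
  rw [Finset.mul_sum, map_sum]
  refine Finset.sum_congr rfl fun η hη => ?_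
  rw [← mul_assoc (glued ⊥), PowerSeries.coeff_mul_X_pow', PowerSeries.coeff_mul_C, coeff_glued_bot,
    mem_partitionsOf.mp hη]
  split_ifs with h
  · have : (k : ℤ) - j = ((k - j : ℕ) : ℤ) := by omega
    rw [this]
    ring
  · rw [hSymm_of_neg (by omega)]
    simp

theorem constantCoeff_glued_bot : PowerSeries.constantCoeff (glued ⊥) = 1 := by
  rw [← PowerSeries.coeff_zero_eq_constantCoeff_apply, coeff_glued_bot, Nat.cast_zero, hSymm_zero,
    map_one]

theorem coeff_normAmplitude (a : ℂ) (m : ℕ+ →₀ ℕ) :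
    MvPowerSeries.coeff m (normAmplitude a) = ∑ μ ∈ partitionsOf (expSize m),
      PowerSeries.C (qpow (a * (kappa μ : ℂ) / 2)) * MvPolynomial.aeval spec (schur μ) *
        PowerSeries.C (HahnSeries.C
          (((MvPolynomial.coeff m (schur μ) : ℚ) : ℂ) / Complex.I ^ expLen m)) := by
  have h1 : ∀ m, MvPowerSeries.coeff m (amplitude a) = glued ⊥ *
      ∑ μ ∈ partitionsOf (expSize m),
      PowerSeries.C (qpow (a * (kappa μ : ℂ) / 2)) * MvPolynomial.aeval spec (schur μ) *
        PowerSeries.C (HahnSeries.C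
          (((MvPolynomial.coeff m (schur μ) : ℚ) : ℂ) / Complex.I ^ expLen m)) := by
    intro m
    change amplitude a m = _
    rw [amplitude, Finset.mul_sum]
    refine Finset.sum_congr rfl fun μ _ => ?_
    have e : ((symmChar μ m : ℚ) : ℂ) / ((expZ m : ℂ) * Complex.I ^ expLen m) =
        ((MvPolynomial.coeff m (schur μ) : ℚ) : ℂ) / Complex.I ^ expLen m := by
      have hz : (expZ m : ℂ) ≠ 0 := Nat.cast_ne_zero.mpr (expZ_pos m).ne'
      rw [symmChar]
      push_cast
      rw [mul_div_mul_left _ _ hz]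
    rw [e, glued_eq μ]
    ring
  have h2 : MvPowerSeries.constantCoeff (amplitude a) = glued ⊥ := by
    rw [← MvPowerSeries.coeff_zero_eq_constantCoeff_apply, h1]
    have e0 : expSize 0 = 0 := by simp [expSize]
    have e1 : expLen 0 = 0 := by simp [expLen]
    rw [e0, e1, partitionsOf_zero, Finset.sum_singleton, kappa_bot, schur_bot]
    simp [qpow_zero]
  rw [normAmplitude, MvPowerSeries.coeff_C_mul, h2, h1, ← mul_assoc, PowerSeries.inv_mul_cancel,
    one_mul]
  rw [constantCoeff_glued_bot]
  exact one_ne_zero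

/-! ### Logarithmic derivatives -/

theorem isUnit_of_constantCoeff_eq_one {S : Type*} [CommRing S] {B : MvPowerSeries ℕ+ S}
    (hB : MvPowerSeries.constantCoeff B = 1) : IsUnit B := by
  rw [MvPowerSeries.isUnit_iff_constantCoeff, hB]
  exact isUnit_one

section Logarithm

variable {σ S : Type*} [CommRing S] [Algebra ℚ S]

theorem coeff_log_subst {G : MvPowerSeries σ S} (hG : MvPowerSeries.constantCoeff G = 0) {N : ℕ}
    {m : σ →₀ ℕ} (hm : m.degree ≤ N) :
    MvPowerSeries.coeff m ((PowerSeries.log S).subst G) = MvPowerSeries.coeff m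
      (∑ n ∈ Finset.range (N + 1), PowerSeries.coeff n (PowerSeries.log ℚ) • G ^ n) := by
  rw [PowerSeries.coeff_subst (PowerSeries.HasSubst.of_constantCoeff_zero hG), map_sum,
    finsum_eq_sum_of_support_subset]
  · refine Finset.sum_congr rfl fun n _ => ?_
    rw [← PowerSeries.map_log (algebraMap ℚ S), PowerSeries.coeff_map, algebraMap_smul]
    rfl
  · intro n hn
    rw [Finset.mem_coe, Finset.mem_range]
    by_contra h
    apply hn
    have h1 : MvPowerSeries.coeff m (G ^ n) = 0 := by
      refine MvPowerSeries.coeff_of_lt_order (lt_of_lt_of_le (Nat.cast_lt.mpr ?_)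
        (MvPowerSeries.le_order_pow_of_constantCoeff_eq_zero n hG))
      omega
    simp only [h1, smul_zero]

theorem constantCoeff_log_subst {G : MvPowerSeries σ S} (hG : MvPowerSeries.constantCoeff G = 0) :
    MvPowerSeries.constantCoeff ((PowerSeries.log S).subst G) = 0 :=
  PowerSeries.constantCoeff_subst_eq_zero hG _ PowerSeries.constantCoeff_log

/-- The rule `B d(log B) = dB` for a derivation `d` that is continuous, in the sense that the
coefficients of `dH` of degree at most `n` depend only on those of `H` of degree at most `n + 1`.
On truncations of the logarithm it is a finite geometric sum. -/
theorem mul_derivation_log (d : Derivation ℚ (MvPowerSeries σ S) (MvPowerSeries σ S))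
    (hd : ∀ (H : MvPowerSeries σ S) (m : σ →₀ ℕ),
      (∀ m' : σ →₀ ℕ, m'.degree ≤ m.degree + 1 → MvPowerSeries.coeff m' H = 0) →
        MvPowerSeries.coeff m (d H) = 0)
    {B : MvPowerSeries σ S} (hB : MvPowerSeries.constantCoeff B = 1) :
    B * d ((PowerSeries.log S).subst (B - 1)) = d B := by
  classical
  set G := B - 1 with hGdef
  have hG : MvPowerSeries.constantCoeff G = 0 := by rw [hGdef, map_sub, hB, map_one, sub_self]
  have hdB : d B = d G := by rw [hGdef, map_sub, d.map_one_eq_zero, sub_zero]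
  ext m
  set N := m.degree + 1
  -- the truncation of `log (1 + G)` that determines the coefficients of degree at most `N`
  set T := ∑ n ∈ Finset.range (N + 1), PowerSeries.coeff n (PowerSeries.log ℚ) • G ^ n with hT
  have h1 : ∀ m' : σ →₀ ℕ, m'.degree ≤ m.degree →
      MvPowerSeries.coeff m' (d ((PowerSeries.log S).subst G)) = MvPowerSeries.coeff m' (d T) := by
    intro m' hm'
    rw [← sub_eq_zero, ← map_sub, ← map_sub]
    refine hd _ _ fun m'' hm'' => ?_
    rw [map_sub, sub_eq_zero]
    exact coeff_log_subst hG (by omega)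
  have h2 : d T = (∑ n ∈ Finset.range N, (-G) ^ n) * d G := by
    rw [hT, map_sum, Finset.sum_range_succ', Finset.sum_mul]
    simp only [PowerSeries.coeff_log, pow_zero]
    rw [d.map_smul, d.map_one_eq_zero, smul_zero, add_zero]
    refine Finset.sum_congr rfl fun n _ => ?_
    rw [d.map_smul, Derivation.leibniz_pow, Nat.add_sub_cancel, if_neg (Nat.succ_ne_zero n),
      ← Nat.cast_smul_eq_nsmul ℚ, smul_smul, smul_eq_mul, neg_pow G n]
    have : ((algebraMap ℚ ℚ) ((-1) ^ (n + 1 + 1) / ((n + 1 : ℕ) : ℚ)) * ((n + 1 : ℕ) : ℚ)) =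
        (-1) ^ n := by
      have : ((n + 1 : ℕ) : ℚ) ≠ 0 := Nat.cast_ne_zero.mpr (Nat.succ_ne_zero n)
      rw [Algebra.algebraMap_self, RingHom.id_apply, div_mul_cancel₀ _ this, pow_add, pow_add]
      ring
    rw [this, Algebra.smul_def, map_pow, map_neg, map_one]
    ring
  have h3 : B * d T = d G - (-G) ^ N * d G := by
    have h := mul_neg_geom_sum (-G) N
    have hB' : B = 1 - -G := by rw [hGdef]; ring
    rw [h2, ← mul_assoc, hB', h]
    ring
  have h4 : MvPowerSeries.coeff m ((-G) ^ N * d G) = 0 := by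
    refine MvPowerSeries.coeff_of_lt_order (lt_of_lt_of_le (Nat.cast_lt.mpr (Nat.lt_succ_self _))
      (le_trans ?_ MvPowerSeries.le_order_mul))
    exact le_trans (MvPowerSeries.le_order_pow_of_constantCoeff_eq_zero N (by rw [map_neg, hG,
      neg_zero])) le_self_add
  have h5 : MvPowerSeries.coeff m (B * d ((PowerSeries.log S).subst G)) =
      MvPowerSeries.coeff m (B * d T) := by
    rw [MvPowerSeries.coeff_mul, MvPowerSeries.coeff_mul]
    refine Finset.sum_congr rfl fun p hp => ?_
    rw [h1]
    rw [← Finset.HasAntidiagonal.mem_antidiagonal.mp hp, map_add]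
    omega
  rw [h5, h3, map_sub, h4, sub_zero, hdB]

/-- The derivation that multiplies the monomials of size `s` by `s`. -/
def sizeDerivation (S : Type*) [CommRing S] [Algebra ℚ S] :
    Derivation ℚ (MvPowerSeries ℕ+ S) (MvPowerSeries ℕ+ S) :=
  Derivation.mk'
    { toFun := fun f m => (expSize m : S) * MvPowerSeries.coeff m f
      map_add' := fun f g => by
        ext m
        exact mul_add _ _ _
      map_smul' := fun c f => by
        ext m
        exact mul_smul_comm c _ _ }
    (by
      intro f g
      ext m
      classical
      change (expSize m : S) * MvPowerSeries.coeff m (f * g) = MvPowerSeries.coeff m (f * _ + g * _)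
      rw [map_add, mul_comm g, MvPowerSeries.coeff_mul, MvPowerSeries.coeff_mul,
        MvPowerSeries.coeff_mul, Finset.mul_sum, ← Finset.sum_add_distrib]
      refine Finset.sum_congr rfl fun p hp => ?_
      rw [← Finset.HasAntidiagonal.mem_antidiagonal.mp hp, expSize_add, Nat.cast_add]
      change _ = _ * ((expSize p.2 : S) * _) + ((expSize p.1 : S) * _) * _
      ring)

theorem coeff_sizeDerivation (f : MvPowerSeries ℕ+ S) (m : ℕ+ →₀ ℕ) :
    MvPowerSeries.coeff m (sizeDerivation S f) = (expSize m : S) * MvPowerSeries.coeff m f := rfl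

theorem mul_sizeDerivation_log {B : MvPowerSeries ℕ+ S}
    (hB : MvPowerSeries.constantCoeff B = 1) :
    B * sizeDerivation S ((PowerSeries.log S).subst (B - 1)) = sizeDerivation S B :=
  mul_derivation_log _ (fun H m h => by
    rw [coeff_sizeDerivation, h m (Nat.le_succ _), mul_zero]) hB

theorem mul_pderiv_log {B : MvPowerSeries ℕ+ S} (hB : MvPowerSeries.constantCoeff B = 1) (n : ℕ+) :
    B * MvPowerSeries.pderiv S n ((PowerSeries.log S).subst (B - 1)) =
      MvPowerSeries.pderiv S n B :=
  mul_derivation_log ((MvPowerSeries.pderiv S n).restrictScalars ℚ) (fun H m h => by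
    change MvPowerSeries.coeff m (MvPowerSeries.pderiv S n H) = 0
    rw [MvPowerSeries.coeff_pderiv, h _ (by rw [map_add, Finsupp.degree_single]),
      zero_mul]) hB

/-- The logarithm is characterized by its logarithmic derivative along `sizeDerivation`. -/
theorem eq_log_of_mul_sizeDerivation {B F : MvPowerSeries ℕ+ S}
    (hB : MvPowerSeries.constantCoeff B = 1) (hF : MvPowerSeries.constantCoeff F = 0)
    (h : B * sizeDerivation S F = sizeDerivation S B) :
    F = (PowerSeries.log S).subst (B - 1) := by
  have hG : MvPowerSeries.constantCoeff (B - 1) = 0 := by rw [map_sub, hB, map_one, sub_self]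
  have h1 : sizeDerivation S F = sizeDerivation S ((PowerSeries.log S).subst (B - 1)) :=
    (isUnit_of_constantCoeff_eq_one hB).mul_left_cancel (h.trans (mul_sizeDerivation_log hB).symm)
  ext m
  rcases Nat.eq_zero_or_pos (expSize m) with h0 | h0
  · rw [expSize_eq_zero] at h0
    rw [h0, MvPowerSeries.coeff_zero_eq_constantCoeff_apply, hF,
      MvPowerSeries.coeff_zero_eq_constantCoeff_apply, constantCoeff_log_subst hG]
  · have h2 := congrArg (MvPowerSeries.coeff m) h1
    rw [coeff_sizeDerivation, coeff_sizeDerivation] at h2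
    have hu : IsUnit ((expSize m : ℕ) : S) := by
      have : IsUnit (algebraMap ℚ S (expSize m : ℚ)) :=
        (isUnit_iff_ne_zero.mpr (Nat.cast_ne_zero.mpr h0.ne')).map _
      simpa using this
    exact hu.mul_left_cancel h2

end Logarithm

/-! ### The cut-and-join flow -/

section Flow

variable {S : Type*} [CommRing S]

theorem coeff_X_mul_mem {W : AddSubgroup S} {n : ℕ+} {f : MvPowerSeries ℕ+ S} {m : ℕ+ →₀ ℕ}
    (h : ∀ m', Finsupp.single n 1 + m' = m → MvPowerSeries.coeff m' f ∈ W) :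
    MvPowerSeries.coeff m (MvPowerSeries.X n * f) ∈ W := by
  classical
  rw [MvPowerSeries.coeff_mul]
  refine sum_mem fun p hp => ?_
  rw [MvPowerSeries.coeff_X]
  split_ifs with h1
  · rw [one_mul]
    exact h _ (h1 ▸ mem_antidiagonal.mp hp)
  · rw [zero_mul]
    exact W.zero_mem

theorem coeff_pderiv_mem {W : AddSubgroup S} {n : ℕ+} {f : MvPowerSeries ℕ+ S} {m : ℕ+ →₀ ℕ}
    (h : MvPowerSeries.coeff (m + Finsupp.single n 1) f ∈ W) :
    MvPowerSeries.coeff m (MvPowerSeries.pderiv S n f) ∈ W := by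
  rw [MvPowerSeries.coeff_pderiv, ← Nat.cast_add_one, mul_comm, ← nsmul_eq_mul]
  exact nsmul_mem h _

theorem coeff_natCast_add_one_mul_mem {W : AddSubgroup S} {k : ℕ} {f : MvPowerSeries ℕ+ S}
    {m : ℕ+ →₀ ℕ} (h : MvPowerSeries.coeff m f ∈ W) :
    MvPowerSeries.coeff m (((k : MvPowerSeries ℕ+ S) + 1) * f) ∈ W := by
  rw [← Nat.cast_add_one, ← nsmul_eq_mul, map_nsmul]
  exact nsmul_mem h _

variable (S) in
/-- The operator `cutJoin` on power series in the Newton functions. -/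
def cutJoinSeries (M : ℕ) : MvPowerSeries ℕ+ S →ₗ[S] MvPowerSeries ℕ+ S :=
  ∑ n ∈ Finset.range M, LinearMap.mulLeft S (((n : MvPowerSeries ℕ+ S) + 1) *
      ∑ a ∈ Finset.range n, MvPowerSeries.X a.succPNat * MvPowerSeries.X (n - 1 - a).succPNat) ∘ₗ
        (MvPowerSeries.pderiv S n.succPNat : MvPowerSeries ℕ+ S →ₗ[S] MvPowerSeries ℕ+ S) +
    ∑ i ∈ Finset.range M, ∑ j ∈ Finset.range M,
      LinearMap.mulLeft S (((i : MvPowerSeries ℕ+ S) + 1) * ((j : MvPowerSeries ℕ+ S) + 1) *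
        MvPowerSeries.X (i + j + 1).succPNat) ∘ₗ
        (MvPowerSeries.pderiv S i.succPNat : MvPowerSeries ℕ+ S →ₗ[S] MvPowerSeries ℕ+ S) ∘ₗ
        (MvPowerSeries.pderiv S j.succPNat : MvPowerSeries ℕ+ S →ₗ[S] MvPowerSeries ℕ+ S)

theorem cutJoinSeries_apply (M : ℕ) (f : MvPowerSeries ℕ+ S) : cutJoinSeries S M f =
    ∑ n ∈ Finset.range M, ((n : MvPowerSeries ℕ+ S) + 1) * (∑ a ∈ Finset.range n,
        MvPowerSeries.X a.succPNat * MvPowerSeries.X (n - 1 - a).succPNat) *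
          MvPowerSeries.pderiv S n.succPNat f +
      ∑ i ∈ Finset.range M, ∑ j ∈ Finset.range M, ((i : MvPowerSeries ℕ+ S) + 1) *
        ((j : MvPowerSeries ℕ+ S) + 1) * MvPowerSeries.X (i + j + 1).succPNat *
          MvPowerSeries.pderiv S i.succPNat (MvPowerSeries.pderiv S j.succPNat f) := by
  rw [cutJoinSeries, LinearMap.add_apply, LinearMap.sum_apply, LinearMap.sum_apply]
  congr 1
  refine Finset.sum_congr rfl fun i _ => ?_
  rw [LinearMap.sum_apply]
  rfl

theorem cutJoinSeries_coe [Algebra ℚ S] (M : ℕ) (f : SymmFun) :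
    cutJoinSeries S M ((MvPolynomial.map (algebraMap ℚ S) f : MvPolynomial ℕ+ S)) =
      (MvPolynomial.map (algebraMap ℚ S) (cutJoin M f) : MvPolynomial ℕ+ S) := by
  rw [cutJoinSeries_apply, cutJoin]
  simp only [MvPowerSeries.pderiv_coe, MvPolynomial.pderiv_map]
  simp only [← MvPolynomial.coeToMvPowerSeries.ringHom_apply, map_add, map_sum, map_mul, map_natCast,
    map_one, MvPolynomial.map_X]
  simp

/-- The operator preserves the size and changes the length by one. -/
theorem coeff_cutJoinSeries_mem {W : AddSubgroup S} {M : ℕ} {f : MvPowerSeries ℕ+ S}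
    {m : ℕ+ →₀ ℕ} (h : ∀ m', expSize m' = expSize m →
      (expLen m' = expLen m + 1 ∨ expLen m' + 1 = expLen m) → MvPowerSeries.coeff m' f ∈ W) :
    MvPowerSeries.coeff m (cutJoinSeries S M f) ∈ W := by
  rw [cutJoinSeries_apply, map_add, map_sum, map_sum]
  refine W.add_mem (sum_mem fun n _ => ?_) (sum_mem fun i _ => ?_)
  · rw [mul_assoc]
    refine coeff_natCast_add_one_mul_mem ?_
    rw [Finset.sum_mul, map_sum]
    refine sum_mem fun a ha => ?_
    rw [mul_assoc]
    refine coeff_X_mul_mem fun m₁ h1 => coeff_X_mul_mem fun m₂ h2 => coeff_pderiv_mem (h _ ?_ ?_)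
    · rw [← h1, ← h2]
      simp only [expSize_add, expSize_single, Nat.succPNat_coe]
      have := Finset.mem_range.mp ha
      omega
    · rw [← h1, ← h2]
      simp only [expLen_add, expLen_single]
      omega
  · rw [map_sum]
    refine sum_mem fun j _ => ?_
    rw [mul_assoc, mul_assoc]
    refine coeff_natCast_add_one_mul_mem (coeff_natCast_add_one_mul_mem ?_)
    refine coeff_X_mul_mem fun m₁ h1 => coeff_pderiv_mem (coeff_pderiv_mem (h _ ?_ ?_))
    · rw [← h1]
      simp only [expSize_add, expSize_single, Nat.succPNat_coe]
      omega
    · rw [← h1]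
      simp only [expLen_add, expLen_single]
      omega

/-- The quadratic term `∑_{i,j} i j p_{i+j} ∂_i f ∂_j f` of the cut-and-join equation of a
logarithm, truncated to `i, j ≤ M`. -/
def joinSquare (M : ℕ) (f : MvPowerSeries ℕ+ S) : MvPowerSeries ℕ+ S :=
  ∑ i ∈ Finset.range M, ∑ j ∈ Finset.range M, ((i : MvPowerSeries ℕ+ S) + 1) *
    ((j : MvPowerSeries ℕ+ S) + 1) * MvPowerSeries.X (i + j + 1).succPNat *
      (MvPowerSeries.pderiv S i.succPNat f * MvPowerSeries.pderiv S j.succPNat f)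

theorem coeff_joinSquare_mem {W : AddSubgroup S} {M : ℕ} {f : MvPowerSeries ℕ+ S}
    {m : ℕ+ →₀ ℕ} (h : ∀ m₁ m₂, expSize m₁ + expSize m₂ = expSize m → 0 < expSize m₁ →
      0 < expSize m₂ → expLen m₁ + expLen m₂ = expLen m + 1 →
        MvPowerSeries.coeff m₁ f * MvPowerSeries.coeff m₂ f ∈ W) :
    MvPowerSeries.coeff m (joinSquare M f) ∈ W := by
  classical
  rw [joinSquare, map_sum]
  refine sum_mem fun i _ => ?_
  rw [map_sum]
  refine sum_mem fun j _ => ?_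
  rw [mul_assoc, mul_assoc]
  refine coeff_natCast_add_one_mul_mem (coeff_natCast_add_one_mul_mem
    (coeff_X_mul_mem fun m₁ h1 => ?_))
  rw [MvPowerSeries.coeff_mul]
  refine sum_mem fun p hp => ?_
  have hp' := mem_antidiagonal.mp hp
  rw [MvPowerSeries.coeff_pderiv, MvPowerSeries.coeff_pderiv, ← Nat.cast_add_one,
    ← Nat.cast_add_one, mul_mul_mul_comm, ← Nat.cast_mul, mul_comm, ← nsmul_eq_mul]
  refine nsmul_mem (h _ _ ?_ ?_ ?_ ?_) _
  · rw [← h1, ← hp']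
    simp only [expSize_add, expSize_single, Nat.succPNat_coe]
    omega
  · simp [expSize_add, expSize_single]
  · simp [expSize_add, expSize_single]
  · rw [← h1, ← hp']
    simp only [expLen_add, expLen_single]
    omega

theorem coeff_eq_zero_of_mul {B H : MvPowerSeries ℕ+ S} (hB : MvPowerSeries.constantCoeff B = 1)
    {M : ℕ} (h : ∀ m, expSize m ≤ M → MvPowerSeries.coeff m (B * H) = 0) {m : ℕ+ →₀ ℕ}
    (hm : expSize m ≤ M) : MvPowerSeries.coeff m H = 0 := by
  classical
  obtain ⟨u, hu⟩ := isUnit_of_constantCoeff_eq_one hB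
  have e : H = ↑u⁻¹ * (B * H) := by rw [← hu, Units.inv_mul_cancel_left]
  rw [e, MvPowerSeries.coeff_mul]
  refine Finset.sum_eq_zero fun p hp => ?_
  rw [h, mul_zero]
  rw [← mem_antidiagonal.mp hp, expSize_add] at hm
  omega

variable [Algebra ℚ S]

/-- The power series `∑_μ w_μ s_μ`. -/
def schurSeries (w : YoungDiagram → S) : MvPowerSeries ℕ+ S := fun m =>
  ∑ μ ∈ partitionsOf (expSize m), w μ * algebraMap ℚ S (MvPolynomial.coeff m (schur μ))

theorem coeff_schurSeries (w : YoungDiagram → S) (m : ℕ+ →₀ ℕ) :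
    MvPowerSeries.coeff m (schurSeries w) = ∑ μ ∈ partitionsOf (expSize m),
      w μ * algebraMap ℚ S (MvPolynomial.coeff m (schur μ)) := rfl

theorem constantCoeff_schurSeries (w : YoungDiagram → S) :
    MvPowerSeries.constantCoeff (schurSeries w) = w ⊥ := by
  rw [← MvPowerSeries.coeff_zero_eq_constantCoeff_apply, coeff_schurSeries,
    expSize_eq_zero.mpr rfl, partitionsOf_zero, Finset.sum_singleton, schur_bot]
  simp

/-- Schur functions are eigenfunctions of the cut-and-join operator. -/
theorem coeff_cutJoinSeries_schurSeries (w : YoungDiagram → S) {M : ℕ} {m : ℕ+ →₀ ℕ}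
    (hm : expSize m ≤ M) : MvPowerSeries.coeff m (cutJoinSeries S M (schurSeries w)) =
      MvPowerSeries.coeff m (schurSeries fun μ => (kappa μ : S) * w μ) := by
  set P : MvPowerSeries ℕ+ S := ∑ μ ∈ partitionsOf (expSize m),
    w μ • ((MvPolynomial.map (algebraMap ℚ S) (schur μ) : MvPolynomial ℕ+ S) :
      MvPowerSeries ℕ+ S) with hP
  have h1 : MvPowerSeries.coeff m (cutJoinSeries S M (schurSeries w - P)) ∈ (⊥ : AddSubgroup S) := by
    refine coeff_cutJoinSeries_mem fun m' h' _ => ?_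
    rw [AddSubgroup.mem_bot, map_sub, coeff_schurSeries, h', hP, map_sum, sub_eq_zero]
    refine Finset.sum_congr rfl fun μ _ => ?_
    rw [map_smul, MvPolynomial.coeff_coe, MvPolynomial.coeff_map, smul_eq_mul]
  rw [AddSubgroup.mem_bot, map_sub, map_sub, sub_eq_zero] at h1
  rw [h1, hP, map_sum, map_sum, coeff_schurSeries]
  refine Finset.sum_congr rfl fun μ hμ => ?_
  rw [map_smul, map_smul, cutJoinSeries_coe, cutJoin_schur (by rw [mem_partitionsOf.mp hμ]; exact hm),
    MvPolynomial.coeff_coe, MvPolynomial.coeff_map, MvPolynomial.coeff_C_mul, smul_eq_mul, map_mul,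
    map_intCast]
  ring

/-- The derivation of a ring of power series obtained by applying a derivation of the ring of
coefficients to each coefficient. -/
def coeffDerivation {σ : Type*} (δ : Derivation ℚ S S) :
    Derivation ℚ (MvPowerSeries σ S) (MvPowerSeries σ S) :=
  Derivation.mk'
    { toFun := fun f m => δ (MvPowerSeries.coeff m f)
      map_add' := fun f g => by
        ext m
        exact map_add δ _ _
      map_smul' := fun c f => by
        ext m
        exact δ.map_smul c _ }
    (by
      intro f g
      ext m
      classical
      change δ (MvPowerSeries.coeff m (f * g)) = MvPowerSeries.coeff m (f * _ + g * _)
      rw [map_add, mul_comm g, MvPowerSeries.coeff_mul, MvPowerSeries.coeff_mul,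
        MvPowerSeries.coeff_mul, map_sum, ← Finset.sum_add_distrib]
      refine Finset.sum_congr rfl fun p hp => ?_
      rw [δ.leibniz, smul_eq_mul, smul_eq_mul, mul_comm (MvPowerSeries.coeff p.2 g)]
      rfl)

theorem coeff_coeffDerivation {σ : Type*} (δ : Derivation ℚ S S) (f : MvPowerSeries σ S)
    (m : σ →₀ ℕ) : MvPowerSeries.coeff m (coeffDerivation δ f) = δ (MvPowerSeries.coeff m f) := rfl

/-- The cut-and-join equation for a logarithm. -/
theorem cutJoin_log {B : MvPowerSeries ℕ+ S} (hB : MvPowerSeries.constantCoeff B = 1)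
    (δ : Derivation ℚ S S) (c : S) {M : ℕ} (h : ∀ m, expSize m ≤ M →
      δ (MvPowerSeries.coeff m B) = c * MvPowerSeries.coeff m (cutJoinSeries S M B))
    {m : ℕ+ →₀ ℕ} (hm : expSize m ≤ M) :
    δ (MvPowerSeries.coeff m ((PowerSeries.log S).subst (B - 1))) =
      c * (MvPowerSeries.coeff m (cutJoinSeries S M ((PowerSeries.log S).subst (B - 1))) +
        MvPowerSeries.coeff m (joinSquare M ((PowerSeries.log S).subst (B - 1)))) := by
  have hp := mul_pderiv_log hB
  have hδ : B * coeffDerivation δ ((PowerSeries.log S).subst (B - 1)) = coeffDerivation δ B :=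
    mul_derivation_log _ (fun H m h => by
      rw [coeff_coeffDerivation, h m (Nat.le_succ _), map_zero]) hB
  generalize (PowerSeries.log S).subst (B - 1) = F at *
  have hD : cutJoinSeries S M B = B * (cutJoinSeries S M F + joinSquare M F) := by
    rw [cutJoinSeries_apply, cutJoinSeries_apply, joinSquare, add_assoc, mul_add,
      mul_add, Finset.mul_sum, Finset.mul_sum, Finset.mul_sum]
    refine congrArg₂ _ (Finset.sum_congr rfl fun n _ => ?_)
      ((Finset.sum_congr rfl fun i _ => ?_).trans Finset.sum_add_distrib)
    · rw [← hp]
      ring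
    · rw [Finset.mul_sum, Finset.mul_sum, ← Finset.sum_add_distrib]
      refine Finset.sum_congr rfl fun j _ => ?_
      rw [← hp j.succPNat, Derivation.leibniz, ← hp i.succPNat, smul_eq_mul, smul_eq_mul]
      ring
  have h1 : ∀ m, expSize m ≤ M → MvPowerSeries.coeff m
      (B * (coeffDerivation δ F - c • (cutJoinSeries S M F + joinSquare M F))) = 0 := by
    intro m hm
    rw [mul_sub, hδ, mul_smul_comm, ← hD, map_sub, map_smul, coeff_coeffDerivation, h m hm,
      smul_eq_mul, sub_self]
  have h2 := coeff_eq_zero_of_mul hB h1 hm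
  rwa [map_sub, map_smul, coeff_coeffDerivation, sub_eq_zero, map_add, smul_eq_mul] at h2

end Flow

/-- The `ℚ`-linear derivations of a commutative `ℚ`-algebra to itself. -/
abbrev SelfDerivation (S : Type*) [CommRing S] [Algebra ℚ S] : Type _ := Derivation ℚ S S

/-- Additive maps that satisfy the Leibniz rule are derivations over `ℚ`. -/
def derivationOfLeibniz {S : Type*} [CommRing S] [Algebra ℚ S] (f : S →+ S)
    (h : ∀ x y, f (x * y) = x * f y + y * f x) : SelfDerivation S :=
  Derivation.mk' f.toRatLinearMap h

theorem SelfDerivation.map_mul {S : Type*} [CommRing S] [Algebra ℚ S] (δ : SelfDerivation S)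
    (x y : S) : δ (x * y) = x * δ y + y * δ x := by
  rw [Derivation.leibniz, smul_eq_mul, smul_eq_mul]

/-! ### Laurent series with coefficients depending on the framing -/

section Laurent

variable {R R' : Type*} [CommRing R] [CommRing R']

/-- The map of Laurent series induced by a homomorphism of the rings of coefficients. -/
def laurentMap (f : R →+* R') : LaurentSeries R →+* LaurentSeries R' where
  toFun x := x.map f
  map_one' := by
    ext j
    change f ((1 : LaurentSeries R).coeff j) = (1 : LaurentSeries R').coeff j
    rw [HahnSeries.coeff_one, HahnSeries.coeff_one]
    split_ifs <;> simp
  map_mul' x y := HahnSeries.map_mul (f : R →ₙ+* R')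
  map_zero' := by
    ext j
    exact map_zero f
  map_add' x y := by
    ext j
    exact map_add f _ _

theorem coeff_laurentMap (f : R →+* R') (x : LaurentSeries R) (j : ℤ) :
    (laurentMap f x).coeff j = f (x.coeff j) := rfl

theorem laurentMap_ofPowerSeries (f : R →+* R') (p : PowerSeries R) :
    laurentMap f (HahnSeries.ofPowerSeries ℤ R p) =
      HahnSeries.ofPowerSeries ℤ R' (PowerSeries.map f p) := by
  ext j
  rw [coeff_laurentMap, PowerSeries.coeff_coe, PowerSeries.coeff_coe]
  split_ifs
  · exact map_zero f
  · rw [PowerSeries.coeff_map]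

variable [Algebra ℚ R]

/-- The derivation of Laurent series obtained by applying a derivation of the ring of coefficients
to each coefficient. -/
def laurentDerivation (d : Derivation ℚ R R) :
    SelfDerivation (LaurentSeries R) :=
  derivationOfLeibniz
    { toFun := fun x => x.map d
      map_zero' := by
        ext j
        exact map_zero d
      map_add' := fun x y => by
        ext j
        exact map_add d _ _ }
    (by
      intro x y
      ext j
      change d ((x * y).coeff j) = (x * y.map d + y * x.map d).coeff j
      have hx : (x.map d).support ⊆ x.support := Function.support_comp_subset (map_zero d) _
      have hy : (y.map d).support ⊆ y.support := Function.support_comp_subset (map_zero d) _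
      rw [HahnSeries.coeff_add, mul_comm y, HahnSeries.coeff_mul_right' y.isPWO_support hy,
        HahnSeries.coeff_mul_left' x.isPWO_support hx, HahnSeries.coeff_mul, map_sum,
        ← Finset.sum_add_distrib]
      refine Finset.sum_congr rfl fun p _ => ?_
      rw [d.leibniz, smul_eq_mul, smul_eq_mul, mul_comm (y.coeff p.2)]
      rfl)

theorem coeff_laurentDerivation (d : Derivation ℚ R R) (x : LaurentSeries R) (j : ℤ) :
    (laurentDerivation d x).coeff j = d (x.coeff j) := rfl

end Laurent

/-- Power series in `e^{-t}` over the Laurent series in `λ` whose coefficients are polynomials in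
the framing. -/
abbrev FramedCoef : Type := PowerSeries (LaurentSeries (Polynomial ℂ))

/-- Specialization of the framing. -/
def evalFraming (a : ℂ) : FramedCoef →+* Coef :=
  PowerSeries.map (laurentMap (Polynomial.evalRingHom a))

theorem coeff_evalFraming (a : ℂ) (f : FramedCoef) (k : ℕ) (j : ℤ) :
    (PowerSeries.coeff k (evalFraming a f)).coeff j =
      ((PowerSeries.coeff k f).coeff j).eval a := by
  rw [evalFraming, PowerSeries.coeff_map, coeff_laurentMap]
  rfl

/-- The inclusion of the series that do not depend on the framing. -/
def constFraming : Coef →+* FramedCoef := PowerSeries.map (laurentMap Polynomial.C)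

theorem coeff_constFraming (f : Coef) (k : ℕ) (j : ℤ) :
    (PowerSeries.coeff k (constFraming f)).coeff j =
      Polynomial.C ((PowerSeries.coeff k f).coeff j) := by
  rw [constFraming, PowerSeries.coeff_map, coeff_laurentMap]

theorem evalFraming_constFraming (a : ℂ) (f : Coef) : evalFraming a (constFraming f) = f := by
  ext k j
  rw [coeff_evalFraming, coeff_constFraming, Polynomial.eval_C]

/-- Differentiation with respect to the framing. -/
def framingDerivation : SelfDerivation FramedCoef :=
  coeffDerivation (laurentDerivation ((Polynomial.derivative' (R := ℂ)).restrictScalars ℚ))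

theorem coeff_framingDerivation (f : FramedCoef) (k : ℕ) (j : ℤ) :
    (PowerSeries.coeff k (framingDerivation f)).coeff j =
      Polynomial.derivative ((PowerSeries.coeff k f).coeff j) := rfl

theorem framingDerivation_constFraming (f : Coef) : framingDerivation (constFraming f) = 0 := by
  ext k j : 3
  rw [coeff_framingDerivation, coeff_constFraming, Polynomial.derivative_C]
  simp

theorem eq_zero_of_derivative_eq_zero {p : Polynomial ℂ} (h : Polynomial.derivative p = 0)
    (h0 : p.eval 0 = 0) : p = 0 := by
  rw [Polynomial.eq_C_of_derivative_eq_zero h] at h0 ⊢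
  rw [Polynomial.eval_C] at h0
  rw [h0, map_zero]

/-- The factor `q^{a κ / 2}`, where the framing `a` is a variable. -/
def framingFactor (κ : ℤ) : FramedCoef :=
  PowerSeries.C (HahnSeries.ofPowerSeries ℤ (Polynomial ℂ) (PowerSeries.mk fun r =>
    Polynomial.C ((Complex.I * κ / 2) ^ r * ((r.factorial : ℂ))⁻¹) * Polynomial.X ^ r))

/-- The constant `√-1 λ / 2`. -/
def halfLambda : FramedCoef := PowerSeries.C (HahnSeries.single 1 (Polynomial.C (Complex.I / 2)))

theorem evalFraming_framingFactor (a : ℂ) (κ : ℤ) :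
    evalFraming a (framingFactor κ) = PowerSeries.C (qpow (a * κ / 2)) := by
  rw [evalFraming, framingFactor, PowerSeries.map_C, laurentMap_ofPowerSeries, qpow]
  congr 2
  ext r
  rw [PowerSeries.coeff_map, PowerSeries.coeff_mk, PowerSeries.coeff_rescale,
    PowerSeries.coeff_exp]
  simp only [Polynomial.coe_evalRingHom, Polynomial.eval_mul, Polynomial.eval_C,
    Polynomial.eval_pow, Polynomial.eval_X]
  rw [mul_right_comm, ← mul_pow]
  congr 1
  · congr 1
    ring
  · simp

theorem framingDerivation_framingFactor (κ : ℤ) :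
    framingDerivation (framingFactor κ) = halfLambda * ((κ : FramedCoef) * framingFactor κ) := by
  have e : (κ : FramedCoef) = PowerSeries.C (HahnSeries.C (κ : Polynomial ℂ)) := by simp
  rw [e, framingFactor, halfLambda, ← map_mul, ← map_mul]
  ext1 k
  rw [PowerSeries.coeff_C]
  change laurentDerivation _ (PowerSeries.coeff k _) = _
  rw [PowerSeries.coeff_C]
  split_ifs
  swap
  · exact map_zero _
  ext j : 2
  rw [coeff_laurentDerivation, HahnSeries.coeff_single_mul, HahnSeries.C_mul_eq_smul,
    HahnSeries.coeff_smul, PowerSeries.coeff_coe, PowerSeries.coeff_coe]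
  rcases lt_trichotomy j 0 with h | rfl | h
  · rw [if_pos h, if_pos (by omega)]
    simp
  · rw [if_neg (lt_irrefl _), if_pos (by omega)]
    simp
  · obtain ⟨r, rfl⟩ : ∃ r : ℕ, j = ((r + 1 : ℕ) : ℤ) := ⟨(j - 1).toNat, by omega⟩
    have e1 : ((r + 1 : ℕ) : ℤ) - 1 = r := by omega
    rw [e1, if_neg (by omega), if_neg (by omega), Int.natAbs_natCast, Int.natAbs_natCast,
      PowerSeries.coeff_mk, PowerSeries.coeff_mk]
    change Polynomial.derivative _ = _
    rw [Polynomial.derivative_C_mul_X_pow, Nat.add_sub_cancel, smul_eq_mul, ← Polynomial.C_eq_intCast,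
      ← mul_assoc, ← mul_assoc, ← map_mul, ← map_mul]
    congr 2
    have hr : ((r : ℂ) + 1) ≠ 0 := Nat.cast_add_one_ne_zero r
    rw [Nat.factorial_succ, pow_succ]
    push_cast
    field_simp

/-! ### The genus filtration -/

section Genus

variable {R : Type*} [CommRing R]

/-- The series whose coefficients of `λ^j` with `j < n` or `j ≢ n mod 2` vanish. -/
def genusSubgroup (R : Type*) [CommRing R] (n : ℤ) :
    AddSubgroup (PowerSeries (LaurentSeries R)) where
  carrier := {f | ∀ k j, ¬(n ≤ j ∧ Even (j - n)) → (PowerSeries.coeff k f).coeff j = 0}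
  zero_mem' := fun k j _ => by rw [map_zero]; rfl
  add_mem' := fun {f g} hf hg k j h => by
    rw [map_add, HahnSeries.coeff_add, hf k j h, hg k j h, add_zero]
  neg_mem' := fun {f} hf k j h => by
    rw [map_neg, HahnSeries.coeff_neg, hf k j h, neg_zero]

theorem mul_mem_genusSubgroup {n n' : ℤ} {f g : PowerSeries (LaurentSeries R)}
    (hf : f ∈ genusSubgroup R n) (hg : g ∈ genusSubgroup R n') :
    f * g ∈ genusSubgroup R (n + n') := by
  intro k j hj
  rw [PowerSeries.coeff_mul, HahnSeries.coeff_sum]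
  refine Finset.sum_eq_zero fun p _ => ?_
  rw [HahnSeries.coeff_mul]
  refine Finset.sum_eq_zero fun r hr => ?_
  by_cases h1 : n ≤ r.1 ∧ Even (r.1 - n)
  · by_cases h2 : n' ≤ r.2 ∧ Even (r.2 - n')
    · exfalso
      have hr' : r.1 + r.2 = j := (Finset.mem_antidiagonal.mp hr).2.2
      apply hj
      refine ⟨by omega, ?_⟩
      have : j - (n + n') = (r.1 - n) + (r.2 - n') := by omega
      rw [this]
      exact h1.2.add h2.2
    · rw [hg _ _ h2, mul_zero]
  · rw [hf _ _ h1, zero_mul]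

/-- The series whose coefficients of `e^{-kt} λ^j` satisfy the conditions of `genusSubgroup` for
a given `k` and for all `j < N`. -/
def truncGenusSubgroup (R : Type*) [CommRing R] (k : ℕ) (n N : ℤ) :
    AddSubgroup (PowerSeries (LaurentSeries R)) where
  carrier := {f | ∀ j < N, ¬(n ≤ j ∧ Even (j - n)) → (PowerSeries.coeff k f).coeff j = 0}
  zero_mem' := fun j _ _ => by rw [map_zero]; rfl
  add_mem' := fun {f g} hf hg j hN h => by
    rw [map_add, HahnSeries.coeff_add, hf j hN h, hg j hN h, add_zero]
  neg_mem' := fun {f} hf j hN h => by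
    rw [map_neg, HahnSeries.coeff_neg, hf j hN h, neg_zero]

theorem truncGenusSubgroup_mono {k : ℕ} {n n' N : ℤ} (h : n ≤ n') (h' : Even (n' - n))
    {f : PowerSeries (LaurentSeries R)} (hf : f ∈ truncGenusSubgroup R k n' N) :
    f ∈ truncGenusSubgroup R k n N := by
  intro j hN hj
  refine hf j hN fun hj' => hj ⟨h.trans hj'.1, ?_⟩
  rw [← sub_add_sub_cancel j n' n]
  exact hj'.2.add h'

theorem mem_truncGenusSubgroup_of_mem {k : ℕ} {n N : ℤ} {f : PowerSeries (LaurentSeries R)}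
    (hf : f ∈ genusSubgroup R n) : f ∈ truncGenusSubgroup R k n N :=
  fun j _ hj => hf k j hj

theorem C_single_mul_mem_truncGenusSubgroup {k : ℕ} {n N : ℤ} {f : PowerSeries (LaurentSeries R)}
    (r : R) (hf : f ∈ truncGenusSubgroup R k n N) :
    PowerSeries.C (HahnSeries.single 1 r) * f ∈ truncGenusSubgroup R k (n + 1) (N + 1) := by
  intro j hN hj
  rw [PowerSeries.coeff_C_mul, HahnSeries.coeff_single_mul, hf (j - 1) (by omega), mul_zero]
  intro h
  refine hj ⟨by omega, ?_⟩
  rw [add_comm n 1, ← sub_sub]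
  exact h.2

end Genus

/-! ### Generating series of Schur functions -/

section SchurSeries

variable {S S' : Type*} [CommRing S] [Algebra ℚ S] [CommRing S'] [Algebra ℚ S']

theorem derivation_coeff_schurSeries (δ : SelfDerivation S) (w : YoungDiagram → S)
    (m : ℕ+ →₀ ℕ) : δ (MvPowerSeries.coeff m (schurSeries w)) =
      MvPowerSeries.coeff m (schurSeries fun μ => δ (w μ)) := by
  rw [coeff_schurSeries, coeff_schurSeries, map_sum]
  refine Finset.sum_congr rfl fun μ _ => ?_
  rw [mul_comm, ← Algebra.smul_def, δ.map_smul, Algebra.smul_def, mul_comm]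

theorem coeff_schurSeries_mul (c : S) (w : YoungDiagram → S) (m : ℕ+ →₀ ℕ) :
    MvPowerSeries.coeff m (schurSeries fun μ => c * w μ) =
      c * MvPowerSeries.coeff m (schurSeries w) := by
  rw [coeff_schurSeries, coeff_schurSeries, Finset.mul_sum]
  exact Finset.sum_congr rfl fun μ _ => mul_assoc _ _ _

theorem map_schurSeries (φ : S →+* S') (w : YoungDiagram → S) :
    MvPowerSeries.map φ (schurSeries w) = schurSeries fun μ => φ (w μ) := by
  ext m
  rw [MvPowerSeries.coeff_map, coeff_schurSeries, coeff_schurSeries, map_sum]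
  refine Finset.sum_congr rfl fun μ _ => ?_
  rw [map_mul]
  congr 1
  exact DFunLike.congr_fun (RingHom.ext_rat (φ.comp (algebraMap ℚ S)) (algebraMap ℚ S')) _

/-- The Cauchy identity `∑_μ s_μ[u] s_μ = exp (∑_n u_n p_n / n)`. -/
theorem coeff_schurSeries_aeval (u : ℕ+ → S) (m : ℕ+ →₀ ℕ) :
    MvPowerSeries.coeff m (schurSeries fun μ => MvPolynomial.aeval u (schur μ)) =
      algebraMap ℚ S ((expZ m : ℚ))⁻¹ * m.prod fun n c => u n ^ c := by
  classical
  rw [coeff_schurSeries]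
  have h1 : ∀ μ ∈ partitionsOf (expSize m), MvPolynomial.aeval u (schur μ) *
      algebraMap ℚ S (MvPolynomial.coeff m (schur μ)) = ∑ m' ∈ expsOf (expSize m),
        algebraMap ℚ S (MvPolynomial.coeff m' (schur μ) * MvPolynomial.coeff m (schur μ)) *
          m'.prod fun n c => u n ^ c := by
    intro μ hμ
    rw [aeval_schur, mem_partitionsOf.mp hμ, Finset.sum_mul]
    refine Finset.sum_congr rfl fun m' _ => ?_
    rw [map_mul]
    ring
  rw [Finset.sum_congr rfl h1, Finset.sum_comm]
  have hm : m ∈ expsOf (expSize m) := mem_expsOf.mpr rfl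
  rw [Finset.sum_eq_single_of_mem m hm]
  · rw [← Finset.sum_mul, ← map_sum, sum_coeff_schur_mul hm hm, if_pos rfl]
  · intro m' hm' hne
    rw [← Finset.sum_mul, ← map_sum, sum_coeff_schur_mul hm' hm, if_neg hne, map_zero, zero_mul]

theorem pderiv_schurSeries_aeval (u : ℕ+ → S) (n : ℕ+) :
    MvPowerSeries.pderiv S n (schurSeries fun μ => MvPolynomial.aeval u (schur μ)) =
      (schurSeries fun μ => MvPolynomial.aeval u (schur μ)) *
        MvPowerSeries.C (algebraMap ℚ S ((n : ℚ))⁻¹ * u n) := by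
  classical
  ext m
  rw [MvPowerSeries.coeff_pderiv, MvPowerSeries.coeff_mul_C, coeff_schurSeries_aeval,
    coeff_schurSeries_aeval, Finsupp.prod_add_index' (by simp) (by intros; exact pow_add _ _ _),
    Finsupp.prod_single_index (h := fun n c => u n ^ c) (pow_zero _), pow_one, expZ_add_single]
  have e : algebraMap ℚ S (((n : ℕ) * (m n + 1) * expZ m : ℕ) : ℚ)⁻¹ * ((m n : S) + 1) =
      algebraMap ℚ S (expZ m : ℚ)⁻¹ * algebraMap ℚ S ((n : ℚ))⁻¹ := by
    have e1 : ((m n : S) + 1) = algebraMap ℚ S ((m n : ℚ) + 1) := by simp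
    have hz : (expZ m : ℚ) ≠ 0 := Nat.cast_ne_zero.mpr (expZ_pos m).ne'
    have hn : ((n : ℕ) : ℚ) ≠ 0 := Nat.cast_ne_zero.mpr n.ne_zero
    have hm : (m n : ℚ) + 1 ≠ 0 := Nat.cast_add_one_ne_zero _
    rw [e1, ← map_mul, ← map_mul]
    congr 1
    push_cast
    field_simp
  linear_combination (u n * m.prod fun n c => u n ^ c) * e

/-- The logarithm of `∑_μ s_μ[u] s_μ` is `∑_n u_n p_n / n`. -/
theorem coeff_log_schurSeries_aeval (u : ℕ+ → S) (m : ℕ+ →₀ ℕ) (n : ℕ+) :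
    MvPowerSeries.coeff (m + Finsupp.single n 1) ((PowerSeries.log S).subst
      ((schurSeries fun μ => MvPolynomial.aeval u (schur μ)) - 1)) =
        if m = 0 then algebraMap ℚ S ((n : ℚ))⁻¹ * u n else 0 := by
  classical
  have hB : MvPowerSeries.constantCoeff (schurSeries fun μ => MvPolynomial.aeval u (schur μ)) =
      1 := by
    rw [constantCoeff_schurSeries, schur_bot, map_one]
  have h := mul_pderiv_log hB n
  rw [pderiv_schurSeries_aeval] at h
  have h1 := congrArg (MvPowerSeries.coeff m) ((isUnit_of_constantCoeff_eq_one hB).mul_left_cancel h)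
  rw [MvPowerSeries.coeff_pderiv, MvPowerSeries.coeff_C] at h1
  split_ifs at h1 ⊢ with h0
  · rw [h0] at h1 ⊢
    simpa using h1
  · have hu : IsUnit ((m n : S) + 1) := by
      have : IsUnit (algebraMap ℚ S ((m n : ℚ) + 1)) :=
        (isUnit_iff_ne_zero.mpr (Nat.cast_add_one_ne_zero _)).map _
      simpa using this
    exact hu.mul_left_eq_zero.mp h1

end SchurSeries

/-! ### The genus expansion -/

theorem smul_mem_genusSubgroup (c : ℚ) {n : ℤ} {f : Coef} (hf : f ∈ genusSubgroup ℂ n) :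
    algebraMap ℚ Coef c * f ∈ genusSubgroup ℂ n := by
  have h : algebraMap ℚ Coef c = PowerSeries.C (HahnSeries.C (c : ℂ)) := by
    exact DFunLike.congr_fun (RingHom.ext_rat (algebraMap ℚ Coef)
      ((PowerSeries.C.comp HahnSeries.C).comp (algebraMap ℚ ℂ))) c
  intro k j hj
  rw [h, PowerSeries.coeff_C_mul, HahnSeries.C_mul_eq_smul, HahnSeries.coeff_smul, hf k j hj,
    smul_zero]

/-- `1 / [n]` is an odd Laurent series in `λ` with at most a simple pole. -/
theorem coeff_tau_eq_zero (n : ℕ+) {j : ℤ} (h : ¬(-1 ≤ j ∧ Even (j - -1))) :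
    (tau n).coeff j = 0 := by
  set c : ℂ := Complex.I * ((n : ℂ) / 2) with hc
  have hc0 : c ≠ 0 := mul_ne_zero Complex.I_ne_zero
    (div_ne_zero (Nat.cast_ne_zero.mpr n.ne_zero) two_ne_zero)
  set g : PowerSeries ℂ := PowerSeries.rescale c (PowerSeries.exp ℂ) -
    PowerSeries.rescale (-c) (PowerSeries.exp ℂ) with hg
  have hqbr : qbr n = HahnSeries.ofPowerSeries ℤ ℂ g := by
    rw [qbr, qpow, qpow, hg, map_sub, mul_neg]
  have hg0 : PowerSeries.constantCoeff g = 0 := by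
    rw [hg, ← PowerSeries.coeff_zero_eq_constantCoeff_apply, map_sub, PowerSeries.coeff_rescale,
      PowerSeries.coeff_rescale, pow_zero, pow_zero, sub_self]
  -- `[n] = λ v` with `v` even and invertible
  obtain ⟨v, hv⟩ := PowerSeries.X_dvd_iff.mpr hg0
  have hv0 : PowerSeries.constantCoeff v ≠ 0 := by
    have h1 := congrArg (PowerSeries.coeff 1) hv
    rw [mul_comm, ← zero_add 1, PowerSeries.coeff_succ_mul_X,
      PowerSeries.coeff_zero_eq_constantCoeff_apply, hg, map_sub, PowerSeries.coeff_rescale,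
      PowerSeries.coeff_rescale, PowerSeries.coeff_exp] at h1
    rw [← h1]
    simp only [zero_add, pow_one, Nat.factorial_one, Nat.cast_one, div_one, map_one, mul_one,
      sub_neg_eq_add]
    intro e
    apply hc0
    linear_combination e / 2
  have hveven : PowerSeries.rescale (-1 : ℂ) v = v := by
    have h1 : PowerSeries.rescale (-1 : ℂ) g = -g := by
      rw [hg, map_sub, PowerSeries.rescale_rescale, PowerSeries.rescale_rescale, mul_neg_one,
        mul_neg_one, neg_neg, neg_sub]
    rw [hv, map_mul, PowerSeries.rescale_neg_one_X, neg_mul, neg_inj] at h1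
    exact mul_left_cancel₀ PowerSeries.X_ne_zero h1
  have hinv : PowerSeries.rescale (-1 : ℂ) v⁻¹ = v⁻¹ := by
    have h1 := congrArg (PowerSeries.rescale (-1 : ℂ)) (PowerSeries.mul_inv_cancel v hv0)
    rw [map_mul, hveven, map_one] at h1
    rw [PowerSeries.eq_inv_iff_mul_eq_one hv0, mul_comm, h1]
  have htau : tau n = HahnSeries.single (-1) 1 * HahnSeries.ofPowerSeries ℤ ℂ v⁻¹ := by
    rw [tau]
    refine inv_eq_of_mul_eq_one_left ?_
    rw [hqbr, hv, map_mul, HahnSeries.ofPowerSeries_X, mul_mul_mul_comm,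
      HahnSeries.single_mul_single, ← map_mul, PowerSeries.inv_mul_cancel v hv0, map_one]
    simp
  rw [htau, HahnSeries.coeff_single_mul, one_mul, PowerSeries.coeff_coe]
  split_ifs with h0
  · rfl
  · obtain ⟨r, hr⟩ := Int.eq_ofNat_of_zero_le (not_lt.mp h0)
    rw [hr, Int.natAbs_natCast]
    have hodd : Odd r := by
      rw [← Nat.not_even_iff_odd, ← Int.even_coe_nat, ← hr]
      exact fun e => h ⟨by omega, e⟩
    have h2 := congrArg (PowerSeries.coeff r) hinv
    rw [PowerSeries.coeff_rescale, hodd.neg_one_pow] at h2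
    linear_combination (-1 / 2 : ℂ) * h2

theorem spec_mem_genusSubgroup (n : ℕ+) : spec n ∈ genusSubgroup ℂ (-1) := by
  intro k j hj
  rw [spec, PowerSeries.coeff_C_mul, map_sub, PowerSeries.coeff_one, PowerSeries.coeff_X_pow]
  have h := coeff_tau_eq_zero n hj
  split_ifs <;> simp [h]

/-- The coefficients of the Schur functions in the amplitude, with the framing as a variable. -/
def framedWeight (μ : YoungDiagram) : FramedCoef :=
  framingFactor (kappa μ) * constFraming (MvPolynomial.aeval spec (schur μ))

/-- The logarithm of `∑_μ q^{a κ_μ / 2} s_μ[spec] s_μ`, with the framing `a` as a variable. -/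
def framedLog : MvPowerSeries ℕ+ FramedCoef :=
  (PowerSeries.log FramedCoef).subst (schurSeries framedWeight - 1)

theorem evalFraming_framedWeight (a : ℂ) (μ : YoungDiagram) : evalFraming a (framedWeight μ) =
    PowerSeries.C (qpow (a * kappa μ / 2)) * MvPolynomial.aeval spec (schur μ) := by
  rw [framedWeight, map_mul, evalFraming_framingFactor, evalFraming_constFraming]

theorem constantCoeff_framedSeries :
    MvPowerSeries.constantCoeff (schurSeries framedWeight) = 1 := by
  rw [constantCoeff_schurSeries, framedWeight, schur_bot, map_one, map_one, mul_one, kappa_bot,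
    framingFactor]
  have e : (PowerSeries.mk fun r => Polynomial.C ((Complex.I * ((0 : ℤ) : ℂ) / 2) ^ r *
      ((r.factorial : ℂ))⁻¹) * Polynomial.X ^ r : PowerSeries (Polynomial ℂ)) = 1 := by
    ext1 r
    rcases r with _ | r
    · simp
    · simp [PowerSeries.coeff_one]
  rw [e, map_one, map_one]

/-- Specialization of the framing commutes with the logarithm. -/
theorem map_framedLog (a : ℂ) : MvPowerSeries.map (evalFraming a) framedLog =
    (PowerSeries.log Coef).subst (schurSeries (fun μ =>
      PowerSeries.C (qpow (a * kappa μ / 2)) * MvPolynomial.aeval spec (schur μ)) - 1) := by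
  rw [framedLog, PowerSeries.map_subst, PowerSeries.map_log, map_sub, map_one, map_schurSeries]
  · simp only [evalFraming_framedWeight]
  · refine PowerSeries.HasSubst.of_constantCoeff_zero ?_
    rw [map_sub, constantCoeff_framedSeries, map_one, sub_self]

theorem evalFraming_zero_coeff_framedLog_mem (m : ℕ+ →₀ ℕ) :
    evalFraming 0 (MvPowerSeries.coeff m framedLog) ∈ genusSubgroup ℂ ((expLen m : ℤ) - 2) := by
  rw [← MvPowerSeries.coeff_map, map_framedLog]
  simp only [zero_mul, zero_div, qpow_zero, map_one, one_mul]
  by_cases h0 : m = 0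
  · rw [h0, MvPowerSeries.coeff_zero_eq_constantCoeff_apply, constantCoeff_log_subst]
    · exact AddSubgroup.zero_mem _
    · rw [map_sub, constantCoeff_schurSeries, schur_bot, map_one, map_one, sub_self]
  · obtain ⟨n, hn⟩ := Finsupp.ne_iff.mp h0
    have hn' : Finsupp.single n 1 ≤ m := Finsupp.single_le_iff.mpr (Nat.one_le_iff_ne_zero.mpr hn)
    obtain ⟨m', rfl⟩ := exists_add_of_le hn'
    rw [add_comm, coeff_log_schurSeries_aeval]
    split_ifs with h
    · have e : ((expLen (m' + Finsupp.single n 1) : ℕ) : ℤ) - 2 = -1 := by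
        rw [h, zero_add, expLen_single]
        norm_num
      rw [e]
      exact smul_mem_genusSubgroup _ (spec_mem_genusSubgroup n)
    · exact AddSubgroup.zero_mem _

/-- The cut-and-join equation for the free energy. -/
theorem framingDerivation_coeff_framedLog {M : ℕ} {m : ℕ+ →₀ ℕ} (hm : expSize m ≤ M) :
    framingDerivation (MvPowerSeries.coeff m framedLog) =
      halfLambda * (MvPowerSeries.coeff m (cutJoinSeries FramedCoef M framedLog) +
        MvPowerSeries.coeff m (joinSquare M framedLog)) := by
  have hw : (fun μ => framingDerivation (framedWeight μ)) =
      fun μ => halfLambda * ((kappa μ : FramedCoef) * framedWeight μ) := by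
    ext1 μ
    rw [framedWeight, SelfDerivation.map_mul, framingDerivation_constFraming, mul_zero, zero_add,
      framingDerivation_framingFactor]
    ring
  have h : ∀ m, expSize m ≤ M →
      framingDerivation (MvPowerSeries.coeff m (schurSeries framedWeight)) =
        halfLambda * MvPowerSeries.coeff m
          (cutJoinSeries FramedCoef M (schurSeries framedWeight)) := by
    intro m hm
    rw [derivation_coeff_schurSeries, coeff_cutJoinSeries_schurSeries _ hm, hw,
      coeff_schurSeries_mul]
  rw [framedLog]
  exact cutJoin_log constantCoeff_framedSeries framingDerivation halfLambda h hm

/-- The coefficient of `p_η` in the free energy only involves `λ^j` with `j ≥ l(η) - 2` and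
`j ≡ l(η) mod 2`. This holds at framing zero and is propagated by the cut-and-join equation. -/
theorem coeff_framedLog_mem (m : ℕ+ →₀ ℕ) : MvPowerSeries.coeff m framedLog ∈
    genusSubgroup (Polynomial ℂ) ((expLen m : ℤ) - 2) := by
  obtain ⟨d, hd⟩ : ∃ d, expSize m = d := ⟨_, rfl⟩
  induction d using Nat.strong_induction_on generalizing m with
  | _ d ih =>
  intro k j hj
  have hQ : ∀ m, expSize m = d → MvPowerSeries.coeff m (joinSquare d framedLog) ∈
      genusSubgroup (Polynomial ℂ) ((expLen m : ℤ) - 3) := by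
    intro m hm
    -- the quadratic term only involves coefficients of smaller size
    refine coeff_joinSquare_mem fun m₁ m₂ h1 h2 h3 h4 => ?_
    have h := mul_mem_genusSubgroup (ih (expSize m₁) (by omega) m₁ rfl)
      (ih (expSize m₂) (by omega) m₂ rfl)
    have e : ((expLen m₁ : ℤ) - 2) + ((expLen m₂ : ℤ) - 2) = (expLen m : ℤ) - 3 := by omega
    rwa [e] at h
  -- a common lower bound for the exponents of `λ` in the finitely many coefficients of size `d`
  obtain ⟨J, hJ⟩ : ∃ J : ℤ, ∀ m ∈ expsOf d, J ≤
      (PowerSeries.coeff k (MvPowerSeries.coeff m framedLog)).order := by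
    obtain ⟨J, hJ⟩ := ((expsOf d).image fun m =>
      (PowerSeries.coeff k (MvPowerSeries.coeff m framedLog)).order).bddBelow
    exact ⟨J, fun m hm => hJ (Finset.mem_coe.mpr (Finset.mem_image_of_mem _ hm))⟩
  -- the factor `λ` in the cut-and-join equation gains one order of `λ` in each step
  have key : ∀ n : ℕ, ∀ m, expSize m = d → MvPowerSeries.coeff m framedLog ∈
      truncGenusSubgroup (Polynomial ℂ) k ((expLen m : ℤ) - 2) (J + n) := by
    intro n
    induction n with
    | zero =>
      intro m hm j hj _
      rw [Nat.cast_zero, add_zero] at hj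
      exact HahnSeries.coeff_eq_zero_of_lt_order (lt_of_lt_of_le hj (hJ m (mem_expsOf.mpr hm)))
    | succ n ihn =>
      intro m hm j hjn hj
      have hD : MvPowerSeries.coeff m (cutJoinSeries FramedCoef d framedLog) ∈
          truncGenusSubgroup (Polynomial ℂ) k ((expLen m : ℤ) - 3) (J + n) := by
        refine coeff_cutJoinSeries_mem fun m' h1 h2 => ?_
        refine truncGenusSubgroup_mono ?_ ?_ (ihn m' (h1.trans hm))
        · omega
        · rcases h2 with h2 | h2
          · exact ⟨1, by omega⟩
          · exact ⟨0, by omega⟩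
      have h1 := C_single_mul_mem_truncGenusSubgroup (Polynomial.C (Complex.I / 2))
        (AddSubgroup.add_mem _ hD (mem_truncGenusSubgroup_of_mem (hQ m hm)))
      have h2 := framingDerivation_coeff_framedLog (le_of_eq hm)
      -- the coefficient is a polynomial in the framing: it vanishes if its derivative and its value
      -- at framing zero do
      refine eq_zero_of_derivative_eq_zero ?_ ?_
      · rw [← coeff_framingDerivation, h2]
        refine h1 j ?_ ?_
        · push_cast at hjn
          omega
        · rwa [sub_add, show (3 : ℤ) - 1 = 2 by norm_num]
      · rw [← coeff_evalFraming]
        exact evalFraming_zero_coeff_framedLog_mem m k j hj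
  exact key (j - J + 1).toNat m hd j (by omega) hj

/-! ### The free energy -/

section Scale

variable {S : Type*} [CommRing S]

/-- The substitution `p_n ↦ c p_n`. -/
def lengthScale (c : S) (f : MvPowerSeries ℕ+ S) : MvPowerSeries ℕ+ S := fun m =>
  c ^ expLen m * MvPowerSeries.coeff m f

theorem coeff_lengthScale (c : S) (f : MvPowerSeries ℕ+ S) (m : ℕ+ →₀ ℕ) :
    MvPowerSeries.coeff m (lengthScale c f) = c ^ expLen m * MvPowerSeries.coeff m f := rfl

theorem constantCoeff_lengthScale (c : S) (f : MvPowerSeries ℕ+ S) :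
    MvPowerSeries.constantCoeff (lengthScale c f) = MvPowerSeries.constantCoeff f := by
  rw [← MvPowerSeries.coeff_zero_eq_constantCoeff_apply, coeff_lengthScale,
    MvPowerSeries.coeff_zero_eq_constantCoeff_apply]
  simp [expLen]

theorem lengthScale_mul (c : S) (f g : MvPowerSeries ℕ+ S) :
    lengthScale c (f * g) = lengthScale c f * lengthScale c g := by
  classical
  ext m
  rw [coeff_lengthScale, MvPowerSeries.coeff_mul, MvPowerSeries.coeff_mul, Finset.mul_sum]
  refine Finset.sum_congr rfl fun p hp => ?_
  rw [← mem_antidiagonal.mp hp, expLen_add, coeff_lengthScale, coeff_lengthScale]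
  ring

theorem lengthScale_log [Algebra ℚ S] (c : S) {B : MvPowerSeries ℕ+ S}
    (hB : MvPowerSeries.constantCoeff B = 1) :
    lengthScale c ((PowerSeries.log S).subst (B - 1)) =
      (PowerSeries.log S).subst (lengthScale c B - 1) := by
  have hE : ∀ f : MvPowerSeries ℕ+ S,
      sizeDerivation S (lengthScale c f) = lengthScale c (sizeDerivation S f) := by
    intro f
    ext m
    rw [coeff_sizeDerivation, coeff_lengthScale, coeff_lengthScale, coeff_sizeDerivation]
    ring
  refine eq_log_of_mul_sizeDerivation ?_ ?_ ?_
  · rw [constantCoeff_lengthScale, hB]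
  · rw [constantCoeff_lengthScale, constantCoeff_log_subst]
    rw [map_sub, hB, map_one, sub_self]
  · rw [hE, hE, ← lengthScale_mul, mul_sizeDerivation_log hB]

end Scale

/-- The normalized amplitude without the factors `√-1`. -/
def conifoldSeries (a : ℂ) : MvPowerSeries ℕ+ Coef := schurSeries fun μ =>
  PowerSeries.C (qpow (a * kappa μ / 2)) * MvPolynomial.aeval spec (schur μ)

theorem constantCoeff_conifoldSeries (a : ℂ) :
    MvPowerSeries.constantCoeff (conifoldSeries a) = 1 := by
  rw [conifoldSeries, constantCoeff_schurSeries, kappa_bot, schur_bot]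
  simp [qpow_zero]

theorem normAmplitude_eq (a : ℂ) : normAmplitude a =
    lengthScale (PowerSeries.C (HahnSeries.C (Complex.I)⁻¹)) (conifoldSeries a) := by
  ext1 m
  rw [coeff_normAmplitude, coeff_lengthScale, conifoldSeries, coeff_schurSeries, Finset.mul_sum]
  refine Finset.sum_congr rfl fun μ _ => ?_
  have h : algebraMap ℚ Coef (MvPolynomial.coeff m (schur μ)) =
      PowerSeries.C (HahnSeries.C ((MvPolynomial.coeff m (schur μ) : ℚ) : ℂ)) :=
    DFunLike.congr_fun (RingHom.ext_rat (algebraMap ℚ Coef)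
      ((PowerSeries.C.comp HahnSeries.C).comp (algebraMap ℚ ℂ))) _
  rw [h, ← map_pow, ← map_pow, div_eq_mul_inv _ (Complex.I ^ expLen m), ← inv_pow, map_mul, map_mul]
  ring

theorem freeEnergy_eq (a : ℂ) : freeEnergy a =
    lengthScale (PowerSeries.C (HahnSeries.C (Complex.I)⁻¹))
      (MvPowerSeries.map (evalFraming a) framedLog) := by
  rw [freeEnergy, normAmplitude_eq, ← lengthScale_log _ (constantCoeff_conifoldSeries a),
    map_framedLog, conifoldSeries]

theorem coeff_freeEnergy_mem (a : ℂ) (m : ℕ+ →₀ ℕ) :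
    MvPowerSeries.coeff m (freeEnergy a) ∈ genusSubgroup ℂ ((expLen m : ℤ) - 2) := by
  intro k j hj
  rw [freeEnergy_eq, coeff_lengthScale, ← map_pow, ← map_pow, PowerSeries.coeff_C_mul,
    HahnSeries.C_mul_eq_smul, HahnSeries.coeff_smul, MvPowerSeries.coeff_map, coeff_evalFraming,
    coeff_framedLog_mem m k j hj, Polynomial.eval_zero, smul_zero]

/-! ### Symmetrization -/

theorem coeff_genusSum (n : ℕ) (c : ℕ → ℂ) (j : ℤ) : (genusSum n c).coeff j =
    if (n : ℤ) - 2 ≤ j ∧ Even (j - ((n : ℤ) - 2)) then c ((j - ((n : ℤ) - 2)).toNat / 2) else 0 := by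
  rw [genusSum, HahnSeries.coeff_single_mul, one_mul, PowerSeries.coeff_coe]
  rcases lt_or_ge j ((n : ℤ) - 2) with h | h
  · rw [if_pos (by omega), if_neg (by omega)]
  · obtain ⟨r, hr⟩ := Int.eq_ofNat_of_zero_le (sub_nonneg.mpr h)
    rw [if_neg (by omega), hr, Int.natAbs_natCast, PowerSeries.coeff_mk, Int.toNat_natCast]
    simp only [h, true_and, Int.even_coe_nat]

/-- The free energy is recovered from the open string invariants. -/
theorem genusSum_openInv (a : ℂ) (k : ℕ) (μ : YoungDiagram) :
    genusSum (len μ) (fun g => openInv a g k μ) =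
      PowerSeries.coeff k (MvPowerSeries.coeff (pExp μ) (freeEnergy a)) := by
  ext j
  rw [coeff_genusSum]
  split_ifs with h
  · obtain ⟨h1, r, hr⟩ := h
    rw [openInv]
    congr 1
    omega
  · have h1 := coeff_freeEnergy_mem a (pExp μ) k j
    rw [expLen_pExp] at h1
    exact (h1 h).symm

theorem genusSum_smul_sum {ι : Type*} (n : ℕ) (s : Finset ι) (b : ℂ) (c : ι → ℕ → ℂ) :
    genusSum n (fun g => b * ∑ i ∈ s, c i g) = HahnSeries.C b * ∑ i ∈ s, genusSum n (c i) := by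
  ext j
  rw [HahnSeries.C_mul_eq_smul, HahnSeries.coeff_smul, HahnSeries.coeff_sum]
  simp only [coeff_genusSum]
  split_ifs
  · rfl
  · simp

theorem sum_coeff_symmMonomial {n d : ℕ} {μ : YoungDiagram} (hn : len μ = n) (hd : μ.card = d) :
    ∑ e ∈ Finset.finsuppAntidiag Finset.univ d, MvPowerSeries.coeff e (symmMonomial n μ) =
      (n.factorial : PowerSeries ℂ) := by
  classical
  have h : ∀ σ : Equiv.Perm (Fin n), ∑ e ∈ Finset.finsuppAntidiag Finset.univ d,
      MvPowerSeries.coeff e (∏ i : Fin n, (MvPowerSeries.X (σ i) ^ μ.rowLen i :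
        MvPowerSeries (Fin n) (PowerSeries ℂ))) = 1 := by
    intro σ
    set e₀ : Fin n →₀ ℕ := Finsupp.equivFunOnFinite.symm fun j => μ.rowLen (σ.symm j) with he₀
    have h1 : (∏ i : Fin n, (MvPowerSeries.X (σ i) ^ μ.rowLen i :
        MvPowerSeries (Fin n) (PowerSeries ℂ))) = MvPowerSeries.monomial e₀ 1 := by
      have h2 : (∏ i : Fin n, (MvPowerSeries.X (σ i) ^ μ.rowLen i :
          MvPowerSeries (Fin n) (PowerSeries ℂ))) =
            MvPowerSeries.monomial (∑ i : Fin n, Finsupp.single (σ i) (μ.rowLen i)) 1 := by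
        have h3 : ∀ s : Finset (Fin n), (∏ i ∈ s, (MvPowerSeries.X (σ i) ^ μ.rowLen i :
          MvPowerSeries (Fin n) (PowerSeries ℂ))) =
            MvPowerSeries.monomial (∑ i ∈ s, Finsupp.single (σ i) (μ.rowLen i)) 1 := by
          intro s
          induction s using Finset.induction_on with
          | empty => simp
          | insert i s hi ih =>
            rw [Finset.prod_insert hi, Finset.sum_insert hi, ih, MvPowerSeries.X_pow_eq,
              MvPowerSeries.monomial_mul_monomial, one_mul]
        exact h3 Finset.univ
      rw [h2]
      congr 1
      congr 1
      ext j
      rw [Finsupp.finsetSum_apply, he₀, Finset.sum_eq_single (σ.symm j)]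
      · simp
      · intro i _ hi
        rw [Finsupp.single_apply, if_neg]
        exact fun e => hi (by rw [← e, Equiv.symm_apply_apply])
      · simp
    have hmem : e₀ ∈ Finset.finsuppAntidiag Finset.univ d := by
      rw [Finset.mem_finsuppAntidiag]
      refine ⟨?_, Finset.subset_univ _⟩
      have : ∑ j, e₀ j = ∑ i : Fin n, μ.rowLen i :=
        Equiv.sum_comp σ.symm fun i : Fin n => μ.rowLen i
      change ∑ j, e₀ j = d
      rw [this, sum_rowLen_fin μ hn.le, hd]
    rw [h1, Finset.sum_eq_single_of_mem e₀ hmem, MvPowerSeries.coeff_monomial_same]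
    intro e _ he
    rw [MvPowerSeries.coeff_monomial_ne he]
  simp only [symmMonomial, map_sum]
  rw [Finset.sum_comm, Finset.sum_congr rfl fun σ _ => h σ]
  simp [Fintype.card_perm]

theorem coeff_PhiDiag (a : ℂ) (g n d : ℕ) : PowerSeries.coeff d (PhiDiag a g n) =
    (n.factorial : PowerSeries ℂ) * ∑ μ ∈ (partitionsOf d).filter fun μ => len μ = n,
      PowerSeries.mk fun k => Complex.I ^ n * openInv a g k μ := by
  rw [PhiDiag, PowerSeries.coeff_mk]
  have h1 : ∀ e ∈ Finset.finsuppAntidiag (Finset.univ : Finset (Fin n)) d,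
      MvPowerSeries.coeff e (Phi a g n) = ∑ μ ∈ (partitionsOf d).filter fun μ => len μ = n,
        (PowerSeries.mk fun k => Complex.I ^ n * openInv a g k μ) *
          MvPowerSeries.coeff e (symmMonomial n μ) := by
    intro e he
    have h2 : ∑ i, e i = d := (Finset.mem_finsuppAntidiag.mp he).1
    change Phi a g n e = _
    rw [Phi, h2]
  rw [Finset.sum_congr rfl h1, Finset.sum_comm, Finset.mul_sum]
  refine Finset.sum_congr rfl fun μ hμ => ?_
  rw [Finset.mem_filter, mem_partitionsOf] at hμ
  rw [← Finset.mul_sum, sum_coeff_symmMonomial hμ.2 hμ.1, mul_comm]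

/-- The factor `n!` from the permutations of the variables cancels, and the genus expansion
reassembles the coefficients of the free energy. -/
theorem coeff_nPoint (a : ℂ) (n d : ℕ) : ((n.factorial : ℚ)⁻¹) • PowerSeries.coeff d (nPoint a n) =
    ∑ μ ∈ (partitionsOf d).filter fun μ => len μ = n,
      PowerSeries.C (HahnSeries.C (Complex.I ^ n)) *
        MvPowerSeries.coeff (pExp μ) (freeEnergy a) := by
  have hsmul : ∀ (c : ℚ) (x : Coef), c • x = PowerSeries.C (HahnSeries.C (c : ℂ)) * x := by
    intro c x
    have h : PowerSeries.C (HahnSeries.C (c : ℂ)) = algebraMap ℚ Coef c :=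
      DFunLike.congr_fun (RingHom.ext_rat ((PowerSeries.C.comp HahnSeries.C).comp
        (algebraMap ℚ ℂ)) (algebraMap ℚ Coef)) c
    rw [h, ← Algebra.smul_def]
  have h1 : PowerSeries.coeff d (nPoint a n) =
      PowerSeries.C (HahnSeries.C (n.factorial : ℂ)) *
      ∑ μ ∈ (partitionsOf d).filter fun μ => len μ = n,
      PowerSeries.C (HahnSeries.C (Complex.I ^ n)) *
        MvPowerSeries.coeff (pExp μ) (freeEnergy a) := by
    rw [nPoint, PowerSeries.coeff_mk]
    ext1 k
    rw [PowerSeries.coeff_mk, ← Finset.mul_sum,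
      PowerSeries.coeff_C_mul, PowerSeries.coeff_C_mul, map_sum]
    have h2 : ∀ g, PowerSeries.coeff k (PowerSeries.coeff d (PhiDiag a g n)) =
        ((n.factorial : ℂ) * Complex.I ^ n) *
          ∑ μ ∈ (partitionsOf d).filter fun μ => len μ = n, openInv a g k μ := by
      intro g
      rw [coeff_PhiDiag, ← map_natCast PowerSeries.C, PowerSeries.coeff_C_mul, map_sum, mul_assoc,
        Finset.mul_sum (a := Complex.I ^ n)]
      simp only [PowerSeries.coeff_mk]
    simp only [h2]
    rw [genusSum_smul_sum, map_mul, mul_assoc]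
    congr 2
    refine Finset.sum_congr rfl fun μ hμ => ?_
    rw [← (Finset.mem_filter.mp hμ).2, genusSum_openInv]
  rw [hsmul, h1, ← mul_assoc, ← map_mul, ← map_mul, Rat.cast_inv, Rat.cast_natCast,
    inv_mul_cancel₀ (Nat.cast_ne_zero.mpr (Nat.factorial_ne_zero n)), map_one, map_one, one_mul]

/-! ### Restriction to one variable -/

section Diagonal

variable {S : Type*} [CommRing S]

/-- The substitution `p_n ↦ x^n`. -/
def oneVariable (f : MvPowerSeries ℕ+ S) : PowerSeries S :=
  PowerSeries.mk fun d => ∑ m ∈ expsOf d, MvPowerSeries.coeff m f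

theorem coeff_oneVariable (f : MvPowerSeries ℕ+ S) (d : ℕ) :
    PowerSeries.coeff d (oneVariable f) = ∑ m ∈ expsOf d, MvPowerSeries.coeff m f := by
  rw [oneVariable, PowerSeries.coeff_mk]

theorem expsOf_zero : expsOf 0 = {0} := by
  ext m
  rw [mem_expsOf, Finset.mem_singleton, expSize_eq_zero]

theorem constantCoeff_oneVariable (f : MvPowerSeries ℕ+ S) :
    PowerSeries.constantCoeff (oneVariable f) = MvPowerSeries.constantCoeff f := by
  rw [← PowerSeries.coeff_zero_eq_constantCoeff_apply, coeff_oneVariable, expsOf_zero,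
    Finset.sum_singleton, MvPowerSeries.coeff_zero_eq_constantCoeff_apply]

theorem oneVariable_mul (f g : MvPowerSeries ℕ+ S) :
    oneVariable (f * g) = oneVariable f * oneVariable g := by
  classical
  ext d
  rw [coeff_oneVariable, PowerSeries.coeff_mul]
  simp only [coeff_oneVariable, MvPowerSeries.coeff_mul, Finset.sum_mul_sum]
  simp only [← Finset.sum_product']
  rw [Finset.sum_sigma', Finset.sum_sigma']
  refine Finset.sum_bij' (fun x _ => ⟨(expSize x.2.1, expSize x.2.2), x.2⟩)
    (fun y _ => ⟨y.2.1 + y.2.2, y.2⟩) ?_ ?_ ?_ ?_ ?_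
  · rintro ⟨m, p⟩ h
    simp only [Finset.mem_sigma, mem_expsOf, mem_antidiagonal, Finset.mem_product] at h ⊢
    rw [← expSize_add, h.2]
    exact ⟨h.1, trivial, trivial⟩
  · rintro ⟨q, p⟩ h
    simp only [Finset.mem_sigma, mem_expsOf, mem_antidiagonal, Finset.mem_product] at h ⊢
    rw [expSize_add, h.2.1, h.2.2]
    exact ⟨h.1, trivial⟩
  · rintro ⟨m, p⟩ h
    simp only [Finset.mem_sigma, mem_antidiagonal] at h
    simp only [h.2]
  · rintro ⟨q, p⟩ h
    simp only [Finset.mem_sigma, mem_expsOf, mem_antidiagonal, Finset.mem_product] at h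
    simp only [h.2.1, h.2.2]
  · rintro ⟨m, p⟩ h
    rfl

theorem oneVariable_sizeDerivation [Algebra ℚ S] (f : MvPowerSeries ℕ+ S) :
    oneVariable (sizeDerivation S f) =
      PowerSeries.X * PowerSeries.derivative S (oneVariable f) := by
  ext d
  rw [coeff_oneVariable]
  rcases d with _ | d
  · rw [PowerSeries.coeff_zero_X_mul, expsOf_zero, Finset.sum_singleton, coeff_sizeDerivation,
      expSize_eq_zero.mpr rfl, Nat.cast_zero, zero_mul]
  · rw [PowerSeries.coeff_succ_X_mul, PowerSeries.coeff_derivative, coeff_oneVariable,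
      Finset.sum_mul]
    refine Finset.sum_congr rfl fun m hm => ?_
    rw [coeff_sizeDerivation, mem_expsOf.mp hm]
    push_cast
    ring

/-- The substitution `p_n ↦ x^n` commutes with the exponential. -/
theorem exp_subst_oneVariable_log [Algebra ℚ S] {B : MvPowerSeries ℕ+ S}
    (hB : MvPowerSeries.constantCoeff B = 1) :
    (PowerSeries.exp S).subst (oneVariable ((PowerSeries.log S).subst (B - 1))) =
      oneVariable B := by
  have hE := congrArg oneVariable (mul_sizeDerivation_log hB)
  have hL0 : PowerSeries.constantCoeff (oneVariable ((PowerSeries.log S).subst (B - 1))) = 0 := by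
    rw [constantCoeff_oneVariable, constantCoeff_log_subst]
    rw [map_sub, hB, map_one, sub_self]
  generalize (PowerSeries.log S).subst (B - 1) = F at hE hL0 ⊢
  have hs := PowerSeries.HasSubst.of_constantCoeff_zero' hL0
  refine eq_of_derivative_eq_mul (P := PowerSeries.derivative S (oneVariable F)) ?_ ?_ ?_
  · rw [constantCoeff_oneVariable, hB]
    have h : PowerSeries.constantCoeff (PowerSeries.exp S - 1) = 0 := by
      simp [PowerSeries.constantCoeff_exp]
    have h1 := PowerSeries.constantCoeff_subst_eq_zero (a := oneVariable F) hL0 _ h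
    have h2 : (1 : PowerSeries S).subst (oneVariable F) = 1 := by
      rw [← PowerSeries.coe_substAlgHom hs, map_one]
    rw [PowerSeries.subst_sub hs, h2, map_sub] at h1
    rw [← sub_eq_zero]
    exact h1
  · rw [PowerSeries.derivative_subst hs, PowerSeries.derivative_exp, mul_comm]
  · rw [oneVariable_mul, oneVariable_sizeDerivation, oneVariable_sizeDerivation,
      mul_left_comm] at hE
    have h := PowerSeries.X_mul_cancel hE
    rw [← h, mul_comm]

end Diagonal

theorem logPartition_eq (a : ℂ) :
    logPartition a = oneVariable ((PowerSeries.log Coef).subst (conifoldSeries a - 1)) := by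
  have hm : ∀ μ : YoungDiagram, PowerSeries.C (HahnSeries.C (Complex.I ^ len μ)) *
      MvPowerSeries.coeff (pExp μ) (freeEnergy a) = MvPowerSeries.coeff (pExp μ)
        ((PowerSeries.log Coef).subst (conifoldSeries a - 1)) := by
    intro μ
    rw [freeEnergy_eq, coeff_lengthScale, expLen_pExp, map_framedLog, ← conifoldSeries, ← mul_assoc,
      ← map_pow, ← map_pow, ← map_mul, ← map_mul, ← mul_pow, mul_inv_cancel₀ Complex.I_ne_zero,
      one_pow, map_one, map_one, one_mul]
  ext1 d
  rw [logPartition, PowerSeries.coeff_mk, coeff_oneVariable, sum_expsOf]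
  simp only [coeff_nPoint]
  rcases Nat.eq_zero_or_pos d with rfl | hd
  · rw [partitionsOf_zero, Finset.sum_singleton]
    have e : pExp ⊥ = 0 := by rw [← expSize_eq_zero, expSize_pExp, card_bot]
    rw [e, MvPowerSeries.coeff_zero_eq_constantCoeff_apply, constantCoeff_log_subst]
    · simp
    · rw [map_sub, constantCoeff_conifoldSeries, map_one, sub_self]
  · rw [← Finset.sum_fiberwise_of_maps_to (s := partitionsOf d) (t := Finset.Icc 1 d) (g := len)]
    · refine Finset.sum_congr rfl fun n _ => Finset.sum_congr rfl fun μ hμ => ?_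
      rw [← hm, (Finset.mem_filter.mp hμ).2]
    · intro μ hμ
      have h1 := len_le_card μ
      rw [mem_partitionsOf.mp hμ] at h1
      rw [Finset.mem_Icc]
      refine ⟨?_, h1⟩
      by_contra h0
      have h2 := sum_rowLen μ (le_refl (len μ))
      rw [show len μ = 0 by omega, mem_partitionsOf.mp hμ] at h2
      simp at h2
      omega

theorem partitionFunction_eq (a : ℂ) :
    partitionFunction a = oneVariable (conifoldSeries a) := by
  rw [partitionFunction, logPartition_eq,
    exp_subst_oneVariable_log (constantCoeff_conifoldSeries a)]

/-! ### One-row partitions -/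

/-- In one variable the Schur functions of partitions with at least two rows vanish: the first two
rows of the Jacobi-Trudi matrix agree. -/
theorem aeval_one_schur_eq_zero {R : Type*} [CommRing R] [Algebra ℚ R] {μ : YoungDiagram}
    (h : 2 ≤ len μ) : MvPolynomial.aeval (fun _ => 1 : ℕ+ → R) (schur μ) = 0 := by
  have h1 : ∀ n : ℕ, MvPolynomial.aeval (fun _ => 1 : ℕ+ → R) (hSymm n) = 1 := by
    intro n
    have := congrArg (PowerSeries.coeff n) (hSer_geom (1 : R))
    rw [coeff_hSer, PowerSeries.coeff_mk, one_pow] at this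
    simpa only [one_pow] using this
  rw [schur_eq_det μ le_rfl, AlgHom.map_det]
  refine Matrix.det_zero_of_row_eq (i := ⟨0, by omega⟩) (j := ⟨1, by omega⟩) (by simp) ?_
  ext1 j
  have hμ : 0 < μ.rowLen 1 := by
    have := (lt_len_iff (μ := μ) (i := 1)).mp (by omega)
    omega
  simp only [AlgHom.mapMatrix_apply, Matrix.map_apply, Matrix.of_apply]
  have e0 : (μ.rowLen 0 : ℤ) - ((0 : ℕ) : ℤ) + ((j : ℕ) : ℤ) = ((μ.rowLen 0 + j : ℕ) : ℤ) := by
    push_cast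
    ring
  have e1 : (μ.rowLen 1 : ℤ) - ((1 : ℕ) : ℤ) + ((j : ℕ) : ℤ) =
      ((μ.rowLen 1 - 1 + j : ℕ) : ℤ) := by
    omega
  rw [e0, e1, h1, h1]

theorem kappa_of_len_le_one {μ : YoungDiagram} (h : len μ ≤ 1) :
    kappa μ = (μ.card : ℤ) * ((μ.card : ℤ) - 1) := by
  have h1 := sum_rowLen μ h
  rw [Finset.sum_range_one] at h1
  rw [← h1, kappa]
  rcases Nat.le_one_iff_eq_zero_or_eq_one.mp h with h0 | h0
  · rw [h0, Finset.sum_range_zero, rowLen_eq_zero (by omega)]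
    simp
  · rw [h0, Finset.sum_range_one]
    push_cast
    ring

theorem coeff_oneVariable_schurSeries {R : Type*} [CommRing R] [Algebra ℚ R]
    (w : YoungDiagram → R) (d : ℕ) : PowerSeries.coeff d (oneVariable (schurSeries w)) =
      ∑ μ ∈ partitionsOf d, w μ * MvPolynomial.aeval (fun _ => 1 : ℕ+ → R) (schur μ) := by
  have h1 : ∀ m ∈ expsOf d, MvPowerSeries.coeff m (schurSeries w) =
      ∑ μ ∈ partitionsOf d, w μ * algebraMap ℚ R (MvPolynomial.coeff m (schur μ)) := by
    intro m hm
    rw [coeff_schurSeries, mem_expsOf.mp hm]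
  rw [coeff_oneVariable, Finset.sum_congr rfl h1, Finset.sum_comm]
  refine Finset.sum_congr rfl fun μ hμ => ?_
  rw [aeval_schur, mem_partitionsOf.mp hμ, Finset.mul_sum]
  refine Finset.sum_congr rfl fun m _ => ?_
  simp

/-- After the restriction to one variable only the one-row partitions contribute, and the framing
factor comes out of the sum. -/
theorem coeff_partitionFunction (a : ℂ) (d : ℕ) : PowerSeries.coeff d (partitionFunction a) =
    PowerSeries.C (qpow (a * d * (d - 1) / 2)) * MvPolynomial.aeval spec (hSymm d) := by
  have h : ∀ μ ∈ partitionsOf d, PowerSeries.C (qpow (a * kappa μ / 2)) *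
      MvPolynomial.aeval spec (schur μ) * MvPolynomial.aeval (1 : ℕ+ → Coef) (schur μ) =
      PowerSeries.C (qpow (a * d * (d - 1) / 2)) * (MvPolynomial.aeval spec (schur μ) *
        MvPolynomial.aeval (1 : ℕ+ → Coef) (schur μ)) := by
    intro μ hμ
    rcases Nat.lt_or_ge 1 (len μ) with h | h
    · have h0 : MvPolynomial.aeval (1 : ℕ+ → Coef) (schur μ) = 0 := aeval_one_schur_eq_zero h
      rw [h0, mul_zero, mul_zero, mul_zero]
    · have h0 : a * kappa μ / 2 = a * d * (d - 1) / 2 := by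
        rw [kappa_of_len_le_one h, mem_partitionsOf.mp hμ]
        push_cast
        ring
      rw [h0, mul_assoc]
  rw [partitionFunction_eq, conifoldSeries, coeff_oneVariable_schurSeries]
  refine (Finset.sum_congr rfl h).trans ?_
  rw [← Finset.mul_sum, sum_aeval_schur_mul, mul_one spec]

/-! ### The product formula -/

/-- The recursion that results from `q^n spec_n = spec_n + q^{n/2} - (q^{1/2} e^{-t})^n`. -/
theorem aeval_spec_hSymm_succ (n : ℕ) :
    (1 - PowerSeries.C (qpow ((n : ℂ) + 1))) * MvPolynomial.aeval spec (hSymm ((n + 1 : ℕ) : ℤ)) =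
      PowerSeries.C (qpow (1 / 2)) * (PowerSeries.X - PowerSeries.C (qpow n)) *
        MvPolynomial.aeval spec (hSymm n) := by
  set c : Coef := PowerSeries.C (qpow (1 / 2)) with hc
  have e : (fun n : ℕ+ => (PowerSeries.C (qpow 1) : Coef) ^ (n : ℕ) * spec n) +
      (fun n : ℕ+ => (c * PowerSeries.X) ^ (n : ℕ)) = spec + fun n : ℕ+ => c ^ (n : ℕ) := by
    ext1 n
    have h := congrArg (PowerSeries.C (R := LambdaSeries)) (qpow_mul_tau n)
    rw [map_mul, map_add, map_pow, map_pow, ← hc] at h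
    rw [Pi.add_apply, Pi.add_apply, spec, mul_pow]
    linear_combination (1 - (PowerSeries.X : Coef) ^ (n : ℕ)) * h
  have h := congrArg hSer e
  rw [hSer_add, hSer_add, hSer_scale, hSer_geom, hSer_geom] at h
  have h0 : PowerSeries.rescale (PowerSeries.C (qpow 1) : Coef) (hSer spec) *
      (1 - PowerSeries.C c * PowerSeries.X) =
      hSer spec * (1 - PowerSeries.C (c * PowerSeries.X) * PowerSeries.X) := by
    have k1 := mk_pow_mul_one_sub c
    have k2 := mk_pow_mul_one_sub (c * PowerSeries.X : Coef)
    generalize (PowerSeries.mk fun n => c ^ n) = A at h k1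
    generalize (PowerSeries.mk fun n => (c * PowerSeries.X) ^ n : PowerSeries Coef) = B at h k2
    linear_combination (1 - PowerSeries.C c * PowerSeries.X) *
      (1 - PowerSeries.C (c * PowerSeries.X) * PowerSeries.X) * h -
      PowerSeries.rescale (PowerSeries.C (qpow 1) : Coef) (hSer spec) *
        (1 - PowerSeries.C c * PowerSeries.X) * k2 +
      hSer spec * (1 - PowerSeries.C (c * PowerSeries.X) * PowerSeries.X) * k1
  have h2 := congrArg (PowerSeries.coeff (n + 1)) h0
  rw [mul_sub, mul_sub, mul_one, mul_one, ← mul_assoc, ← mul_assoc, map_sub, map_sub,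
    PowerSeries.coeff_succ_mul_X, PowerSeries.coeff_succ_mul_X, PowerSeries.coeff_mul_C,
    PowerSeries.coeff_mul_C, PowerSeries.coeff_rescale, PowerSeries.coeff_rescale, ← map_pow,
    ← map_pow, ← qpow_nat_mul, ← qpow_nat_mul, coeff_hSer, coeff_hSer, mul_one, mul_one] at h2
  push_cast at h2 ⊢
  linear_combination -h2

theorem one_sub_qpow_ne_zero {a : ℂ} (h : a ≠ 0) : 1 - qpow a ≠ 0 := by
  rw [← neg_sub, neg_ne_zero]
  exact qpow_sub_one_ne_zero h

theorem aeval_spec_hSymm (n : ℕ) : MvPolynomial.aeval spec (hSymm n) =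
    (∏ j ∈ Finset.Icc 1 n, ((PowerSeries.X - PowerSeries.C (qpow ((j : ℂ) - 1))) *
      PowerSeries.C (1 - qpow (j : ℂ))⁻¹ : Coef)) * PowerSeries.C (qpow ((n : ℂ) / 2)) := by
  induction n with
  | zero => simp [hSymm_zero, qpow_zero]
  | succ n ih =>
    have h := aeval_spec_hSymm_succ n
    have hn : 1 - qpow ((n : ℂ) + 1) ≠ 0 := one_sub_qpow_ne_zero (Nat.cast_add_one_ne_zero n)
    have h1 : (PowerSeries.C (1 - qpow ((n : ℂ) + 1))⁻¹ : Coef) *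
        (1 - PowerSeries.C (qpow ((n : ℂ) + 1))) = 1 := by
      rw [← map_one PowerSeries.C, ← map_sub, ← map_mul, inv_mul_cancel₀ hn]
    have h2 : qpow (((n + 1 : ℕ) : ℂ) / 2) = qpow (1 / 2) * qpow ((n : ℂ) / 2) := by
      rw [← qpow_add]
      congr 1
      push_cast
      ring
    rw [Finset.prod_Icc_succ_top (by omega), h2, map_mul]
    push_cast at h ⊢
    rw [add_sub_cancel_right]
    rw [ih] at h
    linear_combination (PowerSeries.C (1 - qpow ((n : ℂ) + 1))⁻¹ : Coef) * h -
      MvPolynomial.aeval spec (hSymm ((n : ℤ) + 1)) * h1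

/-- The two forms of the factors of the product formula differ by a power of `q`. -/
theorem factor_eq_factor_inv (j : ℕ) (hj : j ≠ 0) :
    ((PowerSeries.X - PowerSeries.C (qpow ((j : ℂ) - 1))) *
      PowerSeries.C (1 - qpow (j : ℂ))⁻¹ : Coef) =
    ((1 - PowerSeries.X * PowerSeries.C (qpow (-((j : ℂ) - 1)))) *
      PowerSeries.C (1 - qpow (-(j : ℂ)))⁻¹) * PowerSeries.C (qpow (-1)) := by
  have hj' : (j : ℂ) ≠ 0 := Nat.cast_ne_zero.mpr hj
  have h1 := one_sub_qpow_ne_zero hj'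
  have h2 : (1 - qpow (-(j : ℂ)))⁻¹ = -(qpow j * (1 - qpow (j : ℂ))⁻¹) := by
    rw [qpow_neg]
    have hu := inv_mul_cancel₀ (qpow_ne_zero j)
    have hv := mul_inv_cancel₀ h1
    refine inv_eq_of_mul_eq_one_right ?_
    linear_combination hv + (1 - qpow (j : ℂ))⁻¹ * hu
  have h3 : (PowerSeries.C (qpow (j : ℂ)) * PowerSeries.C (qpow (-1)) : Coef) =
      PowerSeries.C (qpow ((j : ℂ) - 1)) := by
    rw [← map_mul, ← qpow_add, ← sub_eq_add_neg]
  have h4 : (PowerSeries.C (qpow (-((j : ℂ) - 1))) * PowerSeries.C (qpow ((j : ℂ) - 1)) : Coef) =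
      1 := by
    rw [← map_mul, ← qpow_add, neg_add_cancel, qpow_zero, map_one]
  rw [h2, map_neg, map_mul]
  linear_combination (-(PowerSeries.C (1 - qpow (j : ℂ))⁻¹ : Coef) * PowerSeries.X) * h4 +
    (PowerSeries.C (1 - qpow (j : ℂ))⁻¹ : Coef) *
      (1 - PowerSeries.X * PowerSeries.C (qpow (-((j : ℂ) - 1)))) * h3

end ResolvedConifold

end

theorem mainTheorem6 (a : ℂ) :
    ResolvedConifold.partitionFunction a =
        PowerSeries.mk (fun n : ℕ =>
          (∏ j ∈ Finset.Icc 1 n,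
            ((PowerSeries.X - PowerSeries.C (ResolvedConifold.qpow ((j : ℂ) - 1))) *
              PowerSeries.C (1 - ResolvedConifold.qpow (j : ℂ))⁻¹ : ResolvedConifold.Coef)) *
          PowerSeries.C
            (ResolvedConifold.qpow (a * (n : ℂ) * ((n : ℂ) - 1) / 2 + (n : ℂ) / 2))) ∧
      ResolvedConifold.partitionFunction a =
        PowerSeries.mk (fun n : ℕ =>
          (∏ j ∈ Finset.Icc 1 n,
            ((1 - PowerSeries.X * PowerSeries.C (ResolvedConifold.qpow (-((j : ℂ) - 1)))) *
              PowerSeries.C (1 - ResolvedConifold.qpow (-(j : ℂ)))⁻¹ : ResolvedConifold.Coef)) *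
          PowerSeries.C
            (ResolvedConifold.qpow (a * (n : ℂ) * ((n : ℂ) - 1) / 2 - (n : ℂ) / 2))) := by
  have h1 : ∀ n, PowerSeries.coeff n (ResolvedConifold.partitionFunction a) =
      (∏ j ∈ Finset.Icc 1 n,
        ((PowerSeries.X - PowerSeries.C (ResolvedConifold.qpow ((j : ℂ) - 1))) *
          PowerSeries.C (1 - ResolvedConifold.qpow (j : ℂ))⁻¹ : ResolvedConifold.Coef)) *
      PowerSeries.C
        (ResolvedConifold.qpow (a * (n : ℂ) * ((n : ℂ) - 1) / 2 + (n : ℂ) / 2)) := by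
    intro n
    rw [ResolvedConifold.coeff_partitionFunction, ResolvedConifold.aeval_spec_hSymm,
      ResolvedConifold.qpow_add, map_mul]
    ring
  refine ⟨?_, ?_⟩
  · ext1 n
    rw [h1, PowerSeries.coeff_mk]
  · ext1 n
    rw [h1, PowerSeries.coeff_mk, Finset.prod_congr rfl fun j hj =>
      ResolvedConifold.factor_eq_factor_inv j (by have := Finset.mem_Icc.mp hj; omega),
      Finset.prod_mul_distrib, Finset.prod_const, Nat.card_Icc, Nat.add_sub_cancel, mul_assoc,
      ← map_pow, ← map_mul, ← ResolvedConifold.qpow_nat_mul, ← ResolvedConifold.qpow_add]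
    congr 3
    ring
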